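/- A polygonal 2-tree is a simple graph obtained as follows: every cycle is a polygonal 2-tree; and if $H$ is a polygonal 2-tree with an edge $uv \in E(H)$, and $P$ is a path between $u$ and $v$ with $|E(P)| \ge 2$, $E(H)\cap E(P)=\emptyset$ and $V(H)\cap V(P)=\{u,v\}$, then $H\cup P$ is a polygonal 2-tree. For a spanning tree $T$ of a graph $G$, the average stretch of $T$ is $$\frac{1}{|E(G)|}\sum_{uv\in E(G)} d_T(u,v),$$ where $d_T(u,v)$ is the distance between $u$ and $v$ in $T$; a minimum average stretch spanning tree of $G$ is a spanning tree of $G$ that minimizes the average stretch among all spanning trees of $G$. **Theorem.** Given a polygonal 2-tree $G$ on $n$ vertices, a minimum average stretch spanning tree of $G$ can be computed in $O(n\log n)$ time. That is, there are a program for the unit-cost random access machine with words of $O(\log n)$ bits and a constant $C$ such that, for every polygonal 2-tree $G$ with vertex set $\{0,\dots,n-1\}$, given as a list of its edges in any order, the program halts after at most $C\, n\log n$ steps and marks in the list the edges of a minimum average stretch spanning tree of $G$. -/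

import Mathlib

/-! ### Polygonal 2-trees -/

/-- The subgraphs of `G` that arise by the construction of polygonal 2-trees: a cycle is one, and
if `u v` is an edge of such an `H`, then so is the union of `H` with a path `p` from `u` to `v` with
at least two edges, that has no edge in common with `H` and exactly the vertices `u`, `v` in common
with `H`. -/
inductive SimpleGraph.Subgraph.IsPolygonal2Tree {V : Type*} {G : SimpleGraph V} :
    G.Subgraph → Prop
  | cycle {u : V} (p : G.Walk u u) (hp : p.IsCycle) : IsPolygonal2Tree p.toSubgraph
  | addPath {H : G.Subgraph} {u v : V} (hH : IsPolygonal2Tree H) (huv : H.Adj u v)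
      (p : G.Walk u v) (hp : p.IsPath) (hlen : 2 ≤ p.length)
      (hE : H.edgeSet ∩ p.toSubgraph.edgeSet = ∅)
      (hV : H.verts ∩ p.toSubgraph.verts = {u, v}) : IsPolygonal2Tree (H ⊔ p.toSubgraph)

/-- A graph is a polygonal 2-tree if the construction above produces all of it. -/
def SimpleGraph.IsPolygonal2Tree {V : Type*} (G : SimpleGraph V) : Prop :=
  (⊤ : G.Subgraph).IsPolygonal2Tree

/-! ### Average stretch -/

/-- The distance in `T` between the two ends of `e`. -/
noncomputable def SimpleGraph.stretch {V : Type*} (T : SimpleGraph V) (e : Sym2 V) : ℕ :=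
  Sym2.lift ⟨fun u v => T.dist u v, fun _ _ => T.dist_comm⟩ e

open Classical in
/-- The average, over the edges of `G`, of the distance in `T` between the ends of the edge. -/
noncomputable def SimpleGraph.avgStretch {V : Type*} [Fintype V] (G T : SimpleGraph V) : ℚ :=
  (∑ e ∈ G.edgeFinset, (T.stretch e : ℚ)) / (G.edgeFinset.card : ℚ)

/-- `T` is a spanning tree of `G` (it has all the vertices of `G`, since both graphs live on `V`). -/
def SimpleGraph.IsSpanningTree {V : Type*} (G T : SimpleGraph V) : Prop :=
  T ≤ G ∧ T.IsTree

/-- `T` is a minimum average stretch spanning tree of `G`. -/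
def SimpleGraph.IsMinAvgStretchSpanningTree {V : Type*} [Fintype V] (G T : SimpleGraph V) : Prop :=
  G.IsSpanningTree T ∧ ∀ T' : SimpleGraph V, G.IsSpanningTree T' → G.avgStretch T ≤ G.avgStretch T'

/-! ### The word RAM

A deterministic random access machine with unit cost per instruction. A program is a finite text
that mentions finitely many registers and finitely many arrays of memory words, by constant names
(which is the same as one memory in which these arrays are interleaved, up to a constant factor in
the running time). An index into an array is the contents of a register. Every word that an instruction computes has
to be smaller than the word bound `W`; a computation that would exceed it has no result. -/

namespace RAM

/-- The contents of the registers and of the arrays. -/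
structure State where
  /-- the word in register `x` -/
  reg : ℕ → ℕ
  /-- the word at index `i` of array `a` -/
  arr : ℕ → ℕ → ℕ

/-- Write the word `k` into register `x`. -/
def State.setReg (s : State) (x k : ℕ) : State :=
  { s with reg := Function.update s.reg x k }

/-- Write the word `k` at index `i` of array `a`. -/
def State.setArr (s : State) (a i k : ℕ) : State :=
  { s with arr := Function.update s.arr a (Function.update (s.arr a) i k) }

/-- Arithmetic instructions. -/
inductive Op
  | add | sub | mul | div | mod

/-- The results of the arithmetic instructions on words (subtraction is cut off at `0`). -/
def Op.eval : Op → ℕ → ℕ → ℕ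
  | .add, a, b => a + b
  | .sub, a, b => a - b
  | .mul, a, b => a * b
  | .div, a, b => a / b
  | .mod, a, b => a % b

/-- Comparisons. -/
inductive Cmp
  | lt | le | eq

/-- The meaning of the comparisons. -/
def Cmp.holds : Cmp → ℕ → ℕ → Prop
  | .lt, a, b => a < b
  | .le, a, b => a ≤ b
  | .eq, a, b => a = b

/-- Programs. -/
inductive Prog
  /-- do nothing -/
  | skip
  /-- `x := k` -/
  | const (x k : ℕ)
  /-- `x := y` -/
  | copy (x y : ℕ)
  /-- `x := y o z` -/
  | op (o : Op) (x y z : ℕ)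
  /-- `x := a[y]` -/
  | load (x a y : ℕ)
  /-- `a[y] := z` -/
  | store (a y z : ℕ)
  /-- `p; q` -/
  | seq (p q : Prog)
  /-- `if x r y then p else q` -/
  | ite (r : Cmp) (x y : ℕ) (p q : Prog)
  /-- `while x r y do p` -/
  | while (r : Cmp) (x y : ℕ) (p : Prog)

/-- `Exec W P s t s'`: started in the state `s`, the program `P` halts after exactly `t` steps in the
state `s'`, and every word that it computes on the way is smaller than `W`. Each instruction and
each evaluation of the condition of a branch or a loop is one step. -/
inductive Exec (W : ℕ) : Prog → State → ℕ → State → Prop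
  | skip (s : State) : Exec W .skip s 1 s
  | const (s : State) (x k : ℕ) (h : k < W) : Exec W (.const x k) s 1 (s.setReg x k)
  | copy (s : State) (x y : ℕ) : Exec W (.copy x y) s 1 (s.setReg x (s.reg y))
  | op (s : State) (o : Op) (x y z : ℕ) (h : o.eval (s.reg y) (s.reg z) < W) :
      Exec W (.op o x y z) s 1 (s.setReg x (o.eval (s.reg y) (s.reg z)))
  | load (s : State) (x a y : ℕ) : Exec W (.load x a y) s 1 (s.setReg x (s.arr a (s.reg y)))
  | store (s : State) (a y z : ℕ) :
      Exec W (.store a y z) s 1 (s.setArr a (s.reg y) (s.reg z))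
  | seq {p q : Prog} {s₁ s₂ s₃ : State} {t₁ t₂ : ℕ}
      (hp : Exec W p s₁ t₁ s₂) (hq : Exec W q s₂ t₂ s₃) : Exec W (.seq p q) s₁ (t₁ + t₂) s₃
  | iteTrue {r : Cmp} {x y : ℕ} {p q : Prog} {s s' : State} {t : ℕ}
      (h : r.holds (s.reg x) (s.reg y)) (hp : Exec W p s t s') :
      Exec W (.ite r x y p q) s (t + 1) s'
  | iteFalse {r : Cmp} {x y : ℕ} {p q : Prog} {s s' : State} {t : ℕ}
      (h : ¬ r.holds (s.reg x) (s.reg y)) (hq : Exec W q s t s') :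
      Exec W (.ite r x y p q) s (t + 1) s'
  | whileTrue {r : Cmp} {x y : ℕ} {p : Prog} {s₁ s₂ s₃ : State} {t₁ t₂ : ℕ}
      (h : r.holds (s₁.reg x) (s₁.reg y)) (hp : Exec W p s₁ t₁ s₂)
      (hw : Exec W (.while r x y p) s₂ t₂ s₃) : Exec W (.while r x y p) s₁ (t₁ + t₂ + 1) s₃
  | whileFalse {r : Cmp} {x y : ℕ} {p : Prog} {s : State}
      (h : ¬ r.holds (s.reg x) (s.reg y)) : Exec W (.while r x y p) s 1 s

/-- The machine is deterministic: the running time and the final state are determined. -/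
theorem Exec.unique {W : ℕ} {P : Prog} {s s₁ s₂ : State} {t₁ t₂ : ℕ}
    (h₁ : Exec W P s t₁ s₁) (h₂ : Exec W P s t₂ s₂) : t₁ = t₂ ∧ s₁ = s₂ := by
  induction h₁ generalizing t₂ s₂ with
  | seq _ _ ihp ihq =>
    cases h₂ with
    | seq hp hq =>
      obtain ⟨rfl, rfl⟩ := ihp hp
      obtain ⟨rfl, rfl⟩ := ihq hq
      exact ⟨rfl, rfl⟩
  | iteTrue h _ ih =>
    cases h₂ with
    | iteTrue _ hp => obtain ⟨rfl, rfl⟩ := ih hp; exact ⟨rfl, rfl⟩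
    | iteFalse h' _ => exact absurd h h'
  | iteFalse h _ ih =>
    cases h₂ with
    | iteTrue h' _ => exact absurd h' h
    | iteFalse _ hq => obtain ⟨rfl, rfl⟩ := ih hq; exact ⟨rfl, rfl⟩
  | whileTrue h _ _ ihp ihw =>
    cases h₂ with
    | whileTrue _ hp hw =>
      obtain ⟨rfl, rfl⟩ := ihp hp
      obtain ⟨rfl, rfl⟩ := ihw hw
      exact ⟨rfl, rfl⟩
    | whileFalse h' => exact absurd h h'
  | whileFalse h =>
    cases h₂ with
    | whileTrue h' _ _ => exact absurd h' h
    | whileFalse _ => exact ⟨rfl, rfl⟩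
  | _ => cases h₂; exact ⟨rfl, rfl⟩

end RAM

/-! ### Input and output -/

/-- `L` lists every edge of `G` exactly once, in any order and with its ends in either order. -/
def IsEdgeList {n : ℕ} (G : SimpleGraph (Fin n)) (L : List (Fin n × Fin n)) : Prop :=
  (L.map fun p => s(p.1, p.2)).Nodup ∧
    ∀ e : Sym2 (Fin n), e ∈ (L.map fun p => s(p.1, p.2)) ↔ e ∈ G.edgeSet

/-- The initial state: the number of vertices in register `0`, the number of edges in register `1`,
the first ends of the edges in array `0` and the second ends in array `1`; every other word is `0`. -/
def inputState {n : ℕ} (L : List (Fin n × Fin n)) : RAM.State where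
  reg := fun x => if x = 0 then n else if x = 1 then L.length else 0
  arr := fun a i =>
    if a = 0 then (L.map fun p => (p.1 : ℕ)).getD i 0
    else if a = 1 then (L.map fun p => (p.2 : ℕ)).getD i 0
    else 0

/-- The graph that a final state describes: the `i`-th edge of the list belongs to it if and only if
the word at index `i` of array `2` is `1`. -/
def outputGraph {n : ℕ} (L : List (Fin n × Fin n)) (s : RAM.State) : SimpleGraph (Fin n) :=
  SimpleGraph.fromEdgeSet {e | ∃ (i : ℕ) (h : i < L.length), s.arr 2 i = 1 ∧ e = s(L[i].1, L[i].2)}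

/-!
A polygonal 2-tree can be reduced to any one of its edges `pq`: remove a vertex `x` other than `p`,
`q` that has just two neighbours `a`, `b`, put in the edge `ab` if it is missing, and go on. The
order does not matter (`Reducible.confluent`), and an edge that is created on the way is opposite to
no vertex that is removed later. So the graph, with the created edges, is a tree of triangles `x a b`.

**The optimum.** Give weight one to the edges of the graph and zero to the created ones. When `x` is
removed, the lighter of `xa`, `xb` adds its weight to `ab` (`upPass`). Backwards from `pq`, the
prices `downD` are computed: `downD e` is the least price at which a triangle can be left through
its edge `e`. The price of the triangle is the least of the two ways out: across `x` (`lighter`), or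
through `ab` (`around`). The tree `downC` starts as `pq`; each triangle then either makes `x` a
leaf, dropping the lighter of its two edges, or replaces the tree edge `ab` by the path `a x b`, if
that is cheaper.

The optimality is a case of linear programming duality, between distances and prices. In a tree
metric, the longest side of a triangle is as long as the other two together, and an edge is the
longest side of at most one triangle. Charging the price of every triangle to its edges, with a
positive sign on the longest side and a negative sign on the others, gives a function `Φ` on the
edges such that the sum of `(d - 1) * Φ` is the
sum of all prices. For every spanning tree, `Φ` does not exceed
the weights (`ReductionSeq.exists_dual`), so the sum of the prices is a lower bound for the total
stretch minus the number of edges (`ReductionSeq.cost_le`). For the tree `downC`, the function `Φ`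
equals the weight wherever an edge of the graph is not in the tree (`ReductionSeq.exists_slack`), so
the bound is attained (`ReductionSeq.le_cost`).

**The running time.** All this takes a constant number of machine steps per vertex and edge, once
the two neighbours of a vertex can be found in constant time. The machine keeps, for each vertex,
its degree, the sum of its neighbours and the sum of their squares; when the degree is two, these
determine the two neighbours, with the help of a table of square roots. The weight of an edge `uv`
is stored at the index `key s(u, v)`, a polynomial in `u + v` and `u * v`. Vertices of degree two
wait in a queue (`PartialReduction`). A graph reducible in `k` steps has at most `2 * k + 1` edges,
so the program runs in linear time.

Programs are written with expressions instead of single instructions (`RAM.Cmd`) and verified with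
weakest preconditions (`RAM.runs_of_wp`) and loop invariants (`RAM.runs_loop`).
-/

/-! ### Betweenness in trees -/

namespace SimpleGraph.IsTree

variable {V : Type*} {T : SimpleGraph V}

theorem eq_of_adj_of_dist_add_one (hT : T.IsTree) {u y y' z : V} (h : T.Adj u y) (h' : T.Adj u y')
    (hy : T.dist y z + 1 = T.dist u z) (hy' : T.dist y' z + 1 = T.dist u z) : y = y' := by
  obtain ⟨p, hp⟩ := hT.connected.exists_walk_length_eq_dist y z
  obtain ⟨p', hp'⟩ := hT.connected.exists_walk_length_eq_dist y' z
  have hq : (Walk.cons h p).IsPath := Walk.isPath_of_length_eq_dist _ (by simp [hp, hy])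
  have hq' : (Walk.cons h' p').IsPath := Walk.isPath_of_length_eq_dist _ (by simp [hp', hy'])
  have := (hT.isAcyclic.subsingleton_path u z).elim ⟨_, hq⟩ ⟨_, hq'⟩
  have h2 := congrArg (fun q : T.Path u z => (q : T.Walk u z).snd) this
  simpa using h2

theorem exists_adj_dist_add_one (hT : T.IsTree) {u z : V} (h : u ≠ z) :
    ∃ y, T.Adj u y ∧ T.dist y z + 1 = T.dist u z := by
  obtain ⟨p, hp⟩ := hT.connected.exists_walk_length_eq_dist u z
  cases p with
  | nil => exact absurd rfl h
  | @cons _ y _ hy p =>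
    refine ⟨y, hy, ?_⟩
    have h1 := T.dist_le p
    have h2 := hT.connected.dist_triangle (u := u) (v := y) (w := z)
    have h3 := dist_eq_one_iff_adj.2 hy
    simp only [Walk.length_cons] at hp
    omega

/-- The vertices between `u` and `v` form a chain. -/
theorem dist_add_dist_or (hT : T.IsTree) {u v p q : V}
    (hp : T.dist u p + T.dist p v = T.dist u v) (hq : T.dist u q + T.dist q v = T.dist u v) :
    T.dist u p + T.dist p q = T.dist u q ∨ T.dist u q + T.dist q p = T.dist u p := by
  induction hk : T.dist u p generalizing u with
  | zero =>
    obtain rfl := hT.connected.dist_eq_zero_iff.1 hk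
    left; omega
  | succ k ih =>
    by_cases hu : u = q
    · subst hu; right; simp [hk]
    have hup : u ≠ p := by rintro rfl; simp at hk
    obtain ⟨y, hy, hyp⟩ := hT.exists_adj_dist_add_one hup
    obtain ⟨y', hy', hyq⟩ := hT.exists_adj_dist_add_one hu
    have t := fun a b c => hT.connected.dist_triangle (u := a) (v := b) (w := c)
    have e := dist_eq_one_iff_adj.2 hy
    have e' := dist_eq_one_iff_adj.2 hy'
    have h1 := t y p v
    have h2 := t u y v
    have h3 := t y' q v
    have h4 := t u y' v
    obtain rfl : y = y' := hT.eq_of_adj_of_dist_add_one (z := v) hy hy' (by omega) (by omega)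
    have := ih (u := y) (by omega) (by omega) (by omega)
    omega

/-- Any three vertices of a tree have a median. -/
theorem exists_median (hT : T.IsTree) (u v w : V) :
    ∃ m, T.dist u m + T.dist m v = T.dist u v ∧ T.dist u m + T.dist m w = T.dist u w ∧
      T.dist v m + T.dist m w = T.dist v w := by
  induction hk : T.dist u v generalizing u with
  | zero =>
    obtain rfl := hT.connected.dist_eq_zero_iff.1 hk
    exact ⟨u, by simp, by simp, by simp⟩
  | succ k ih =>
    have huv : u ≠ v := by rintro rfl; simp at hk
    obtain ⟨y, hy, hyv⟩ := hT.exists_adj_dist_add_one huv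
    have t := fun a b c => hT.connected.dist_triangle (u := a) (v := b) (w := c)
    have e := dist_eq_one_iff_adj.2 hy
    have e' := dist_eq_one_iff_adj.2 hy.symm
    obtain ⟨m, h1, h2, h3⟩ := ih y (by omega)
    have a1 := t u y m
    have a2 := t u m v
    have a3 := t u m w
    have c1 := T.dist_comm (u := u) (v := v)
    have c2 := T.dist_comm (u := y) (v := v)
    rcases hT.dist_eq_dist_add_one_of_adj w hy with h | h <;>
      rw [T.dist_comm (u := w), T.dist_comm (u := w)] at h
    · exact ⟨m, by omega, by omega, h3⟩
    · by_cases hm : y = m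
      · subst hm
        exact ⟨u, by simp [hk], by simp, by omega⟩
      · -- the first step from `y` to `m` leads towards `w`, hence to `u`, and also towards `v`
        obtain ⟨z, hz, hzm⟩ := hT.exists_adj_dist_add_one hm
        have ez := dist_eq_one_iff_adj.2 hz
        have b1 := t z m w
        have b2 := t y z w
        obtain rfl : z = u := hT.eq_of_adj_of_dist_add_one (z := w) hz hy.symm (by omega) (by omega)
        omega

end SimpleGraph.IsTree

/-! ### Reduction of polygonal 2-trees to an edge -/

section Reduction

variable {V : Type*}

/-- The neighbours of `x` in the set of edges `A` are precisely the two vertices `a` and `b`. -/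
structure HasTwoNeighbors (A : Set (Sym2 V)) (x a b : V) : Prop where
  ne : a ≠ b
  ne_left : x ≠ a
  ne_right : x ≠ b
  mem_iff : ∀ y, s(x, y) ∈ A ↔ y = a ∨ y = b

/-- Remove the vertex `x` and put in the edge `ab`. -/
def reduce (A : Set (Sym2 V)) (x a b : V) : Set (Sym2 V) :=
  insert s(a, b) {e ∈ A | x ∉ e}

/-- `A` can be reduced to the single edge `pq` in `k` steps, each of which removes a vertex `x`
other than `p`, `q` that has precisely two neighbours `a`, `b`, and puts in `ab` if `ab` is not
yet an edge. An edge `ab` that was there before has to be in `R`; so the edges that the reduction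
itself creates are not used a second time in this way. -/
inductive Reducible (R : Set (Sym2 V)) (p q : V) : ℕ → Set (Sym2 V) → Prop
  | edge : Reducible R p q 0 {s(p, q)}
  | step {k : ℕ} {A : Set (Sym2 V)} {x a b : V} (hp : x ≠ p) (hq : x ≠ q)
      (h : HasTwoNeighbors A x a b) (hR : s(a, b) ∈ A → s(a, b) ∈ R)
      (hk : Reducible R p q k (reduce A x a b)) : Reducible R p q (k + 1) A

variable {R A B : Set (Sym2 V)} {p q x y z a b c d : V} {k : ℕ}

theorem HasTwoNeighbors.symm (h : HasTwoNeighbors A x a b) : HasTwoNeighbors A x b a :=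
  ⟨h.ne.symm, h.ne_right, h.ne_left, fun y => by rw [h.mem_iff, or_comm]⟩

theorem reduce_comm (A : Set (Sym2 V)) (x a b : V) : reduce A x a b = reduce A x b a := by
  rw [reduce, reduce, Sym2.eq_swap]

theorem mem_reduce_iff {u v : V} :
    s(u, v) ∈ reduce A x a b ↔
      (u = a ∧ v = b ∨ u = b ∧ v = a) ∨ s(u, v) ∈ A ∧ u ≠ x ∧ v ≠ x := by
  simp only [reduce, Set.mem_insert_iff, Sym2.eq_iff, Set.mem_ofPred_eq, Sym2.mem_iff]
  grind

theorem Reducible.not_isDiag (hpq : p ≠ q) (h : Reducible R p q k A) : s(x, x) ∉ A := by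
  induction h generalizing x with
  | edge => simp only [Set.mem_singleton_iff, Sym2.eq_iff]; grind
  | @step k A y a b hp hq h hR hk ih =>
    intro hx
    by_cases hxy : x = y
    · subst hxy
      have := (h.mem_iff x).1 hx
      have := h.ne_left
      have := h.ne_right
      grind
    · exact ih (mem_reduce_iff.2 (.inr ⟨hx, hxy, hxy⟩))

/-- In a reducible set, a vertex other than `p`, `q` has at least two neighbours, if any. -/
theorem Reducible.exists_mem_ne (h : Reducible R p q k A) (hp : x ≠ p) (hq : x ≠ q)
    (hx : s(x, y) ∈ A) : ∃ z ≠ y, s(x, z) ∈ A := by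
  induction h generalizing x y with
  | edge => simp only [Set.mem_singleton_iff, Sym2.eq_iff] at hx; grind
  | @step k A w a b hp' hq' h hR hk ih =>
    by_cases hxw : x = w
    · subst hxw
      have h1 := h.mem_iff
      have := h.ne
      by_cases hya : y = a
      · exact ⟨b, by grind, by grind⟩
      · exact ⟨a, by grind, by grind⟩
    have hswap : ∀ u v : V, s(u, v) ∈ A ↔ s(v, u) ∈ A := fun u v => by rw [Sym2.eq_swap]
    have h1 := h.mem_iff
    have h2 := h.ne_left
    have h3 := h.ne_right
    by_cases hyw : y = w
    · subst hyw
      have hab : x = a ∨ x = b := (h.mem_iff x).1 ((hswap _ _).1 hx)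
      obtain ⟨z, hz, hzA⟩ : ∃ z, z ≠ y ∧ s(x, z) ∈ A := by
        rcases hab with rfl | rfl
        · obtain ⟨z, hz, hzA⟩ := ih (y := b) hp hq (mem_reduce_iff.2 (.inl (.inl ⟨rfl, rfl⟩)))
          rw [mem_reduce_iff] at hzA
          exact ⟨z, by grind, by grind⟩
        · obtain ⟨z, hz, hzA⟩ := ih (y := a) hp hq (mem_reduce_iff.2 (.inl (.inr ⟨rfl, rfl⟩)))
          rw [mem_reduce_iff] at hzA
          exact ⟨z, by grind, by grind⟩
      exact ⟨z, hz, hzA⟩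
    · obtain ⟨z, hz, hzA⟩ := ih hp hq (mem_reduce_iff.2 (.inr ⟨hx, hxw, hyw⟩))
      rw [mem_reduce_iff] at hzA
      rcases hzA with (⟨rfl, rfl⟩ | ⟨rfl, rfl⟩) | hzA
      · exact ⟨w, by grind, by grind⟩
      · exact ⟨w, by grind, by grind⟩
      · exact ⟨z, hz, hzA.1⟩

theorem reduce_reduce_of_not_mem (h : x ≠ c ∧ x ≠ d) (h' : z ≠ a ∧ z ≠ b) :
    reduce (reduce A x a b) z c d = reduce (reduce A z c d) x a b := by
  ext e
  induction e with
  | _ u v => simp only [mem_reduce_iff]; grind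

/-- Reductions are confluent: whichever vertex with two neighbours is removed first, the reduction
can be completed. -/
theorem Reducible.confluent (h : Reducible R p q k A) (hp : x ≠ p) (hq : x ≠ q)
    (hx : HasTwoNeighbors A x a b) :
    (s(a, b) ∈ A → s(a, b) ∈ R) ∧ ∃ j, k = j + 1 ∧ Reducible R p q j (reduce A x a b) := by
  have hswap : ∀ (A : Set (Sym2 V)) (u v : V), s(u, v) ∈ A ↔ s(v, u) ∈ A :=
    fun A u v => by rw [Sym2.eq_swap]
  induction h generalizing x a b with
  | edge =>
    have := (hx.mem_iff a).2 (.inl rfl)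
    simp only [Set.mem_singleton_iff, Sym2.eq_iff] at this
    grind
  | @step k A z c d hp' hq' h hR hk ih =>
    by_cases hxz : x = z
    · subst hxz
      have h1 := hx.mem_iff
      have h2 := h.mem_iff
      have h3 := hx.ne
      have h4 : (a = c ∧ b = d) ∨ (a = d ∧ b = c) := by
        have := (h2 a).1 ((h1 a).2 (.inl rfl))
        have := (h2 b).1 ((h1 b).2 (.inr rfl))
        grind
      rcases h4 with ⟨rfl, rfl⟩ | ⟨rfl, rfl⟩
      · exact ⟨hR, k, rfl, hk⟩
      · rw [Sym2.eq_swap, reduce_comm]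
        exact ⟨hR, k, rfl, hk⟩
    by_cases hadj : x = c ∨ x = d
    · -- `x` and `z` are neighbours
      wlog hxc : x = c generalizing c d
      · exact this h.symm (by rwa [Sym2.eq_swap]) (by rwa [reduce_comm])
          (by rwa [reduce_comm]) hadj.symm (by grind)
      subst hxc
      have hz : z = a ∨ z = b := (hx.mem_iff z).1 ((hswap A z x).1 ((h.mem_iff x).2 (.inl rfl)))
      wlog hza : z = a generalizing a b
      · have := this (a := b) (b := a) hx.symm hz.symm (by grind)
        rwa [Sym2.eq_swap, reduce_comm]
      subst hza
      have e1 := hx.mem_iff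
      have e2 := h.mem_iff
      have n1 := hx.ne
      have n2 := hx.ne_right
      have n3 := h.ne
      have n4 := h.ne_right
      have hbd : b ≠ d := by
        rintro rfl
        -- otherwise `x` has only one neighbour once `z` is removed
        obtain ⟨y, hy, hyA⟩ := hk.exists_mem_ne (y := b) hp hq
          (mem_reduce_iff.2 (.inl (.inl ⟨rfl, rfl⟩)))
        rw [mem_reduce_iff] at hyA
        grind
      have hx1 : HasTwoNeighbors (reduce A z x d) x b d :=
        ⟨hbd, n2, n3, fun y => by rw [mem_reduce_iff]; grind⟩
      obtain ⟨h1, j, rfl, hj⟩ := ih hp hq hx1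
      have hz1 : HasTwoNeighbors (reduce A x z b) z b d :=
        ⟨hbd, n1, n4, fun y => by rw [mem_reduce_iff]; grind⟩
      refine ⟨fun hm => ?_, j + 1, rfl, .step hp' hq' hz1 (fun hm => h1 ?_) ?_⟩
      · grind
      · rw [mem_reduce_iff] at hm ⊢
        grind
      · convert hj using 1
        ext e
        induction e with
        | _ u v => simp only [mem_reduce_iff]; grind
    · have e1 := hx.mem_iff
      have e2 := h.mem_iff
      have n1 := hx.ne
      have n3 := h.ne
      have hza : z ≠ a ∧ z ≠ b := by
        have := hswap A z x
        constructor <;> rintro rfl <;> grind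
      have hx1 : HasTwoNeighbors (reduce A z c d) x a b :=
        ⟨n1, hx.ne_left, hx.ne_right, fun y => by rw [mem_reduce_iff]; grind⟩
      obtain ⟨h1, j, rfl, hj⟩ := ih hp hq hx1
      have hz1 : HasTwoNeighbors (reduce A x a b) z c d :=
        ⟨n3, h.ne_left, h.ne_right, fun y => by rw [mem_reduce_iff]; grind⟩
      refine ⟨fun hm => h1 (mem_reduce_iff.2 (.inr ⟨hm, by grind⟩)), j + 1, rfl,
        .step hp' hq' hz1 (fun hm => ?_) ?_⟩
      · rw [mem_reduce_iff] at hm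
        rcases hm with hm | hm
        · have : s(c, d) = s(a, b) := by rw [Sym2.eq_iff]; exact hm
          rw [this] at hR ⊢
          exact h1 (mem_reduce_iff.2 (.inl (by grind)))
        · exact hR hm.1
      · rw [reduce_reduce_of_not_mem (by grind) hza]
        exact hj

/-- Two reducible sets of edges that share just the vertices `u`, `v` of an edge `uv` can be
reduced one after the other. -/
theorem Reducible.union {u v : V} {H : Set (Sym2 V)} {j : ℕ} (hH : Reducible R u v k H)
    (hB : Reducible R p q j B) (hpq : s(p, q) ∈ B) (huv : s(u, v) ∈ B) (huvR : s(u, v) ∈ R)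
    (hV : ∀ w y y', s(w, y) ∈ H → s(w, y') ∈ B → w = u ∨ w = v) :
    Reducible R p q (k + j) (H ∪ B) := by
  have hswap : ∀ (A : Set (Sym2 V)) (u v : V), s(u, v) ∈ A ↔ s(v, u) ∈ A :=
    fun A u v => by rw [Sym2.eq_swap]
  induction hH with
  | edge =>
    rw [Set.singleton_union, Set.insert_eq_of_mem huv, Nat.zero_add]
    exact hB
  | @step k H x a b hxu hxv h hR hk ih =>
    have e1 := h.mem_iff
    have hxB : ∀ y, s(x, y) ∉ B := fun y hy => by
      have := hV x a y ((e1 a).2 (.inl rfl)) hy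
      grind
    rw [Nat.add_right_comm]
    refine .step (x := x) (a := a) (b := b) ?_ ?_ ⟨h.ne, h.ne_left, h.ne_right, ?_⟩ ?_ ?_
    · rintro rfl; exact hxB _ hpq
    · rintro rfl; exact hxB _ ((hswap _ _ _).1 hpq)
    · intro y
      rw [Set.mem_union, e1]
      have := hxB y
      tauto
    · rintro (hab | hab)
      · exact hR hab
      · have h1 := hV a x b ((hswap _ _ _).1 ((e1 a).2 (.inl rfl))) hab
        have h2 := hV b x a ((hswap _ _ _).1 ((e1 b).2 (.inr rfl))) ((hswap _ _ _).1 hab)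
        have h3 := h.ne
        have : s(a, b) = s(u, v) := by rw [Sym2.eq_iff]; grind
        rwa [this]
    · have : reduce (H ∪ B) x a b = reduce H x a b ∪ B := by
        ext e
        induction e with
        | _ y z =>
          simp only [Set.mem_union, mem_reduce_iff]
          have h1 := hxB y
          have h2 := hxB z
          have h3 := hswap B y z
          grind
      rw [this]
      apply ih
      intro w y y' hw hw'
      rw [mem_reduce_iff] at hw
      rcases hw with (⟨rfl, rfl⟩ | ⟨rfl, rfl⟩) | hw
      · exact hV _ x y' ((hswap _ _ _).1 ((e1 _).2 (.inl rfl))) hw'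
      · exact hV _ x y' ((hswap _ _ _).1 ((e1 _).2 (.inr rfl))) hw'
      · exact hV _ y y' hw.1 hw'

open SimpleGraph

variable {G : SimpleGraph V}

theorem SimpleGraph.Walk.exists_append_cons_of_mem_darts {u v : V} (w : G.Walk u v) {e : G.Dart}
    (he : e ∈ w.darts) : ∃ (w₁ : G.Walk u e.fst) (w₂ : G.Walk e.snd v),
      w = w₁.append (.cons e.adj w₂) := by
  induction w with
  | nil => simp at he
  | @cons u v' v h w ih =>
    rw [Walk.darts_cons, List.mem_cons] at he
    rcases he with rfl | he
    · exact ⟨.nil, w, rfl⟩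
    · obtain ⟨w₁, w₂, rfl⟩ := ih he
      exact ⟨.cons h w₁, w₂, rfl⟩

/-- A cycle through the edge `cd` is that edge together with a path from `d` to `c`. -/
theorem SimpleGraph.Walk.IsCycle.exists_isPath {u : V} {w : G.Walk u u} (hw : w.IsCycle)
    (h : s(c, d) ∈ w.edges) : ∃ r : G.Walk d c, r.IsPath ∧ s(d, c) ∉ r.edges ∧
      ∀ e, e ∈ w.edges ↔ e = s(d, c) ∨ e ∈ r.edges := by
  have key : ∀ e ∈ w.darts, ∃ r : G.Walk e.snd e.fst, r.IsPath ∧ s(e.fst, e.snd) ∉ r.edges ∧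
      ∀ e', e' ∈ w.edges ↔ e' = s(e.fst, e.snd) ∨ e' ∈ r.edges := by
    intro e he
    obtain ⟨w₁, w₂, rfl⟩ := w.exists_append_cons_of_mem_darts he
    have hn := hw.edges_nodup
    have hs := hw.support_nodup
    rw [Walk.edges_append, Walk.edges_cons] at hn
    rw [Walk.tail_support_append, Walk.support_cons, List.tail_cons] at hs
    refine ⟨w₂.append w₁, ?_, ?_, ?_⟩
    · rw [Walk.isPath_def, Walk.support_append]
      exact (List.perm_append_comm.nodup_iff).1 hs
    · rw [Walk.edges_append]
      have := (List.perm_middle.nodup_iff).1 hn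
      rw [List.nodup_cons, List.mem_append] at this
      rw [List.mem_append]
      tauto
    · intro e'
      simp only [Walk.edges_append, Walk.edges_cons, List.mem_append, List.mem_cons]
      tauto
  rw [Walk.edges, List.mem_map] at h
  obtain ⟨e, he, hcd⟩ := h
  change s(e.fst, e.snd) = s(c, d) at hcd
  rw [Sym2.eq_iff] at hcd
  obtain ⟨r, h1, h2, h3⟩ := key e he
  rcases hcd with ⟨rfl, rfl⟩ | ⟨rfl, rfl⟩
  · exact ⟨r, h1, by rwa [Sym2.eq_swap], fun e' => by rw [h3, Sym2.eq_swap]⟩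
  · refine ⟨r.reverse, h1.reverse, ?_, fun e' => ?_⟩
    · rwa [Walk.edges_reverse, List.mem_reverse]
    · rw [Walk.edges_reverse, List.mem_reverse, h3]

/-- A path from `w` to `v` that avoids `u`, closed up to a cycle by the edges `uv` and `uw`, can be
reduced to `uv`, from the side of `w`. -/
theorem reducible_path {u w v : V} (huv : s(u, v) ∈ R) (r : G.Walk w v) (hr : r.IsPath)
    (hu : u ∉ r.support) (hwv : w ≠ v) :
    ∃ k, Reducible R u v k {e | e ∈ r.edges ∨ e = s(u, v) ∨ e = s(u, w)} := by
  induction r with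
  | nil => exact absurd rfl hwv
  | @cons w w' v h r ih =>
    rw [Walk.cons_isPath_iff] at hr
    rw [Walk.support_cons, List.mem_cons, not_or] at hu
    have hw' : w' ∈ r.support := r.start_mem_support
    have hwr : ∀ y, s(w, y) ∉ r.edges := fun y hy => hr.2 (r.fst_mem_support_of_mem_edges hy)
    have hwr' : ∀ y, s(y, w) ∉ r.edges := fun y hy => hr.2 (r.snd_mem_support_of_mem_edges hy)
    have hur : ∀ y, s(u, y) ∉ r.edges := fun y hy => hu.2 (r.fst_mem_support_of_mem_edges hy)
    have huw' : u ≠ w' := by rintro rfl; exact hu.2 hw'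
    have hx : HasTwoNeighbors
        {e | e ∈ (Walk.cons h r).edges ∨ e = s(u, v) ∨ e = s(u, w)} w u w' :=
      ⟨huw', Ne.symm hu.1, h.ne, fun y => by
        have := hwr y
        simp only [Walk.edges_cons, List.mem_cons, Set.mem_ofPred_eq, Sym2.eq_iff]
        grind⟩
    have hred : reduce {e | e ∈ (Walk.cons h r).edges ∨ e = s(u, v) ∨ e = s(u, w)} w u w' =
        {e | e ∈ r.edges ∨ e = s(u, v) ∨ e = s(u, w')} := by
      ext e
      induction e with
      | _ y z =>
        have h1 : s(y, z) ∈ r.edges → y ≠ w ∧ z ≠ w := by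
          refine fun hm => ⟨?_, ?_⟩ <;> rintro rfl
          · exact hwr _ hm
          · exact hwr' _ hm
        have h2 := hu.1
        simp only [mem_reduce_iff, Walk.edges_cons, List.mem_cons, Set.mem_ofPred_eq, Sym2.eq_iff]
        generalize (s(y, z) ∈ r.edges) = P at h1 ⊢
        clear hx hwr hwr' hur huv ih
        by_cases hy : y = w
        · subst hy
          grind
        · by_cases hz : z = w
          · subst hz
            grind
          · grind
    by_cases hw'v : w' = v
    · subst hw'v
      have hnil : r = .nil := by
        cases r with
        | nil => rfl
        | cons h' r' =>
          have := hr.1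
          rw [Walk.cons_isPath_iff] at this
          exact absurd r'.end_mem_support this.2
      subst hnil
      refine ⟨1, .step (Ne.symm hu.1) hwv hx (fun _ => huv) ?_⟩
      rw [hred]
      have : {e | e ∈ (Walk.nil : G.Walk w' w').edges ∨ e = s(u, w') ∨ e = s(u, w')}
          = {s(u, w')} := by
        ext e; simp
      rw [this]
      exact .edge
    · obtain ⟨k, hk⟩ := ih huv hr.1 hu.2 hw'v
      refine ⟨k + 1, .step (Ne.symm hu.1) hwv hx (fun hm => ?_) (hred ▸ hk)⟩
      have := hur w'
      simp only [Walk.edges_cons, List.mem_cons, Set.mem_ofPred_eq, Sym2.eq_iff] at hm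
      grind

theorem SimpleGraph.Walk.IsCycle.reducible {u : V} {w : G.Walk u u} (hw : w.IsCycle)
    (hcd : s(c, d) ∈ w.edges) (hR : s(c, d) ∈ R) : ∃ k, Reducible R c d k {e | e ∈ w.edges} := by
  rw [Sym2.eq_swap] at hcd
  obtain ⟨r, hr, hdc, hiff⟩ := hw.exists_isPath hcd
  cases r with
  | nil => exact absurd rfl (w.adj_of_mem_edges hcd).ne
  | @cons _ y _ h r =>
    rw [Walk.cons_isPath_iff] at hr
    have hyd : y ≠ d := by
      rintro rfl
      exact hdc (by simp)
    obtain ⟨k, hk⟩ := reducible_path hR r hr.1 hr.2 hyd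
    refine ⟨k, ?_⟩
    convert hk using 1
    ext e
    rw [Set.mem_ofPred_eq, hiff, Walk.edges_cons, List.mem_cons, Set.mem_ofPred_eq]
    tauto

/-- A polygonal 2-tree can be reduced to any one of its edges. Only edges of the graph itself are
opposite to more than one removed vertex. -/
theorem SimpleGraph.Subgraph.IsPolygonal2Tree.reducible {H : G.Subgraph}
    (hH : H.IsPolygonal2Tree) (hcd : H.Adj c d) :
    ∃ k, Reducible G.edgeSet c d k H.edgeSet := by
  have hG : ∀ {H : G.Subgraph} {u v : V}, H.Adj u v → s(u, v) ∈ G.edgeSet :=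
    fun h => (SimpleGraph.mem_edgeSet G).2 (Subgraph.adj_sub _ h)
  induction hH generalizing c d with
  | cycle w hw =>
    rw [Walk.edgeSet_toSubgraph]
    exact hw.reducible (by
      rwa [← Subgraph.mem_edgeSet, Walk.edgeSet_toSubgraph, Walk.mem_edgeSet] at hcd) (hG hcd)
  | @addPath H u v hH huv w hw hlen hE hV ih =>
    have huvG := hG huv
    have huvw : s(v, u) ∉ w.edges := by
      intro h
      have : s(u, v) ∈ H.edgeSet ∩ w.toSubgraph.edgeSet := by
        refine ⟨huv, ?_⟩
        rw [Walk.edgeSet_toSubgraph, Walk.mem_edgeSet, Sym2.eq_swap]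
        exact h
      rw [hE] at this
      exact this
    have hc : (Walk.cons (huv.adj_sub).symm w).IsCycle :=
      (Walk.cons_isCycle_iff _ _).2 ⟨hw, huvw⟩
    have hshare : ∀ y y' y'', s(y, y') ∈ H.edgeSet →
        s(y, y'') ∈ {e | e ∈ (Walk.cons (huv.adj_sub).symm w).edges} → y = u ∨ y = v := by
      intro y y' y'' h1 h2
      have h3 : y ∈ H.verts := H.edge_vert h1
      have h4 := Walk.fst_mem_support_of_mem_edges _ h2
      rw [Walk.support_cons, List.mem_cons] at h4
      rcases h4 with h4 | h4
      · exact .inr h4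
      · have : y ∈ H.verts ∩ w.toSubgraph.verts := ⟨h3, (Walk.mem_verts_toSubgraph _).2 h4⟩
        rw [hV] at this
        exact this
    have hunion : (H ⊔ w.toSubgraph).edgeSet
        = H.edgeSet ∪ {e | e ∈ (Walk.cons (huv.adj_sub).symm w).edges} := by
      ext e
      rw [Subgraph.edgeSet_sup, Walk.edgeSet_toSubgraph, Set.mem_union, Set.mem_union,
        Walk.mem_edgeSet, Set.mem_ofPred_eq, Walk.edges_cons, List.mem_cons]
      have : s(v, u) ∈ H.edgeSet := huv.symm
      grind
    have huvc : s(u, v) ∈ (Walk.cons (huv.adj_sub).symm w).edges := by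
      rw [Walk.edges_cons, List.mem_cons, Sym2.eq_swap]; exact .inl rfl
    obtain hcd' | hcd' : H.Adj c d ∨ s(c, d) ∈ (Walk.cons (huv.adj_sub).symm w).edges := by
      have : s(c, d) ∈ (H ⊔ w.toSubgraph).edgeSet := hcd
      rw [hunion] at this
      exact this
    · obtain ⟨k, hk⟩ := ih hcd'
      obtain ⟨j, hj⟩ := hc.reducible huvc huvG
      refine ⟨j + k, ?_⟩
      rw [hunion, Set.union_comm]
      exact hj.union hk hcd' huv huvG (fun y y' y'' h1 h2 => hshare y y'' y' h2 h1)
    · obtain ⟨k, hk⟩ := ih huv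
      obtain ⟨j, hj⟩ := hc.reducible hcd' (hG hcd)
      refine ⟨k + j, ?_⟩
      rw [hunion]
      exact hk.union hj hcd' huvc huvG hshare

theorem SimpleGraph.Subgraph.IsPolygonal2Tree.exists_adj {H : G.Subgraph}
    (hH : H.IsPolygonal2Tree) {v : V} (hv : v ∈ H.verts) : ∃ w, H.Adj v w := by
  have key : ∀ {u w : V} (r : G.Walk u w), 0 < r.length → ∀ v ∈ r.toSubgraph.verts,
      ∃ y, r.toSubgraph.Adj v y := by
    intro u w r hr v hv
    have hn : ¬ r.Nil := by
      rw [← Walk.length_eq_zero_iff]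
      omega
    rw [Walk.mem_verts_toSubgraph, Walk.mem_support_iff_exists_mem_edges_of_not_nil hn] at hv
    obtain ⟨e, he, hve⟩ := hv
    obtain ⟨y, rfl⟩ := hve
    exact ⟨y, by rwa [← Subgraph.mem_edgeSet, Walk.edgeSet_toSubgraph]⟩
  induction hH with
  | cycle w hw => exact key w (by have := hw.three_le_length; omega) v hv
  | addPath hH huv w hw hlen hE hV ih =>
    rw [Subgraph.verts_sup] at hv
    rcases hv with hv | hv
    · obtain ⟨y, hy⟩ := ih hv
      exact ⟨y, .inl hy⟩
    · obtain ⟨y, hy⟩ := key w (by omega) v hv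
      exact ⟨y, .inr hy⟩

end Reduction

/-! ### Weights, prices and the computed tree -/

section Certificate

variable {V : Type*}

/-- `K` is a full sequence of reduction steps for `A`: its members are the triples `(x, a, b)` of a
removed vertex and its two neighbours, in the order of removal. -/
inductive ReductionSeq (R : Set (Sym2 V)) (p q : V) : List (V × V × V) → Set (Sym2 V) → Prop
  | edge : ReductionSeq R p q [] {s(p, q)}
  | step {K : List (V × V × V)} {A : Set (Sym2 V)} {x a b : V} (hp : x ≠ p) (hq : x ≠ q)
      (h : HasTwoNeighbors A x a b) (hR : s(a, b) ∈ A → s(a, b) ∈ R)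
      (hK : ReductionSeq R p q K (reduce A x a b)) : ReductionSeq R p q ((x, a, b) :: K) A

/-- Both ends of `e` are ends of edges in `A`. -/
def Covers (A : Set (Sym2 V)) (e : Sym2 V) : Prop :=
  ∀ v ∈ e, ∃ y, s(v, y) ∈ A

variable {R A : Set (Sym2 V)} {p q x a b : V} {K : List (V × V × V)} {e : Sym2 V}

theorem covers_of_mem (h : e ∈ A) : Covers A e := by
  induction e with
  | _ u v =>
    intro w hw
    rcases Sym2.mem_iff.1 hw with rfl | rfl
    · exact ⟨_, h⟩
    · exact ⟨_, Sym2.eq_swap ▸ h⟩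

theorem mem_reduce_iff' : e ∈ reduce A x a b ↔ e = s(a, b) ∨ e ∈ A ∧ x ∉ e := Iff.rfl

namespace HasTwoNeighbors

theorem mem_left (h : HasTwoNeighbors A x a b) : s(x, a) ∈ A := (h.mem_iff a).2 (.inl rfl)

theorem mem_right (h : HasTwoNeighbors A x a b) : s(x, b) ∈ A := (h.mem_iff b).2 (.inr rfl)

theorem not_mem (h : HasTwoNeighbors A x a b) : x ∉ s(a, b) := by
  rw [Sym2.mem_iff, not_or]
  exact ⟨h.ne_left, h.ne_right⟩

theorem eq_or_eq (h : HasTwoNeighbors A x a b) (he : e ∈ A) (hx : x ∈ e) :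
    e = s(x, a) ∨ e = s(x, b) := by
  obtain ⟨y, rfl⟩ := hx
  rcases (h.mem_iff y).1 he with rfl | rfl
  · exact .inl rfl
  · exact .inr rfl

theorem exists_mem_reduce_iff (h : HasTwoNeighbors A x a b) (v : V) :
    (∃ y, s(v, y) ∈ reduce A x a b) ↔ (∃ y, s(v, y) ∈ A) ∧ v ≠ x := by
  have h1 := h.mem_left
  have h2 := h.mem_right
  have h3 := h.ne_left
  have h4 := h.ne_right
  constructor
  · rintro ⟨y, hy⟩
    rcases mem_reduce_iff.1 hy with (⟨rfl, rfl⟩ | ⟨rfl, rfl⟩) | h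
    · exact ⟨⟨x, Sym2.eq_swap ▸ h1⟩, h3.symm⟩
    · exact ⟨⟨x, Sym2.eq_swap ▸ h2⟩, h4.symm⟩
    · exact ⟨⟨y, h.1⟩, h.2.1⟩
  · rintro ⟨⟨y, hy⟩, hv⟩
    by_cases hyx : y = x
    · subst hyx
      rcases (h.mem_iff v).1 (Sym2.eq_swap ▸ hy) with rfl | rfl
      · exact ⟨b, mem_reduce_iff.2 (.inl (.inl ⟨rfl, rfl⟩))⟩
      · exact ⟨a, mem_reduce_iff.2 (.inl (.inr ⟨rfl, rfl⟩))⟩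
    · exact ⟨y, mem_reduce_iff.2 (.inr ⟨hy, hv, hyx⟩)⟩

theorem covers_reduce_iff (h : HasTwoNeighbors A x a b) :
    Covers (reduce A x a b) e ↔ Covers A e ∧ x ∉ e := by
  simp only [Covers, h.exists_mem_reduce_iff]
  grind

theorem covers (h : HasTwoNeighbors A x a b) : Covers A s(a, b) := by
  have := h.covers_reduce_iff.1 (covers_of_mem (e := s(a, b)) (mem_reduce_iff'.2 (.inl rfl)))
  exact this.1

theorem sym2_ne (h : HasTwoNeighbors A x a b) :
    s(x, a) ≠ s(x, b) ∧ s(x, a) ≠ s(a, b) ∧ s(x, b) ≠ s(a, b) := by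
  have h1 := h.ne
  have h2 := h.ne_left
  have h3 := h.ne_right
  simp only [ne_eq, Sym2.eq_iff]
  grind

end HasTwoNeighbors

variable [DecidableEq V]

/-- The least of the weights of the two edges at the removed vertex. -/
def lighter (S : Sym2 V → ℕ) (t : V × V × V) : ℕ :=
  min (S s(t.1, t.2.1)) (S s(t.1, t.2.2))

/-- The weights when the reduction step `t` is done: the lighter of the two edges at the removed
vertex adds its weight to the edge opposite to that vertex. -/
def upStep (S : Sym2 V → ℕ) (t : V × V × V) : Sym2 V → ℕ :=
  Function.update S s(t.2.1, t.2.2) (S s(t.2.1, t.2.2) + lighter S t)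

/-- The weights when all the reduction steps are done. -/
def upPass (S : Sym2 V → ℕ) (K : List (V × V × V)) : Sym2 V → ℕ :=
  K.foldl upStep S

/-- The price of leaving the triangle `t` through the edge opposite to the removed vertex, when `D`
gives the prices of going on from there to the outside. -/
def around (S D : Sym2 V → ℕ) (t : V × V × V) : ℕ :=
  S s(t.2.1, t.2.2) - lighter S t + D s(t.2.1, t.2.2)

/-- For each edge, the least price of a way that leaves through that edge and does not come
back. -/
def downD (S : Sym2 V → ℕ) : List (V × V × V) → Sym2 V → ℕ
  | [] => 0
  | t :: K => Function.update
      (Function.update (downD S K) s(t.1, t.2.1) (min (S s(t.1, t.2.2)) (around S (downD S K) t)))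
      s(t.1, t.2.2) (min (S s(t.1, t.2.1)) (around S (downD S K) t))

/-- The update of the indicator function `C` of a tree that the triangle `t = (x, a, b)` calls for:
if `ab` is in the tree and leaving through `ab` is cheap, then the path `a, x, b` takes its place;
otherwise `x` becomes a leaf, and the lighter one of `xa`, `xb` is left out. -/
def treeStep (S D C : Sym2 V → ℕ) (t : V × V × V) : Sym2 V → ℕ :=
  if C s(t.2.1, t.2.2) = 1 ∧ around S D t ≤ lighter S t then
    Function.update (Function.update (Function.update C s(t.2.1, t.2.2) 0) s(t.1, t.2.1) 1)
      s(t.1, t.2.2) 1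
  else if S s(t.1, t.2.1) ≤ S s(t.1, t.2.2) then
    Function.update (Function.update C s(t.1, t.2.1) 0) s(t.1, t.2.2) 1
  else
    Function.update (Function.update C s(t.1, t.2.1) 1) s(t.1, t.2.2) 0

/-- The indicator function of the edges of the optimal tree. -/
def downC (S : Sym2 V → ℕ) (p q : V) : List (V × V × V) → Sym2 V → ℕ
  | [] => Pi.single s(p, q) 1
  | t :: K => treeStep S (downD S K) (downC S p q K) t

/-- The price of the triangle `t`. -/
def price (S D : Sym2 V → ℕ) (t : V × V × V) : ℕ :=
  min (lighter S t) (around S D t)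

/-- The sum of the prices of all triangles. -/
def cost (S : Sym2 V → ℕ) : List (V × V × V) → ℕ
  | [] => 0
  | t :: K => price S (downD S K) t + cost S K

theorem le_upPass (S : Sym2 V → ℕ) (K : List (V × V × V)) (e : Sym2 V) : S e ≤ upPass S K e := by
  induction K generalizing S with
  | nil => exact le_rfl
  | cons t K ih =>
    refine le_trans ?_ (ih (upStep S t))
    rw [upStep, Function.update_apply]
    split_ifs with h
    · rw [h]; exact Nat.le_add_right _ _
    · exact le_rfl

theorem ReductionSeq.upPass_eq (hK : ReductionSeq R p q K A) (S : Sym2 V → ℕ)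
    (he : ¬ Covers A e) : upPass S K e = S e := by
  induction hK generalizing S with
  | edge => rfl
  | @step K A x a b hp hq h hR hK ih =>
    refine (ih (upStep S (x, a, b)) fun h' => he (h.covers_reduce_iff.1 h').1).trans ?_
    rw [upStep, Function.update_of_ne]
    rintro rfl
    exact he h.covers

theorem ReductionSeq.downD_eq (hK : ReductionSeq R p q K A) (S : Sym2 V → ℕ)
    (he : ¬ Covers A e) : downD S K e = 0 := by
  induction hK with
  | edge => rfl
  | @step K A x a b hp hq h hR hK ih =>
    rw [downD, Function.update_of_ne, Function.update_of_ne]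
    · exact ih fun h' => he (h.covers_reduce_iff.1 h').1
    · rintro rfl; exact he (covers_of_mem h.mem_left)
    · rintro rfl; exact he (covers_of_mem h.mem_right)

theorem ReductionSeq.downC_eq (hK : ReductionSeq R p q K A) (S : Sym2 V → ℕ)
    (he : ¬ Covers A e) : downC S p q K e = 0 := by
  induction hK with
  | edge =>
    rw [downC, Pi.single_eq_of_ne]
    rintro rfl
    exact he (covers_of_mem rfl)
  | @step K A x a b hp hq h hR hK ih =>
    have h1 : e ≠ s(x, a) := by rintro rfl; exact he (covers_of_mem h.mem_left)
    have h2 : e ≠ s(x, b) := by rintro rfl; exact he (covers_of_mem h.mem_right)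
    have h3 : e ≠ s(a, b) := by rintro rfl; exact he h.covers
    have h4 := ih fun h' => he (h.covers_reduce_iff.1 h').1
    simp only [downC, treeStep]
    split_ifs <;> simp [Function.update_of_ne, h1, h2, h3, h4]

theorem sum_mul_add_single [Fintype V] (h Φ : Sym2 V → ℤ) (e₁ e₂ e₃ : Sym2 V) (α β γ : ℤ) :
    ∑ e, h e * (Φ + Pi.single e₁ α + Pi.single e₂ β + Pi.single e₃ γ : Sym2 V → ℤ) e =
      ∑ e, h e * Φ e + h e₁ * α + h e₂ * β + h e₃ * γ := by
  simp [mul_add, Finset.sum_add_distrib, Pi.single_apply]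

theorem Nat.min_spec (a b : ℕ) : min a b ≤ a ∧ min a b ≤ b ∧ (min a b = a ∨ min a b = b) :=
  ⟨min_le_left a b, min_le_right a b, min_choice a b⟩

section

variable (F : Sym2 V → ℕ) (p q : V) (K : List (V × V × V))

theorem downD_left (h : s(x, a) ≠ s(x, b)) : downD F ((x, a, b) :: K) s(x, a) =
    min (F s(x, b)) (around F (downD F K) (x, a, b)) := by
  rw [downD, Function.update_of_ne h, Function.update_self]

theorem downD_right : downD F ((x, a, b) :: K) s(x, b) =
    min (F s(x, a)) (around F (downD F K) (x, a, b)) := by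
  rw [downD, Function.update_self]

theorem downD_of_ne (h₁ : e ≠ s(x, a)) (h₂ : e ≠ s(x, b)) :
    downD F ((x, a, b) :: K) e = downD F K e := by
  rw [downD, Function.update_of_ne h₂, Function.update_of_ne h₁]

theorem downC_of_ne (h₁ : e ≠ s(x, a)) (h₂ : e ≠ s(x, b)) (h₃ : e ≠ s(a, b)) :
    downC F p q ((x, a, b) :: K) e = downC F p q K e := by
  simp only [downC, treeStep]
  split_ifs <;> simp [Function.update_of_ne, h₁, h₂, h₃]

/-- The three ways in which `treeStep` can act, with the signs that the price of the triangle gets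
on its three edges. -/
theorem downC_cons (h₁ : s(x, a) ≠ s(x, b)) (h₂ : s(x, a) ≠ s(a, b)) (h₃ : s(x, b) ≠ s(a, b)) :
    ∃ α β γ : ℤ,
      (downC F p q K s(a, b) = 1 ∧ around F (downD F K) (x, a, b) ≤ lighter F (x, a, b) ∧
        α = -1 ∧ β = -1 ∧ γ = 1 ∧ downC F p q ((x, a, b) :: K) s(x, a) = 1 ∧
        downC F p q ((x, a, b) :: K) s(x, b) = 1 ∧ downC F p q ((x, a, b) :: K) s(a, b) = 0) ∨
      ((downC F p q K s(a, b) = 1 → lighter F (x, a, b) < around F (downD F K) (x, a, b)) ∧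
        F s(x, a) ≤ F s(x, b) ∧
        α = 1 ∧ β = -1 ∧ γ = -1 ∧ downC F p q ((x, a, b) :: K) s(x, a) = 0 ∧
        downC F p q ((x, a, b) :: K) s(x, b) = 1 ∧
        downC F p q ((x, a, b) :: K) s(a, b) = downC F p q K s(a, b)) ∨
      ((downC F p q K s(a, b) = 1 → lighter F (x, a, b) < around F (downD F K) (x, a, b)) ∧
        F s(x, b) < F s(x, a) ∧
        α = -1 ∧ β = 1 ∧ γ = -1 ∧ downC F p q ((x, a, b) :: K) s(x, a) = 1 ∧
        downC F p q ((x, a, b) :: K) s(x, b) = 0 ∧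
        downC F p q ((x, a, b) :: K) s(a, b) = downC F p q K s(a, b)) := by
  simp only [downC, treeStep]
  by_cases q1 : downC F p q K s(a, b) = 1 ∧
    around F (downD F K) (x, a, b) ≤ lighter F (x, a, b)
  · rw [if_pos q1]
    refine ⟨-1, -1, 1, .inl ?_⟩
    simp [q1, h₁, h₂.symm, h₃.symm]
  · rw [if_neg q1]
    rw [not_and, not_le] at q1
    by_cases q2 : F s(x, a) ≤ F s(x, b)
    · rw [if_pos q2]
      refine ⟨1, -1, -1, .inr (.inl ⟨q1, q2, ?_⟩)⟩
      simp [h₁, h₂.symm, h₃.symm]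
    · rw [if_neg q2]
      refine ⟨-1, 1, -1, .inr (.inr ⟨q1, by omega, ?_⟩)⟩
      simp [h₁, h₂.symm, h₃.symm]

end

set_option maxHeartbeats 1000000 in
/-- Complementary slackness for the tree `downC`. For the dual weight `Φ e`, the price of a
triangle counts negatively on each of its edges, except that it counts positively on the edge
through which that triangle is left. -/
theorem ReductionSeq.exists_slack [Fintype V] (hK : ReductionSeq R p q K A) (S : Sym2 V → ℕ)
    {F : Sym2 V → ℕ} (hF : upPass S K = F) (hRA : ∀ e ∈ R, Covers A e → e ∈ A)
    (hS : ∀ e, Covers A e → e ∉ A → S e = 0) :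
    ∃ Φ : Sym2 V → ℤ,
      (∀ h : Sym2 V → ℤ, (∀ u v w, h s(u, w) ≤ h s(u, v) + h s(v, w) + 1) →
        ∑ e, h e * Φ e ≤ cost F K) ∧
      (∀ e, ¬ Covers A e → Φ e = 0) ∧
      ∀ e, Covers A e → (e ∈ A → e ∉ R → F e = S e) ∧
        (downC F p q K e = 1 ∧ e ∈ A ∧ downD F K e ≤ F e ∧
            Φ e = -((F e : ℤ) - S e) - downD F K e ∨
          downC F p q K e = 0 ∧ Φ e = S e ∧ 2 * S e ≤ F e + downD F K e) := by
  induction hK generalizing S with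
  | edge =>
    subst hF
    refine ⟨0, fun h _ => by simp, fun _ _ => rfl, fun e he => ⟨fun _ _ => rfl, ?_⟩⟩
    by_cases hpq : e = s(p, q)
    · left
      subst hpq
      simp [downC, downD, upPass]
    · right
      simp [downC, downD, upPass, Pi.single_eq_of_ne hpq, hS e he hpq]
  | @step K A x a b hp hq h hR hK ih =>
    obtain ⟨n1, n2, n3⟩ := h.sym2_ne
    obtain ⟨Φ, hsum, hzero, hmain⟩ := ih (upStep S (x, a, b)) hF
      (fun e he hc => by
        rw [h.covers_reduce_iff] at hc
        exact mem_reduce_iff'.2 (.inr ⟨hRA e he hc.1, hc.2⟩))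
      (fun e hc he => by
        rw [h.covers_reduce_iff] at hc
        rw [mem_reduce_iff', not_or] at he
        rw [upStep, Function.update_of_ne he.1]
        exact hS e hc.1 fun h' => he.2 ⟨h', hc.2⟩)
    have hcx : ∀ e, x ∈ e → ¬ Covers (reduce A x a b) e := fun e hx hc =>
      (h.covers_reduce_iff.1 hc).2 hx
    have hxa := hcx s(x, a) (Sym2.mem_mk_left _ _)
    have hxb := hcx s(x, b) (Sym2.mem_mk_left _ _)
    have hFx : ∀ e, x ∈ e → F e = S e := fun e hx => by
      rw [← hF]
      refine (hK.upPass_eq (upStep S (x, a, b)) (hcx e hx)).trans ?_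
      rw [upStep, Function.update_of_ne]
      rintro rfl
      exact h.not_mem hx
    have hFa := hFx s(x, a) (Sym2.mem_mk_left _ _)
    have hFb := hFx s(x, b) (Sym2.mem_mk_left _ _)
    have hl : lighter S (x, a, b) = lighter F (x, a, b) := by simp [lighter, hFa, hFb]
    have hSab : upStep S (x, a, b) s(a, b) = S s(a, b) + lighter F (x, a, b) := by
      simp [upStep, hl]
    have hSo : ∀ e, e ≠ s(a, b) → upStep S (x, a, b) e = S e := fun e he => by
      simp [upStep, Function.update_of_ne he]
    have hFab : S s(a, b) + lighter F (x, a, b) ≤ F s(a, b) := by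
      rw [← hSab, ← hF]
      exact le_upPass _ K _
    have hab := hmain s(a, b) (h.covers_reduce_iff.2 ⟨h.covers, h.not_mem⟩)
    have habm : s(a, b) ∈ reduce A x a b := mem_reduce_iff'.2 (.inl rfl)
    rw [hSab] at hab
    have hm := Nat.min_spec (F s(x, a)) (F s(x, b))
    have hv : around F (downD F K) (x, a, b) =
      F s(a, b) - lighter F (x, a, b) + downD F K s(a, b) := rfl
    have hc := Nat.min_spec (lighter F (x, a, b)) (around F (downD F K) (x, a, b))
    have hda := Nat.min_spec (F s(x, b)) (around F (downD F K) (x, a, b))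
    have hdb := Nat.min_spec (F s(x, a)) (around F (downD F K) (x, a, b))
    rw [← downD_left F K n1] at hda
    rw [← downD_right F K] at hdb
    change lighter F (x, a, b) ≤ _ ∧ lighter F (x, a, b) ≤ _ ∧
      (lighter F (x, a, b) = _ ∨ lighter F (x, a, b) = _) at hm
    change price F (downD F K) (x, a, b) ≤ _ ∧ price F (downD F K) (x, a, b) ≤ _ ∧
      (price F (downD F K) (x, a, b) = _ ∨ price F (downD F K) (x, a, b) = _) at hc
    have hcost : cost F ((x, a, b) :: K) = price F (downD F K) (x, a, b) + cost F K := rfl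
    have hCo := fun {e : Sym2 V} => downC_of_ne F p q K (x := x) (a := a) (b := b) (e := e)
    have hDo := fun {e : Sym2 V} => downD_of_ne F K (x := x) (a := a) (b := b) (e := e)
    -- the signs depend on the edge through which the triangle is left
    obtain ⟨α, β, γ, hαβγ⟩ := downC_cons F p q K n1 n2 n3
    -- a triangle that is not left through `ab` would not gain from that
    have hout : (downC F p q K s(a, b) = 1 →
        lighter F (x, a, b) < around F (downD F K) (x, a, b)) →
        lighter F (x, a, b) ≤ around F (downD F K) (x, a, b) := fun h' => by
      rcases hab.2 with ⟨c1, -, c2, c3⟩ | ⟨c1, c2, c3⟩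
      · exact (h' c1).le
      · omega
    set D' := downD F ((x, a, b) :: K)
    set C' := downC F p q ((x, a, b) :: K)
    set D := downD F K
    set C := downC F p q K
    set c := price F D (x, a, b)
    set v := around F D (x, a, b)
    set m := lighter F (x, a, b)
    have za := hzero _ hxa
    have zb := hzero _ hxb
    have ma := h.mem_left
    have mb := h.mem_right
    refine ⟨Φ + Pi.single s(x, a) (α * c) + Pi.single s(x, b) (β * c) + Pi.single s(a, b) (γ * c),
      fun g hg => ?_, fun e he => ?_, fun e he => ?_⟩
    · rw [sum_mul_add_single, hcost]
      have h1 := hsum g hg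
      have g1 := hg x b a
      have g2 := hg x a b
      have g3 := hg a x b
      rw [Sym2.eq_swap (a := b) (b := a)] at g1
      rw [Sym2.eq_swap (a := a) (b := x)] at g3
      have hc0 : (0 : ℤ) ≤ c := Int.natCast_nonneg _
      push_cast
      rcases hαβγ with ⟨-, -, rfl, rfl, rfl, -⟩ | ⟨-, -, rfl, rfl, rfl, -⟩ |
        ⟨-, -, rfl, rfl, rfl, -⟩
      · linarith [mul_le_mul_of_nonneg_left g3 hc0]
      · linarith [mul_le_mul_of_nonneg_left g1 hc0]
      · linarith [mul_le_mul_of_nonneg_left g2 hc0]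
    · have e1 : e ≠ s(x, a) := by rintro rfl; exact he (covers_of_mem h.mem_left)
      have e2 : e ≠ s(x, b) := by rintro rfl; exact he (covers_of_mem h.mem_right)
      have e3 : e ≠ s(a, b) := by rintro rfl; exact he h.covers
      have e4 := hzero e fun h' => he (h.covers_reduce_iff.1 h').1
      simp [Pi.single_eq_of_ne, e1, e2, e3, e4]
    · simp only [Pi.add_apply]
      by_cases e1 : e = s(x, a)
      · subst e1
        clear hab hdb
        rw [Pi.single_eq_same, Pi.single_eq_of_ne n1, Pi.single_eq_of_ne n2, za]
        refine ⟨fun _ _ => hFa, ?_⟩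
        rcases hαβγ with ⟨q1, q2, rfl, rfl, rfl, q3, -, -⟩ | ⟨q1, q2, rfl, rfl, rfl, q3, -, -⟩ |
          ⟨q1, q2, rfl, rfl, rfl, q3, -, -⟩
        · exact .inl ⟨q3, ma, by omega, by omega⟩
        · have := hout q1
          exact .inr ⟨q3, by omega, by omega⟩
        · have := hout q1
          exact .inl ⟨q3, ma, by omega, by omega⟩
      by_cases e2 : e = s(x, b)
      · subst e2
        clear hab hda
        rw [Pi.single_eq_same, Pi.single_eq_of_ne n1.symm, Pi.single_eq_of_ne n3, zb]
        refine ⟨fun _ _ => hFb, ?_⟩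
        rcases hαβγ with ⟨q1, q2, rfl, rfl, rfl, -, q3, -⟩ | ⟨q1, q2, rfl, rfl, rfl, -, q3, -⟩ |
          ⟨q1, q2, rfl, rfl, rfl, -, q3, -⟩
        · exact .inl ⟨q3, mb, by omega, by omega⟩
        · have := hout q1
          exact .inl ⟨q3, mb, by omega, by omega⟩
        · have := hout q1
          exact .inr ⟨q3, by omega, by omega⟩
      rw [hDo e1 e2, Pi.single_eq_of_ne e1, Pi.single_eq_of_ne e2]
      by_cases e3 : e = s(a, b)
      · subst e3
        clear hda hdb
        rw [Pi.single_eq_same]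
        refine ⟨fun hA hR' => absurd (hR hA) hR', ?_⟩
        obtain ⟨hvirt, hab⟩ := hab
        -- an edge that was created by the reduction must not stay in the tree
        have hvirt' : s(a, b) ∉ A → F s(a, b) = m ∧ S s(a, b) = 0 := fun hA => by
          have h0 := hS _ h.covers hA
          have := hvirt habm fun hR' => hA (hRA _ hR' h.covers)
          omega
        rcases hαβγ with ⟨q1, q2, rfl, rfl, rfl, -, -, q3⟩ | ⟨q1, q2, rfl, rfl, rfl, -, -, q3⟩ |
          ⟨q1, q2, rfl, rfl, rfl, -, -, q3⟩ <;> rw [q3]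
        · rcases hab with ⟨c1, -, c2, c3⟩ | ⟨c1, c2, c3⟩
          · exact .inr ⟨rfl, by omega, by omega⟩
          · omega
        all_goals
          rcases hab with ⟨c1, -, c2, c3⟩ | ⟨c1, c2, c3⟩
          · have := q1 c1
            by_cases hA : s(a, b) ∈ A
            · exact .inl ⟨c1, hA, c2, by omega⟩
            · have := hvirt' hA
              omega
          · have := hout q1
            exact .inr ⟨c1, by omega, by omega⟩
      · rw [hCo e1 e2 e3, Pi.single_eq_of_ne e3]
        by_cases hx : x ∈ e
        · have hA : e ∉ A := fun hA => by
            rcases h.eq_or_eq hA hx with h' | h'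
            · exact e1 h'
            · exact e2 h'
          have := hFx e hx
          have := hS e he hA
          have := hzero e (hcx e hx)
          have : C e = 0 := hK.downC_eq F (hcx e hx)
          have : D e = 0 := hK.downD_eq F (hcx e hx)
          refine ⟨fun h' => absurd h' hA, .inr ?_⟩
          omega
        · have := hmain e (h.covers_reduce_iff.2 ⟨he, hx⟩)
          rw [hSo e e3, mem_reduce_iff'] at this
          simp only [e3, hx, not_false_eq_true, and_true, false_or] at this
          simpa using this

end Certificate

/-! ### Prices and tree metrics -/

section TreeMetric

variable {V : Type*}

/-- A metric in which the points between two given points form a chain. -/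
structure IsChainMetric (d : V → V → ℕ) : Prop where
  comm : ∀ u v, d u v = d v u
  triangle : ∀ u v w, d u w ≤ d u v + d v w
  eq_of_eq_zero : ∀ u v, d u v = 0 → u = v
  chain : ∀ u v y z, d u y + d y v = d u v → d u z + d z v = d u v →
    d u y + d y z = d u z ∨ d u z + d z y = d u y

/-- Among the vertices of `A`, the metric `d` looks like that of a tree with edges in `A`: on the
way from one vertex to another there is a neighbour of the first, and any three vertices have a
median. -/
structure IsSpannedBy (A : Set (Sym2 V)) (d : V → V → ℕ) : Prop where
  step : ∀ u v, (∃ y, s(u, y) ∈ A) → (∃ y, s(v, y) ∈ A) → u ≠ v →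
    ∃ y, s(u, y) ∈ A ∧ d u y + d y v = d u v
  median : ∀ u v w, (∃ y, s(u, y) ∈ A) → (∃ y, s(v, y) ∈ A) → (∃ y, s(w, y) ∈ A) →
    ∃ m, (∃ y, s(m, y) ∈ A) ∧ d u m + d m v = d u v ∧ d u m + d m w = d u w ∧
      d v m + d m w = d v w

variable {A : Set (Sym2 V)} {d : V → V → ℕ} {x a b : V}

theorem IsSpannedBy.reduce (hd : IsChainMetric d) (hA : IsSpannedBy A d)
    (h : HasTwoNeighbors A x a b) : IsSpannedBy (reduce A x a b) d := by
  have hex := h.exists_mem_reduce_iff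
  have hxA : ∃ y, s(x, y) ∈ A := ⟨a, h.mem_left⟩
  constructor
  · intro u v hu hv huv
    replace ⟨hu, hux⟩ := (hex u).1 hu
    replace ⟨hv, hvx⟩ := (hex v).1 hv
    obtain ⟨y, hy, hyv⟩ := hA.step u v hu hv huv
    by_cases hyx : y = x
    · subst hyx
      -- the way from `u` to `v` starts with `y`, hence goes through both neighbours of `y`
      obtain ⟨z, hz, hzv⟩ := hA.step y v hxA hv (Ne.symm hvx)
      have hu' := (h.mem_iff u).1 (Sym2.eq_swap ▸ hy)
      have hz' := (h.mem_iff z).1 hz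
      have t := hd.triangle u z v
      have t' := hd.triangle u y z
      by_cases huz : u = z
      · subst huz
        have := hd.comm u y
        have := hd.eq_of_eq_zero u y (by omega)
        exact absurd this hux
      · refine ⟨z, mem_reduce_iff.2 (.inl ?_), by omega⟩
        grind
    · exact ⟨y, mem_reduce_iff.2 (.inr ⟨hy, hux, hyx⟩), hyv⟩
  · intro u v w hu hv hw
    replace ⟨hu, hux⟩ := (hex u).1 hu
    replace ⟨hv, hvx⟩ := (hex v).1 hv
    replace ⟨hw, hwx⟩ := (hex w).1 hw
    obtain ⟨m, hm, h1, h2, h3⟩ := hA.median u v w hu hv hw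
    refine ⟨m, (hex m).2 ⟨hm, ?_⟩, h1, h2, h3⟩
    rintro rfl
    -- two of the three ways from `m` would start with the same neighbour
    have key : ∀ u v y, d u m + d m v = d u v → d m y + d y u = d m u → d m y + d y v = d m v →
        m = y := by
      intro u v y h1 h2 h3
      refine hd.eq_of_eq_zero _ _ ?_
      have := hd.triangle u y v
      have := hd.comm u m
      have := hd.comm u y
      omega
    obtain ⟨y₁, hy₁, e₁⟩ := hA.step m u hm hu (Ne.symm hux)
    obtain ⟨y₂, hy₂, e₂⟩ := hA.step m v hm hv (Ne.symm hvx)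
    obtain ⟨y₃, hy₃, e₃⟩ := hA.step m w hm hw (Ne.symm hwx)
    have n1 := h.ne_left
    have n2 := h.ne_right
    have k1 := key u v y₁ h1 e₁
    have k2 := key u w y₁ h2 e₁
    have k3 := key v w y₂ h3 e₂
    rw [h.mem_iff] at hy₁ hy₂ hy₃
    grind

/-- Each triangle has a longest edge, as long as the other two together. -/
theorem IsSpannedBy.exists_between (hd : IsChainMetric d) (hA : IsSpannedBy A d)
    (h : HasTwoNeighbors A x a b) :
    d a x + d x b = d a b ∨ d x b + d b a = d x a ∨ d x a + d a b = d x b := by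
  have hex := h.exists_mem_reduce_iff
  have ha : ∃ y, s(a, y) ∈ A := ⟨x, Sym2.eq_swap ▸ h.mem_left⟩
  have hb : ∃ y, s(b, y) ∈ A := ⟨x, Sym2.eq_swap ▸ h.mem_right⟩
  have hx : ∃ y, s(x, y) ∈ A := ⟨a, h.mem_left⟩
  obtain ⟨m, hm, h1, h2, h3⟩ := hA.median x a b hx ha hb
  by_cases hmx : m = x
  · subst hmx
    exact .inl h3
  · obtain ⟨y, hy, hym⟩ := hA.step x m hx hm (Ne.symm hmx)
    have c1 := hd.comm m a
    have c2 := hd.comm m b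
    rcases (h.mem_iff y).1 hy with rfl | rfl
    · have := hd.eq_of_eq_zero y m (by omega)
      subst this
      exact .inr (.inr h2)
    · have := hd.eq_of_eq_zero y m (by omega)
      subst this
      exact .inr (.inl h1)

/-- If the removed vertex lies between its neighbours, then no other vertex does. -/
theorem IsSpannedBy.not_between (hd : IsChainMetric d) (hA : IsSpannedBy A d)
    (h : HasTwoNeighbors A x a b) (hx : d a x + d x b = d a b) {z : V} (hz : ∃ y, s(z, y) ∈ A)
    (hzx : z ≠ x) (hza : z ≠ a) (hzb : z ≠ b) : d a z + d z b ≠ d a b := by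
  intro hz'
  have key : ∀ a b, (∀ y, s(x, y) ∈ A → y = a ∨ y = b) → x ≠ b → z ≠ a →
      d a x + d x b = d a b → d a z + d z x = d a x → d a z + d z b = d a b → False := by
    intro a b hn hxb hza hx h1 hz'
    obtain ⟨y, hy, hyz⟩ := hA.step x z ⟨_, h.mem_left⟩ hz (Ne.symm hzx)
    have c1 := hd.comm x z
    have c2 := hd.comm x a
    have c3 := hd.comm z a
    have c4 := hd.comm z b
    rcases hn y hy with rfl | rfl
    · exact hza (hd.eq_of_eq_zero _ _ (by omega))
    · exact hxb (hd.eq_of_eq_zero _ _ (by omega))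
  have c1 := hd.comm x a
  have c2 := hd.comm x b
  have c3 := hd.comm z a
  have c4 := hd.comm z b
  have c5 := hd.comm a b
  have c6 := hd.comm x z
  rcases hd.chain a b x z hx hz' with h1 | h1
  · exact key b a (fun y hy => ((h.mem_iff y).1 hy).symm) h.ne_left hzb (by omega) (by omega)
      (by omega)
  · exact key a b (fun y hy => (h.mem_iff y).1 hy) h.ne_right hza hx h1 hz'

variable {R : Set (Sym2 V)} {p q : V} {K : List (V × V × V)}

/-- The arithmetic of one step of `ReductionSeq.exists_dual`, for the edge `ab` opposite to the
removed vertex: `S` and `S + m` are the weights of `ab` before and after the step, `F` is the final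
one, and `c` is the price of the triangle. The number `N` is the sum of the prices of the triangles
at `ab` so far, and `Y` bounds each of them; the two alternatives say whether going on through `ab`
is expensive or cheap. -/
theorem dual_step {S F D m v c : ℕ} {N Y : ℤ} (hv : v = F - m + D) (hS : S + m ≤ F)
    (hc : c ≤ m ∧ c ≤ v ∧ (c = m ∨ c = v))
    (h : ((S + m : ℕ) : ℤ) + N = F + ((min F D : ℕ) : ℤ) ∧ Y ≤ (F - (S + m : ℕ)) + D ∧
        2 * Y ≤ F + ((min F D : ℕ) : ℤ) ∨
      2 * ((S + m : ℕ) : ℤ) ≤ (S + m : ℕ) + N ∧ 2 * Y ≤ (S + m : ℕ) + N ∧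
        2 * (S + m) ≤ F + D) :
    (S : ℤ) + (N + c) = F + ((min F D : ℕ) : ℤ) ∧ max Y c ≤ (F - S) + D ∧
        2 * max Y c ≤ F + ((min F D : ℕ) : ℤ) ∨
      2 * (S : ℤ) ≤ S + (N + c) ∧ 2 * max Y c ≤ S + (N + c) ∧ 2 * S ≤ F + D := by
  have h1 : max Y (c : ℤ) = Y ∨ max Y (c : ℤ) = c := max_choice _ _
  have h2 := Nat.min_spec F D
  generalize max Y (c : ℤ) = M at *
  generalize min F D = L at *
  obtain ⟨hc1, hc2, hc3⟩ := hc
  push_cast at h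
  have hv' : (v : ℤ) = F - m + D := by omega
  by_cases hvm : v < m
  · right
    have hcv : c = v := by omega
    subst hcv
    rcases h with ⟨y1, y2, y3⟩ | ⟨y1, y2, y3⟩
    · refine ⟨by omega, ?_, by omega⟩
      rcases h1 with rfl | rfl <;> omega
    · omega
  · have hcm : c = m := by omega
    subst hcm
    rcases h with ⟨y1, y2, y3⟩ | ⟨y1, y2, y3⟩
    · left
      refine ⟨by omega, ?_, ?_⟩ <;> rcases h1 with rfl | rfl <;> omega
    · right
      refine ⟨by omega, ?_, by omega⟩
      rcases h1 with rfl | rfl <;> omega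

set_option maxHeartbeats 1000000 in
/-- Feasibility of the prices: for every tree metric, the price of a triangle is at most what the
edge costs through which the tree leaves it. Here `N e` is the sum of the prices of all triangles at
`e`, the greatest of these is at most `Y e`, and the dual weight `Φ e` has at most one positive
summand, because at most one triangle is left through `e`. -/
theorem ReductionSeq.exists_dual [DecidableEq V] [Fintype V] (hd : IsChainMetric d)
    (hK : ReductionSeq R p q K A) (hA : IsSpannedBy A d) (S : Sym2 V → ℕ)
    {F : Sym2 V → ℕ} (hF : upPass S K = F) (hS : ∀ e, Covers A e → e ∉ A → S e = 0)
    {g : Sym2 V → ℤ} (hg : ∀ u v, u ≠ v → g s(u, v) = d u v - 1) :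
    ∃ N Φ Y : Sym2 V → ℤ, ∑ e, g e * Φ e = cost F K ∧
      (∀ e, ¬ Covers A e → N e = 0 ∧ Φ e = 0 ∧ Y e = 0) ∧
      ∀ e, Covers A e → 0 ≤ Y e ∧ Φ e ≤ 2 * Y e - N e ∧
        (Φ e = - N e ∨ ∃ z, (∃ y, s(z, y) ∈ A) ∧ z ∉ e ∧
          ∀ u v, e = s(u, v) → d u z + d z v = d u v) ∧
        (S e + N e = F e + min (F e) (downD F K e) ∧ Y e ≤ (F e - S e) + downD F K e ∧
            2 * Y e ≤ F e + min (F e) (downD F K e) ∨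
          2 * S e ≤ S e + N e ∧ 2 * Y e ≤ S e + N e ∧ 2 * S e ≤ F e + downD F K e) := by
  induction hK generalizing S with
  | edge =>
    subst hF
    refine ⟨0, 0, 0, by simp [cost], fun _ _ => ⟨rfl, rfl, rfl⟩, fun e he => ?_⟩
    simp [downD, upPass]
  | @step K A x a b hp hq h hR hK ih =>
    obtain ⟨n1, n2, n3⟩ := h.sym2_ne
    obtain ⟨N, Φ, Y, hsum, hzero, hmain⟩ := ih (hA.reduce hd h) (upStep S (x, a, b)) hF
      (fun e hc he => by
        rw [h.covers_reduce_iff] at hc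
        rw [mem_reduce_iff', not_or] at he
        rw [upStep, Function.update_of_ne he.1]
        exact hS e hc.1 fun h' => he.2 ⟨h', hc.2⟩)
    have hcx : ∀ e, x ∈ e → ¬ Covers (reduce A x a b) e := fun e hx hc =>
      (h.covers_reduce_iff.1 hc).2 hx
    have hFx : ∀ e, x ∈ e → F e = S e := fun e hx => by
      rw [← hF]
      refine (hK.upPass_eq (upStep S (x, a, b)) (hcx e hx)).trans ?_
      rw [upStep, Function.update_of_ne]
      rintro rfl
      exact h.not_mem hx
    have hFa := hFx s(x, a) (Sym2.mem_mk_left _ _)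
    have hFb := hFx s(x, b) (Sym2.mem_mk_left _ _)
    have hl : lighter S (x, a, b) = lighter F (x, a, b) := by simp [lighter, hFa, hFb]
    have hSab : upStep S (x, a, b) s(a, b) = S s(a, b) + lighter F (x, a, b) := by
      simp [upStep, hl]
    have hSo : ∀ e, e ≠ s(a, b) → upStep S (x, a, b) e = S e := fun e he => by
      simp [upStep, Function.update_of_ne he]
    have hFab : S s(a, b) + lighter F (x, a, b) ≤ F s(a, b) := by
      rw [← hSab, ← hF]
      exact le_upPass _ K _
    have hab := hmain s(a, b) (h.covers_reduce_iff.2 ⟨h.covers, h.not_mem⟩)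
    rw [hSab] at hab
    have hm := Nat.min_spec (F s(x, a)) (F s(x, b))
    have hv : around F (downD F K) (x, a, b) =
      F s(a, b) - lighter F (x, a, b) + downD F K s(a, b) := rfl
    have hc := Nat.min_spec (lighter F (x, a, b)) (around F (downD F K) (x, a, b))
    have hda := Nat.min_spec (F s(x, b)) (around F (downD F K) (x, a, b))
    have hdb := Nat.min_spec (F s(x, a)) (around F (downD F K) (x, a, b))
    rw [← downD_left F K n1] at hda
    rw [← downD_right F K] at hdb
    change lighter F (x, a, b) ≤ _ ∧ lighter F (x, a, b) ≤ _ ∧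
      (lighter F (x, a, b) = _ ∨ lighter F (x, a, b) = _) at hm
    change price F (downD F K) (x, a, b) ≤ _ ∧ price F (downD F K) (x, a, b) ≤ _ ∧
      (price F (downD F K) (x, a, b) = _ ∨ price F (downD F K) (x, a, b) = _) at hc
    have hcost : cost F ((x, a, b) :: K) = price F (downD F K) (x, a, b) + cost F K := rfl
    have hDo := fun {e : Sym2 V} => downD_of_ne F K (x := x) (a := a) (b := b) (e := e)
    have hex := h.exists_mem_reduce_iff
    have gxa := hg x a h.ne_left
    have gxb := hg x b h.ne_right
    have gab := hg a b h.ne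
    have cax := hd.comm a x
    have cab := hd.comm a b
    have cbx := hd.comm b x
    -- the signs depend on the edge through which the triangle is left
    obtain ⟨α, β, γ, hαβγ⟩ : ∃ α β γ : ℤ,
        (d a x + d x b = d a b ∧ α = -1 ∧ β = -1 ∧ γ = 1) ∨
        (d x b + d b a = d x a ∧ α = 1 ∧ β = -1 ∧ γ = -1) ∨
        (d x a + d a b = d x b ∧ α = -1 ∧ β = 1 ∧ γ = -1) := by
      rcases hA.exists_between hd h with h' | h' | h'
      · exact ⟨-1, -1, 1, .inl ⟨h', rfl, rfl, rfl⟩⟩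
      · exact ⟨1, -1, -1, .inr (.inl ⟨h', rfl, rfl, rfl⟩)⟩
      · exact ⟨-1, 1, -1, .inr (.inr ⟨h', rfl, rfl, rfl⟩)⟩
    set D' := downD F ((x, a, b) :: K)
    set D := downD F K
    set c := price F D (x, a, b)
    set v := around F D (x, a, b)
    set m := lighter F (x, a, b)
    obtain ⟨za, za', za''⟩ := hzero _ (hcx s(x, a) (Sym2.mem_mk_left _ _))
    obtain ⟨zb, zb', zb''⟩ := hzero _ (hcx s(x, b) (Sym2.mem_mk_left _ _))
    refine ⟨N + Pi.single s(x, a) (c : ℤ) + Pi.single s(x, b) (c : ℤ) + Pi.single s(a, b) (c : ℤ),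
      Φ + Pi.single s(x, a) (α * c) + Pi.single s(x, b) (β * c) + Pi.single s(a, b) (γ * c),
      fun e => if e = s(x, a) ∨ e = s(x, b) ∨ e = s(a, b) then max (Y e) c else Y e,
      ?_, fun e he => ?_, fun e he => ?_⟩
    · rw [sum_mul_add_single, hcost, hsum, gxa, gxb, gab]
      push_cast
      rcases hαβγ with ⟨k, rfl, rfl, rfl⟩ | ⟨k, rfl, rfl, rfl⟩ | ⟨k, rfl, rfl, rfl⟩
      · have k' : (d a b : ℤ) = d x a + d x b := by omega
        rw [k']; ring
      · have k' : (d x a : ℤ) = d a b + d x b := by omega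
        rw [k']; ring
      · have k' : (d x b : ℤ) = d x a + d a b := by omega
        rw [k']; ring
    · have e1 : e ≠ s(x, a) := by rintro rfl; exact he (covers_of_mem h.mem_left)
      have e2 : e ≠ s(x, b) := by rintro rfl; exact he (covers_of_mem h.mem_right)
      have e3 : e ≠ s(a, b) := by rintro rfl; exact he h.covers
      have e4 := hzero e fun h' => he (h.covers_reduce_iff.1 h').1
      simp [Pi.single_eq_of_ne, e1, e2, e3, e4]
    · simp only [Pi.add_apply]
      by_cases e1 : e = s(x, a)
      · subst e1
        clear hab hdb hFab hv
        rw [Pi.single_eq_same, Pi.single_eq_same, Pi.single_eq_of_ne n1, Pi.single_eq_of_ne n1,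
          Pi.single_eq_of_ne n2, Pi.single_eq_of_ne n2, za, za', za'', if_pos (.inl rfl),
          max_eq_right (Int.natCast_nonneg c)]
        refine ⟨by omega, ?_, ?_, .inl ⟨by omega, by omega, by omega⟩⟩
        · rcases hαβγ with ⟨k, rfl, rfl, rfl⟩ | ⟨k, rfl, rfl, rfl⟩ | ⟨k, rfl, rfl, rfl⟩ <;> omega
        · rcases hαβγ with ⟨k, rfl, rfl, rfl⟩ | ⟨k, rfl, rfl, rfl⟩ | ⟨k, rfl, rfl, rfl⟩
          · left; omega
          · right
            refine ⟨b, ⟨x, Sym2.eq_swap ▸ h.mem_right⟩, ?_, fun u v huv => ?_⟩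
            · rw [Sym2.mem_iff, not_or]
              exact ⟨h.ne_right.symm, h.ne.symm⟩
            · rcases Sym2.eq_iff.1 huv with ⟨rfl, rfl⟩ | ⟨rfl, rfl⟩ <;> omega
          · left; omega
      by_cases e2 : e = s(x, b)
      · subst e2
        clear hab hda hFab hv
        rw [Pi.single_eq_same, Pi.single_eq_same, Pi.single_eq_of_ne n1.symm,
          Pi.single_eq_of_ne n1.symm,
          Pi.single_eq_of_ne n3, Pi.single_eq_of_ne n3, zb, zb', zb'', if_pos (.inr (.inl rfl)),
          max_eq_right (Int.natCast_nonneg c)]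
        refine ⟨by omega, ?_, ?_, .inl ⟨by omega, by omega, by omega⟩⟩
        · rcases hαβγ with ⟨k, rfl, rfl, rfl⟩ | ⟨k, rfl, rfl, rfl⟩ | ⟨k, rfl, rfl, rfl⟩ <;> omega
        · rcases hαβγ with ⟨k, rfl, rfl, rfl⟩ | ⟨k, rfl, rfl, rfl⟩ | ⟨k, rfl, rfl, rfl⟩
          · left; omega
          · left; omega
          · right
            refine ⟨a, ⟨x, Sym2.eq_swap ▸ h.mem_left⟩, ?_, fun u v huv => ?_⟩
            · rw [Sym2.mem_iff, not_or]
              exact ⟨h.ne_left.symm, h.ne⟩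
            · rcases Sym2.eq_iff.1 huv with ⟨rfl, rfl⟩ | ⟨rfl, rfl⟩ <;> omega
      rw [hDo e1 e2, Pi.single_eq_of_ne e1, Pi.single_eq_of_ne e2, Pi.single_eq_of_ne e1,
        Pi.single_eq_of_ne e2]
      by_cases e3 : e = s(a, b)
      · subst e3
        clear hda hdb
        rw [Pi.single_eq_same, Pi.single_eq_same, if_pos (.inr (.inr rfl))]
        obtain ⟨y0, y1, y2, y3⟩ := hab
        push_cast at y3
        have hor : Φ s(a, b) = - N s(a, b) ∨ γ = -1 := by
          rcases y2 with y2 | ⟨z, hz, hze, hz'⟩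
          · exact .inl y2
          rcases hαβγ with ⟨k, rfl, rfl, rfl⟩ | ⟨k, rfl, rfl, rfl⟩ | ⟨k, rfl, rfl, rfl⟩
          · obtain ⟨hz, hzx⟩ := (hex z).1 hz
            rw [Sym2.mem_iff, not_or] at hze
            exact absurd (hz' a b rfl) (hA.not_between hd h k hz hzx hze.1 hze.2)
          · exact .inr rfl
          · exact .inr rfl
        refine ⟨y0.trans (le_max_left _ _), ?_, ?_, ?_⟩
        · clear y3 hc hm hv hFab
          have := le_max_left (Y s(a, b)) (c : ℤ)
          have := le_max_right (Y s(a, b)) (c : ℤ)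
          generalize max (Y s(a, b)) (c : ℤ) = M at *
          rcases hαβγ with ⟨k, rfl, rfl, rfl⟩ | ⟨k, rfl, rfl, rfl⟩ | ⟨k, rfl, rfl, rfl⟩ <;> omega
        · clear y3 hc hm hv hFab
          rcases hαβγ with ⟨k, rfl, rfl, rfl⟩ | ⟨k, rfl, rfl, rfl⟩ | ⟨k, rfl, rfl, rfl⟩
          · right
            refine ⟨x, ⟨_, h.mem_left⟩, h.not_mem, fun u v huv => ?_⟩
            rcases Sym2.eq_iff.1 huv with ⟨rfl, rfl⟩ | ⟨rfl, rfl⟩ <;> omega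
          all_goals
            rcases y2 with y2 | ⟨z, hz, hz'⟩
            · left; omega
            · exact .inr ⟨z, ((hex z).1 hz).1, hz'⟩
        · have := dual_step (N := N s(a, b)) hv hFab hc (by push_cast; exact y3)
          rwa [add_zero, add_zero]
      · rw [Pi.single_eq_of_ne e3, Pi.single_eq_of_ne e3,
          if_neg fun h' => h'.elim e1 fun h' => h'.elim e2 e3]
        clear hab hda hdb hFab hv hm hc hαβγ
        by_cases hx : x ∈ e
        · have hA : e ∉ A := fun hA => by
            rcases h.eq_or_eq hA hx with h' | h'
            · exact e1 h'
            · exact e2 h'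
          have := hFx e hx
          have := hS e he hA
          obtain ⟨z1, z2, z3⟩ := hzero e (hcx e hx)
          have : D e = 0 := hK.downD_eq F (hcx e hx)
          rw [z1, z2, z3]
          exact ⟨by omega, by omega, .inl (by omega), by omega⟩
        · have := hmain e (h.covers_reduce_iff.2 ⟨he, hx⟩)
          rw [hSo e e3] at this
          obtain ⟨y0, y1, y2, y3⟩ := this
          simp only [add_zero]
          refine ⟨y0, y1, ?_, y3⟩
          rcases y2 with y2 | ⟨z, hz, hz'⟩
          · exact .inl y2
          · exact .inr ⟨z, ((hex z).1 hz).1, hz'⟩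

end TreeMetric

/-! ### Optimality of the computed tree -/

section Optimality

variable {V : Type*} {R A : Set (Sym2 V)} {p q : V} {K : List (V × V × V)}

open SimpleGraph

theorem SimpleGraph.Reachable.of_forall_adj {G H : SimpleGraph V}
    (h : ∀ u v, G.Adj u v → H.Reachable u v) {u v : V} (huv : G.Reachable u v) :
    H.Reachable u v := by
  obtain ⟨w⟩ := huv
  induction w with
  | nil => exact .refl _
  | cons hadj _ ih => exact (h _ _ hadj).trans ih

/-- The graph with the edges on which `C` is `1`. -/
def indicatorGraph (C : Sym2 V → ℕ) : SimpleGraph V :=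
  fromEdgeSet {e | C e = 1}

theorem indicatorGraph_adj {C : Sym2 V → ℕ} {u v : V} :
    (indicatorGraph C).Adj u v ↔ C s(u, v) = 1 ∧ u ≠ v := by
  simp [indicatorGraph]

/-- The removed vertices are different from each other and from `p`, `q`. -/
theorem ReductionSeq.nodup (hK : ReductionSeq R p q K A) (hpq : p ≠ q) :
    (p :: q :: K.map Prod.fst).Nodup ∧ ∀ v ∈ K.map Prod.fst, ∃ y, s(v, y) ∈ A := by
  induction hK with
  | edge => simp [hpq]
  | @step K A x a b hp hq h hR hK ih =>
    obtain ⟨ih1, ih2⟩ := ih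
    have hx : x ∉ K.map Prod.fst := fun hx => ((h.exists_mem_reduce_iff x).1 (ih2 x hx)).2 rfl
    refine ⟨?_, fun v hv => ?_⟩
    · simp only [List.map_cons, List.nodup_cons, List.mem_cons, not_or] at ih1 ⊢
      exact ⟨⟨hpq, hp.symm, ih1.1.2⟩, ⟨hq.symm, ih1.2.1⟩, hx, ih1.2.2⟩
    · rw [List.map_cons, List.mem_cons] at hv
      rcases hv with rfl | hv
      · exact ⟨a, h.mem_left⟩
      · exact ((h.exists_mem_reduce_iff v).1 (ih2 v hv)).1

theorem ReductionSeq.length_add_two_le [Fintype V] (hK : ReductionSeq R p q K A) (hpq : p ≠ q) :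
    K.length + 2 ≤ Fintype.card V := by
  have := (hK.nodup hpq).1.length_le_card
  simp only [List.length_cons, List.length_map] at this
  omega

theorem stretch_mk {T : SimpleGraph V} (u v : V) : T.stretch s(u, v) = T.dist u v := rfl

theorem SimpleGraph.IsTree.isChainMetric {T : SimpleGraph V} (hT : T.IsTree) :
    IsChainMetric fun u v => T.dist u v where
  comm _ _ := T.dist_comm
  triangle _ _ _ := hT.connected.dist_triangle
  eq_of_eq_zero _ _ := hT.connected.dist_eq_zero_iff.1
  chain _ _ _ _ := hT.dist_add_dist_or

theorem SimpleGraph.IsSpanningTree.isSpannedBy {G T : SimpleGraph V} (hT : G.IsSpanningTree T)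
    (hG : ∀ v, ∃ w, G.Adj v w) : IsSpannedBy G.edgeSet fun u v => T.dist u v where
  step u v _ _ huv := by
    obtain ⟨y, hy, h⟩ := hT.2.exists_adj_dist_add_one huv
    refine ⟨y, hT.1 hy, ?_⟩
    have := dist_eq_one_iff_adj.2 hy
    omega
  median u v w _ _ _ := by
    obtain ⟨m, h⟩ := hT.2.exists_median u v w
    exact ⟨m, hG m, h⟩

variable [DecidableEq V]

/-- The computed graph connects all vertices of `A`. -/
theorem ReductionSeq.reachable (hK : ReductionSeq R p q K A) (F : Sym2 V → ℕ) {u v : V}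
    (hu : ∃ y, s(u, y) ∈ A) (hv : ∃ y, s(v, y) ∈ A) :
    (indicatorGraph (downC F p q K)).Reachable u v := by
  induction hK generalizing u v with
  | edge =>
    have hpq : (indicatorGraph (downC F p q [])).Reachable p q := by
      by_cases h : p = q
      · subst h; exact .refl _
      · exact (indicatorGraph_adj.2 ⟨by simp [downC], h⟩).reachable
    have key : ∀ u, (∃ y, s(u, y) ∈ ({s(p, q)} : Set (Sym2 V))) → u = p ∨ u = q := by
      rintro u ⟨y, hy⟩
      rw [Set.mem_singleton_iff, Sym2.eq_iff] at hy
      tauto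
    rcases key u hu with rfl | rfl <;> rcases key v hv with rfl | rfl
    · exact .refl _
    · exact hpq
    · exact hpq.symm
    · exact .refl _
  | @step K A x a b hp hq h hR hK ih =>
    obtain ⟨n1, n2, n3⟩ := h.sym2_ne
    obtain ⟨_, _, _, hopt⟩ := downC_cons F p q K n1 n2 n3
    have hzero : ∀ y, downC F p q K s(x, y) = 0 := fun y => hK.downC_eq F fun hc =>
      (h.covers_reduce_iff.1 hc).2 (Sym2.mem_mk_left _ _)
    have hadj : ∀ y, x ≠ y → downC F p q ((x, a, b) :: K) s(x, y) = 1 →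
        (indicatorGraph (downC F p q ((x, a, b) :: K))).Reachable x y := fun y hy h1 =>
      (indicatorGraph_adj.2 ⟨h1, hy⟩).reachable
    have ha := hadj a h.ne_left
    have hb := hadj b h.ne_right
    have hstep : ∀ u v, (indicatorGraph (downC F p q K)).Adj u v →
        (indicatorGraph (downC F p q ((x, a, b) :: K))).Reachable u v := by
      intro u v huv
      rw [indicatorGraph_adj] at huv
      have e1 : s(u, v) ≠ s(x, a) := fun h' => by rw [h', hzero] at huv; simp at huv
      have e2 : s(u, v) ≠ s(x, b) := fun h' => by rw [h', hzero] at huv; simp at huv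
      by_cases e3 : s(u, v) = s(a, b)
      · have hab : (indicatorGraph (downC F p q ((x, a, b) :: K))).Reachable a b := by
          rcases hopt with ⟨-, -, -, -, -, h1, h2, -⟩ | ⟨-, -, -, -, -, -, -, h3⟩ |
            ⟨-, -, -, -, -, -, -, h3⟩
          · exact (ha h1).symm.trans (hb h2)
          all_goals
            rw [e3, ← h3] at huv
            exact (indicatorGraph_adj.2 ⟨huv.1, h.ne⟩).reachable
        rcases Sym2.eq_iff.1 e3 with ⟨rfl, rfl⟩ | ⟨rfl, rfl⟩
        · exact hab
        · exact hab.symm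
      · exact (indicatorGraph_adj.2 ⟨by rw [downC_of_ne F p q K e1 e2 e3]; exact huv.1,
          huv.2⟩).reachable
    have hex := h.exists_mem_reduce_iff
    have hxz : ∃ z, z ≠ x ∧ (∃ y, s(z, y) ∈ A) ∧
        (indicatorGraph (downC F p q ((x, a, b) :: K))).Reachable x z := by
      rcases hopt with ⟨-, -, -, -, -, h1, -, -⟩ | ⟨-, -, -, -, -, -, h2, -⟩ |
        ⟨-, -, -, -, -, h1, -, -⟩
      · exact ⟨a, h.ne_left.symm, ⟨x, Sym2.eq_swap ▸ h.mem_left⟩, ha h1⟩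
      · exact ⟨b, h.ne_right.symm, ⟨x, Sym2.eq_swap ▸ h.mem_right⟩, hb h2⟩
      · exact ⟨a, h.ne_left.symm, ⟨x, Sym2.eq_swap ▸ h.mem_left⟩, ha h1⟩
    obtain ⟨z, hzx, hz, hreach⟩ := hxz
    have key : ∀ u, (∃ y, s(u, y) ∈ A) →
        (indicatorGraph (downC F p q ((x, a, b) :: K))).Reachable u z := by
      intro u hu
      by_cases hux : u = x
      · subst hux; exact hreach
      · exact (ih ((hex u).2 ⟨hu, hux⟩) ((hex z).2 ⟨hz, hzx⟩)).of_forall_adj hstep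
    exact (key u hu).trans (key v hv).symm

/-- Each step adds one edge to the computed graph. -/
theorem ReductionSeq.card_le [Fintype V] (hK : ReductionSeq R p q K A) (F : Sym2 V → ℕ) :
    (Finset.univ.filter fun e => downC F p q K e = 1).card ≤ K.length + 1 := by
  induction hK with
  | edge =>
    rw [List.length_nil, Finset.card_le_one]
    have : ∀ e, downC F p q [] e = 1 → e = s(p, q) := fun e he => by
      by_contra h
      rw [downC, Pi.single_eq_of_ne h] at he
      simp at he
    intro e he e' he'
    rw [this e (Finset.mem_filter.1 he).2, this e' (Finset.mem_filter.1 he').2]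
  | @step K A x a b hp hq h hR hK ih =>
    obtain ⟨n1, n2, n3⟩ := h.sym2_ne
    obtain ⟨_, _, _, hopt⟩ := downC_cons F p q K n1 n2 n3
    have hne := fun {e : Sym2 V} => downC_of_ne F p q K (x := x) (a := a) (b := b) (e := e)
    set C := downC F p q K
    set C' := downC F p q ((x, a, b) :: K)
    have key : ∀ f : Sym2 V, (∀ e, C' e = 1 → C e = 1 ∨ e = f) →
        (Finset.univ.filter fun e => C' e = 1).card ≤ K.length + 1 + 1 := by
      intro f hf
      refine le_trans (Finset.card_le_card (t := insert f (Finset.univ.filter fun e => C e = 1))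
        ?_) ((Finset.card_insert_le _ _).trans (Nat.add_le_add_right ih 1))
      intro e he
      rw [Finset.mem_insert, Finset.mem_filter]
      rcases hf e (Finset.mem_filter.1 he).2 with h' | h'
      · exact .inr ⟨Finset.mem_univ _, h'⟩
      · exact .inl h'
    rw [List.length_cons]
    rcases hopt with ⟨h0, -, -, -, -, h1, h2, h3⟩ | ⟨-, -, -, -, -, h1, h2, h3⟩ |
      ⟨-, -, -, -, -, h1, h2, h3⟩
    · have hsub : (Finset.univ.filter fun e => C' e = 1) ⊆ insert s(x, a) (insert s(x, b)
          ((Finset.univ.filter fun e => C e = 1).erase s(a, b))) := by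
        intro e he
        have he := (Finset.mem_filter.1 he).2
        simp only [Finset.mem_insert, Finset.mem_erase, Finset.mem_filter, Finset.mem_univ,
          true_and]
        by_cases e1 : e = s(x, a)
        · exact .inl e1
        by_cases e2 : e = s(x, b)
        · exact .inr (.inl e2)
        by_cases e3 : e = s(a, b)
        · rw [e3, h3] at he; simp at he
        · exact .inr (.inr ⟨e3, by rw [← hne e1 e2 e3]; exact he⟩)
      have c1 := Finset.card_le_card hsub
      have c2 := Finset.card_insert_le s(x, a) (insert s(x, b)
        ((Finset.univ.filter fun e => C e = 1).erase s(a, b)))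
      have c3 := Finset.card_insert_le s(x, b)
        ((Finset.univ.filter fun e => C e = 1).erase s(a, b))
      have c4 := Finset.card_erase_add_one
        (show s(a, b) ∈ Finset.univ.filter fun e => C e = 1 by simpa using h0)
      omega
    · refine key s(x, b) fun e he => ?_
      by_cases e1 : e = s(x, a)
      · rw [e1, h1] at he; simp at he
      by_cases e2 : e = s(x, b)
      · exact .inr e2
      by_cases e3 : e = s(a, b)
      · rw [e3, h3] at he; rw [e3]; exact .inl he
      · rw [hne e1 e2 e3] at he; exact .inl he
    · refine key s(x, a) fun e he => ?_
      by_cases e1 : e = s(x, a)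
      · exact .inr e1
      by_cases e2 : e = s(x, b)
      · rw [e2, h2] at he; simp at he
      by_cases e3 : e = s(a, b)
      · rw [e3, h3] at he; rw [e3]; exact .inl he
      · rw [hne e1 e2 e3] at he; exact .inl he

variable [Fintype V] {G : SimpleGraph V} {S F : Sym2 V → ℕ}

/-- The sum of the prices is a lower bound for all spanning trees. -/
theorem ReductionSeq.cost_le {T : SimpleGraph V} (hG : ∀ v, ∃ w, G.Adj v w)
    (hK : ReductionSeq G.edgeSet p q K G.edgeSet) (hF : upPass S K = F)
    (hS : ∀ e, e ∉ G.edgeSet → S e = 0) (hT : G.IsSpanningTree T) :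
    (cost F K : ℤ) ≤ ∑ e, ((T.stretch e : ℤ) - 1) * S e := by
  obtain ⟨N, Φ, Y, hsum, -, hmain⟩ := hK.exists_dual hT.2.isChainMetric (hT.isSpannedBy hG) S hF
    (fun e _ he => hS e he) (g := fun e => ((T.stretch e - 1 : ℕ) : ℤ)) (by
      intro u v huv
      have := hT.2.connected.pos_dist_of_ne huv
      rw [stretch_mk]
      omega)
  rw [← hsum]
  refine Finset.sum_le_sum fun e _ => ?_
  have h1 := hmain e fun v _ => hG v
  have hΦ : Φ e ≤ S e := by omega
  refine (mul_le_mul_of_nonneg_left hΦ (Int.natCast_nonneg _)).trans (le_of_eq ?_)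
  by_cases he : e ∈ G.edgeSet
  · congr 1
    induction e with
    | _ u v =>
      have := hT.2.connected.pos_dist_of_ne ((mem_edgeSet G).1 he).ne
      rw [stretch_mk]
      omega
  · simp [hS e he]

/-- The computed graph is connected and has few enough edges to be a tree. It consists of edges of
`G`, since an edge created by the reduction is always left out in the end. -/
theorem ReductionSeq.isSpanningTree (hpq : p ≠ q) (hG : ∀ v, ∃ w, G.Adj v w)
    (hK : ReductionSeq G.edgeSet p q K G.edgeSet) (hF : upPass S K = F)
    (hS : ∀ e, e ∉ G.edgeSet → S e = 0) :
    G.IsSpanningTree (indicatorGraph (downC F p q K)) := by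
  obtain ⟨Φ, -, -, hmain⟩ := hK.exists_slack S hF (fun e he _ => he) (fun e _ he => hS e he)
  refine ⟨fun u v huv => ?_, isTree_iff_connected_and_card.2 ⟨?_, ?_⟩⟩
  · rw [indicatorGraph_adj] at huv
    rcases (hmain s(u, v) fun v _ => hG v).2 with h | h
    · exact h.2.1
    · omega
  · have : Nonempty V := ⟨p⟩
    exact ⟨fun u v => hK.reachable F (hG u) (hG v)⟩
  · have hconn : (indicatorGraph (downC F p q K)).Connected := by
      have : Nonempty V := ⟨p⟩
      exact ⟨fun u v => hK.reachable F (hG u) (hG v)⟩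
    have h1 := hconn.card_vert_le_card_edgeSet_add_one
    have h2 := hK.card_le F
    have h3 := hK.length_add_two_le hpq
    rw [Nat.card_eq_fintype_card (α := V)] at h1 ⊢
    have h4 : Nat.card (indicatorGraph (downC F p q K)).edgeSet ≤
        (Finset.univ.filter fun e => downC F p q K e = 1).card := by
      rw [Nat.card_coe_set_eq, ← Set.ncard_coe_finset]
      refine Set.ncard_le_ncard ?_ (Set.toFinite _)
      intro e he
      rw [indicatorGraph, edgeSet_fromEdgeSet] at he
      simpa using he.1
    omega

/-- The sum of the prices is attained by the computed tree. -/
theorem ReductionSeq.le_cost (hpq : p ≠ q) (hG : ∀ v, ∃ w, G.Adj v w)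
    (hK : ReductionSeq G.edgeSet p q K G.edgeSet) (hF : upPass S K = F)
    (hS : ∀ e, e ∉ G.edgeSet → S e = 0) :
    ∑ e, (((indicatorGraph (downC F p q K)).stretch e : ℤ) - 1) * S e ≤ cost F K := by
  have hT := (hK.isSpanningTree hpq hG hF hS).2.connected
  obtain ⟨Φ, hsum, -, hmain⟩ := hK.exists_slack S hF (fun e he _ => he) (fun e _ he => hS e he)
  refine le_trans (le_of_eq ?_)
    (hsum (fun e => ((indicatorGraph (downC F p q K)).stretch e : ℤ) - 1) ?_)
  · refine Finset.sum_congr rfl fun e _ => ?_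
    rcases (hmain e fun v _ => hG v).2 with ⟨h1, h2, -⟩ | ⟨-, h, -⟩
    · have : (indicatorGraph (downC F p q K)).stretch e = 1 := by
        induction e with
        | _ u v =>
          rw [stretch_mk]
          exact dist_eq_one_iff_adj.2 (indicatorGraph_adj.2 ⟨h1, ((mem_edgeSet G).1 h2).ne⟩)
      simp [this]
    · rw [h]
  · intro u v w
    have := hT.dist_triangle (u := u) (v := v) (w := w)
    simp only [stretch_mk]
    omega

/-- The computed tree attains the lower bound, hence is optimal. -/
theorem ReductionSeq.isMinAvgStretchSpanningTree (hpq : p ≠ q) (hG : ∀ v, ∃ w, G.Adj v w)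
    (hK : ReductionSeq G.edgeSet p q K G.edgeSet) (hF : upPass S K = F)
    (hS : ∀ e, e ∉ G.edgeSet → S e = 0) (hS' : ∀ e ∈ G.edgeSet, S e = 1) :
    G.IsMinAvgStretchSpanningTree (indicatorGraph (downC F p q K)) := by
  classical
  refine ⟨hK.isSpanningTree hpq hG hF hS, fun T' hT' => ?_⟩
  have h1 := (hK.le_cost hpq hG hF hS).trans (hK.cost_le hG hF hS hT')
  have key : ∀ T : SimpleGraph V, ∑ e, ((T.stretch e : ℤ) - 1) * S e =
      ∑ e ∈ G.edgeFinset, ((T.stretch e : ℤ) - 1) := by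
    intro T
    rw [← Finset.sum_subset (Finset.subset_univ G.edgeFinset)]
    · exact Finset.sum_congr rfl fun e he => by rw [hS' e (mem_edgeFinset.1 he)]; simp
    · intro e _ he
      rw [hS e fun h => he (mem_edgeFinset.2 h)]; simp
  rw [key, key, Finset.sum_sub_distrib, Finset.sum_sub_distrib] at h1
  have h2 : (∑ e ∈ G.edgeFinset, ((indicatorGraph (downC F p q K)).stretch e : ℤ)) ≤
      ∑ e ∈ G.edgeFinset, (T'.stretch e : ℤ) := by linarith
  have h3 : (∑ e ∈ G.edgeFinset, ((indicatorGraph (downC F p q K)).stretch e : ℚ)) ≤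
      ∑ e ∈ G.edgeFinset, (T'.stretch e : ℚ) := by exact_mod_cast h2
  unfold avgStretch
  convert div_le_div_of_nonneg_right h3 (Nat.cast_nonneg (α := ℚ) (G.edgeFinset.card)) using 1

end Optimality

/-! ### Expressions and commands for the word RAM -/

namespace RAM

/-- Arithmetic expressions over registers and arrays. -/
inductive Ex
  /-- a constant -/
  | lit (k : ℕ)
  /-- the word in a register -/
  | reg (x : ℕ)
  /-- the result of an arithmetic instruction -/
  | op (o : Op) (e f : Ex)
  /-- the word at an index of an array -/
  | get (a : ℕ) (e : Ex)

namespace Ex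

/-- The value of an expression. -/
def val (s : State) : Ex → ℕ
  | lit k => k
  | reg x => s.reg x
  | op o e f => o.eval (e.val s) (f.val s)
  | get a e => s.arr a (e.val s)

/-- All words that are computed on the way to the value are smaller than `W`. -/
def Fits (W : ℕ) (s : State) : Ex → Prop
  | lit k => k < W
  | reg _ => True
  | op o e f => e.Fits W s ∧ f.Fits W s ∧ o.eval (e.val s) (f.val s) < W
  | get _ e => e.Fits W s

/-- A program that computes the value of an expression in the register `t`, with the registers from
`t` on as working space. -/
def code (t : ℕ) : Ex → Prog
  | lit k => .const t k
  | reg x => .copy t x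
  | op o e f => .seq (e.code t) (.seq (f.code (t + 1)) (.op o t t (t + 1)))
  | get a e => .seq (e.code t) (.load t a t)

/-- The running time of `code`. -/
def time : Ex → ℕ
  | lit _ => 1
  | reg _ => 1
  | op _ e f => e.time + (f.time + 1)
  | get _ e => e.time + 1

/-- Only registers below `32` occur; those from `32` on are the working space. -/
def low : Ex → Bool
  | lit _ => true
  | reg x => x < 32
  | op _ e f => e.low && f.low
  | get _ e => e.low

end Ex

/-- The states `s` and `s'` agree up to the registers of the working space. -/
def Sim (s s' : State) : Prop :=
  s.arr = s'.arr ∧ ∀ r < 32, s.reg r = s'.reg r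

theorem Ex.val_congr {s s' : State} {e : Ex} {b : ℕ} (hb : 32 ≤ b) (harr : s.arr = s'.arr)
    (hreg : ∀ r < b, s.reg r = s'.reg r) (he : e.low = true) : e.val s = e.val s' := by
  induction e with
  | lit k => rfl
  | reg x => exact hreg x (lt_of_lt_of_le (by simpa [Ex.low] using he) hb)
  | op o e f ihe ihf =>
    simp only [Ex.low, Bool.and_eq_true] at he
    simp only [Ex.val, ihe he.1, ihf he.2]
  | get a e ih => simp only [Ex.val, ih he, harr]

theorem Ex.fits_congr {W : ℕ} {s s' : State} {e : Ex} {b : ℕ} (hb : 32 ≤ b)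
    (harr : s.arr = s'.arr) (hreg : ∀ r < b, s.reg r = s'.reg r) (he : e.low = true)
    (h : e.Fits W s) : e.Fits W s' := by
  induction e with
  | lit k => exact h
  | reg x => trivial
  | op o e f ihe ihf =>
    simp only [Ex.low, Bool.and_eq_true] at he
    refine ⟨ihe he.1 h.1, ihf he.2 h.2.1, ?_⟩
    rw [← Ex.val_congr hb harr hreg he.1, ← Ex.val_congr hb harr hreg he.2]
    exact h.2.2
  | get a e ih => exact ih he h

theorem Ex.exec_code {W : ℕ} {e : Ex} {t : ℕ} (ht : 32 ≤ t) (he : e.low = true) {s : State}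
    (h : e.Fits W s) : ∃ s', Exec W (e.code t) s e.time s' ∧ s'.arr = s.arr ∧
      (∀ r < t, s'.reg r = s.reg r) ∧ s'.reg t = e.val s := by
  induction e generalizing t s with
  | lit k =>
    exact ⟨_, .const s t k h, rfl, fun r hr => Function.update_of_ne hr.ne _ _,
      Function.update_self _ _ _⟩
  | reg x =>
    exact ⟨_, .copy s t x, rfl, fun r hr => Function.update_of_ne hr.ne _ _,
      Function.update_self _ _ _⟩
  | op o e f ihe ihf =>
    simp only [Ex.low, Bool.and_eq_true] at he
    obtain ⟨s₁, h1, a1, r1, v1⟩ := ihe ht he.1 h.1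
    obtain ⟨s₂, h2, a2, r2, v2⟩ := ihf (t := t + 1) (by omega) he.2
      (Ex.fits_congr ht a1.symm (fun r hr => (r1 r hr).symm) he.2 h.2.1)
    have v3 : s₂.reg t = e.val s := by rw [r2 t (by omega), v1]
    have v4 : s₂.reg (t + 1) = f.val s := by
      rw [v2, Ex.val_congr ht a1 r1 he.2]
    refine ⟨_, .seq h1 (.seq h2 (.op s₂ o t t (t + 1) (by rw [v3, v4]; exact h.2.2))), ?_, ?_, ?_⟩
    · exact a2.trans a1
    · intro r hr
      refine (Function.update_of_ne hr.ne _ _).trans ?_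
      rw [r2 r (by omega), r1 r hr]
    · refine (Function.update_self _ _ _).trans ?_
      rw [v3, v4]; rfl
  | get a e ih =>
    obtain ⟨s₁, h1, a1, r1, v1⟩ := ih ht he h
    refine ⟨_, .seq h1 (.load s₁ t a t), a1, ?_, ?_⟩
    · intro r hr
      exact (Function.update_of_ne hr.ne _ _).trans (r1 r hr)
    · refine (Function.update_self _ _ _).trans ?_
      rw [v1, a1]; rfl

/-- Commands: programs with expressions in place of single instructions. -/
inductive Cmd
  /-- assign the value of an expression to a register -/
  | set (x : ℕ) (e : Ex)
  /-- write the value of `f` at the index `e` of an array -/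
  | put (a : ℕ) (e f : Ex)
  /-- one command after the other -/
  | seq (c d : Cmd)
  /-- a branch -/
  | ite (r : Cmp) (e f : Ex) (c d : Cmd)
  /-- a loop -/
  | loop (r : Cmp) (e f : Ex) (c : Cmd)

namespace Cmd

/-- The program that a command stands for. -/
def code : Cmd → Prog
  | set x e => .seq (e.code 32) (.copy x 32)
  | put a e f => .seq (e.code 32) (.seq (f.code 33) (.store a 32 33))
  | seq c d => .seq c.code d.code
  | ite r e f c d => .seq (e.code 32) (.seq (f.code 33) (.ite r 32 33 c.code d.code))
  | loop r e f c => .seq (e.code 32) (.seq (f.code 33)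
      (.while r 32 33 (.seq c.code (.seq (e.code 32) (f.code 33)))))

/-- A bound on the running time of a command without loops. For commands with loops that are not
nested and run through at most `2 * n` rounds each, `n` times this number is a bound. -/
def time : Cmd → ℕ
  | set _ e => e.time + 1
  | put _ e f => e.time + (f.time + 1)
  | seq c d => c.time + d.time
  | ite _ e f c d => e.time + (f.time + (max c.time d.time + 1))
  | loop _ e f c => 2 * (c.time + (e.time + f.time) + 1) + (e.time + f.time + 1)

/-- The command leaves the working space alone. -/
def low : Cmd → Bool
  | set x e => x < 32 && e.low
  | put _ e f => e.low && f.low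
  | seq c d => c.low && d.low
  | ite _ e f c d => e.low && f.low && c.low && d.low
  | loop _ e f c => e.low && f.low && c.low

/-- A condition on the initial state under which a command without loops ends in a state with
`Q`. -/
def wp (W : ℕ) : Cmd → (State → Prop) → State → Prop
  | set x e, Q, s => e.Fits W s ∧ ∀ v, v = e.val s → Q (s.setReg x v)
  | put a e f, Q, s => e.Fits W s ∧ f.Fits W s ∧
      ∀ i v, i = e.val s → v = f.val s → Q (s.setArr a i v)
  | seq c d, Q, s => c.wp W (d.wp W Q) s
  | ite r e f c d, Q, s => e.Fits W s ∧ f.Fits W s ∧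
      (r.holds (e.val s) (f.val s) → c.wp W Q s) ∧ (¬ r.holds (e.val s) (f.val s) → d.wp W Q s)
  | loop _ _ _ _, _, _ => False

end Cmd

/-- Started in `s`, the command `c` ends after at most `T` steps in a state with `Q`. -/
def Runs (W : ℕ) (c : Cmd) (s : State) (T : ℕ) (Q : State → Prop) : Prop :=
  ∀ s', Sim s' s → ∃ t s'' s₂, Exec W c.code s' t s'' ∧ t ≤ T ∧ Sim s'' s₂ ∧ Q s₂

variable {W T : ℕ} {c d : Cmd} {s : State} {Q Q' : State → Prop}

theorem Runs.mono (h : Runs W c s T Q) {T' : ℕ} (hT : T ≤ T') (hQ : ∀ s, Q s → Q' s) :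
    Runs W c s T' Q' := by
  intro s' hs
  obtain ⟨t, s'', s₂, h1, h2, h3, h4⟩ := h s' hs
  exact ⟨t, s'', s₂, h1, h2.trans hT, h3, hQ _ h4⟩

theorem Runs.seq {T₁ T₂ : ℕ} (h : Runs W c s T₁ fun s => Runs W d s T₂ Q) :
    Runs W (.seq c d) s (T₁ + T₂) Q := by
  intro s' hs
  obtain ⟨t, s'', s₂, h1, h2, h3, h4⟩ := h s' hs
  obtain ⟨t', s₃, s₄, h5, h6, h7, h8⟩ := h4 s'' h3
  exact ⟨_, s₃, s₄, .seq h1 h5, by omega, h7, h8⟩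

theorem Sim.trans_eq {s₁ s₂ s₃ : State} (h : Sim s₂ s₃) (ha : s₁.arr = s₂.arr)
    (hr : ∀ r < 32, s₁.reg r = s₂.reg r) : Sim s₁ s₃ :=
  ⟨ha.trans h.1, fun r hr' => (hr r hr').trans (h.2 r hr')⟩

theorem exec_code_code {e f : Ex} (he : e.low = true) (hf : f.low = true)
    {s s' : State} (hs : Sim s' s) (h1 : e.Fits W s) (h2 : f.Fits W s) :
    ∃ s₁ s₂, Exec W (e.code 32) s' e.time s₁ ∧ Exec W (f.code 33) s₁ f.time s₂ ∧ Sim s₂ s ∧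
      s₂.reg 32 = e.val s ∧ s₂.reg 33 = f.val s := by
  have hs' : Sim s s' := ⟨hs.1.symm, fun r hr => (hs.2 r hr).symm⟩
  obtain ⟨s₁, x1, a1, r1, v1⟩ := Ex.exec_code (t := 32) le_rfl he
    (Ex.fits_congr le_rfl hs'.1 hs'.2 he h1)
  have hs₁ : Sim s₁ s := hs.trans_eq a1 r1
  obtain ⟨s₂, x2, a2, r2, v2⟩ := Ex.exec_code (t := 33) (by omega) hf
    (Ex.fits_congr le_rfl hs₁.1.symm (fun r hr => (hs₁.2 r hr).symm) hf h2)
  refine ⟨s₁, s₂, x1, x2, hs₁.trans_eq a2 fun r hr => r2 r (by omega), ?_, ?_⟩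
  · rw [r2 32 (by omega), v1, Ex.val_congr le_rfl hs.1 hs.2 he]
  · rw [v2, Ex.val_congr le_rfl hs₁.1 hs₁.2 hf]

theorem runs_of_wp (hc : c.low = true) (h : c.wp W Q s) : Runs W c s c.time Q := by
  induction c generalizing s Q with
  | set x e =>
    simp only [Cmd.low, Bool.and_eq_true, decide_eq_true_eq] at hc
    intro s' hs
    obtain ⟨s₁, x1, a1, r1, v1⟩ := Ex.exec_code (t := 32) le_rfl hc.2
      (Ex.fits_congr le_rfl hs.1.symm (fun r hr => (hs.2 r hr).symm) hc.2 h.1)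
    refine ⟨_, _, s.setReg x (e.val s), .seq x1 (.copy s₁ x 32), le_rfl,
      ⟨a1.trans hs.1, fun r hr => ?_⟩, h.2 _ rfl⟩
    simp only [State.setReg, Function.update_apply]
    rw [v1, Ex.val_congr le_rfl hs.1 hs.2 hc.2, r1 r hr, hs.2 r hr]
  | put a e f =>
    simp only [Cmd.low, Bool.and_eq_true] at hc
    intro s' hs
    obtain ⟨s₁, s₂, x1, x2, hs₂, v1, v2⟩ := exec_code_code hc.1 hc.2 hs h.1 h.2.1
    refine ⟨_, _, s.setArr a (e.val s) (f.val s), .seq x1 (.seq x2 (.store s₂ a 32 33)), le_rfl,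
      ⟨?_, hs₂.2⟩,
      h.2.2 _ _ rfl rfl⟩
    simp only [State.setArr, v1, v2, hs₂.1]
  | seq c d ihc ihd =>
    simp only [Cmd.low, Bool.and_eq_true] at hc
    exact Runs.seq ((ihc hc.1 h).mono le_rfl fun s hs => ihd hc.2 hs)
  | ite r e f c d ihc ihd =>
    simp only [Cmd.low, Bool.and_eq_true] at hc
    intro s' hs
    obtain ⟨s₁, s₂, x1, x2, hs₂, v1, v2⟩ := exec_code_code hc.1.1.1 hc.1.1.2 hs h.1 h.2.1
    by_cases hr : r.holds (e.val s) (f.val s)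
    · obtain ⟨t, s₃, s₄, h1, h2, h3, h4⟩ := ihc hc.1.2 (h.2.2.1 hr) s₂ hs₂
      refine ⟨_, s₃, s₄, .seq x1 (.seq x2 (.iteTrue (by rwa [v1, v2]) h1)), ?_, h3, h4⟩
      have := le_max_left c.time d.time
      simp only [Cmd.time]
      omega
    · obtain ⟨t, s₃, s₄, h1, h2, h3, h4⟩ := ihd hc.2 (h.2.2.2 hr) s₂ hs₂
      refine ⟨_, s₃, s₄, .seq x1 (.seq x2 (.iteFalse (by rwa [v1, v2]) h1)), ?_, h3, h4⟩
      have := le_max_right c.time d.time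
      simp only [Cmd.time]
      omega
  | loop r e f c ih => exact absurd h id

/-- A loop that is run through exactly `N` times; `I i` holds after `i` rounds. -/
theorem runs_loop {r : Cmp} {e f : Ex} (he : e.low = true) (hf : f.low = true)
    (I : ℕ → State → Prop) (N : ℕ) (hfits : ∀ i s, I i s → e.Fits W s ∧ f.Fits W s)
    (hstep : ∀ i < N, ∀ s, I i s → r.holds (e.val s) (f.val s) ∧ Runs W c s T (I (i + 1)))
    (hend : ∀ s, I N s → ¬ r.holds (e.val s) (f.val s)) (h0 : I 0 s) :
    Runs W (.loop r e f c) s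
      (N * (T + (e.time + f.time) + 1) + (e.time + f.time + 1)) (I N) := by
  have key : ∀ k i, i + k = N → ∀ s₀ s', I i s₀ → Sim s' s₀ → s'.reg 32 = e.val s₀ →
      s'.reg 33 = f.val s₀ →
      ∃ t s'' s₂, Exec W (.while r 32 33 (.seq c.code (.seq (e.code 32) (f.code 33)))) s' t s'' ∧
        t ≤ k * (T + (e.time + f.time) + 1) + 1 ∧ Sim s'' s₂ ∧ I N s₂ := by
    intro k
    induction k with
    | zero =>
      intro i hi s₀ s' hI hs v1 v2
      obtain rfl : i = N := by omega
      exact ⟨1, s', s₀, .whileFalse (by rw [v1, v2]; exact hend _ hI), by omega, hs, hI⟩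
    | succ k ih =>
      intro i hi s₀ s' hI hs v1 v2
      obtain ⟨hr, hrun⟩ := hstep i (by omega) s₀ hI
      obtain ⟨t, s₁, s₂, x1, ht, hs₁, hI'⟩ := hrun s' hs
      obtain ⟨g1, g2⟩ := hfits _ _ hI'
      obtain ⟨s₃, s₄, x2, x3, hs₄, w1, w2⟩ := exec_code_code he hf hs₁ g1 g2
      obtain ⟨t', s₅, s₆, x4, ht', hs₅, hN⟩ := ih (i + 1) (by omega) s₂ s₄ hI' hs₄ w1 w2
      refine ⟨_, s₅, s₆, .whileTrue (by rwa [v1, v2]) (.seq x1 (.seq x2 x3)) x4, ?_, hs₅, hN⟩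
      rw [Nat.succ_mul]
      omega
  intro s' hs
  obtain ⟨g1, g2⟩ := hfits _ _ h0
  obtain ⟨s₃, s₄, x2, x3, hs₄, w1, w2⟩ := exec_code_code he hf hs g1 g2
  obtain ⟨t, s₅, s₆, x4, ht, hs₅, hN⟩ := key N 0 (by omega) s s₄ h0 hs₄ w1 w2
  exact ⟨_, s₅, s₆, .seq x2 (.seq x3 x4), by omega, hs₅, hN⟩

end RAM

/-! ### Sums over neighbours and partial reductions -/

section Neighbours

variable {V : Type*} [Fintype V]

open Classical in
/-- The sum of the values of `f` at the neighbours of `v` along edges in `A`. -/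
noncomputable def nbSum (A : Set (Sym2 V)) (f : V → ℕ) (v : V) : ℕ :=
  ∑ u, if s(v, u) ∈ A then f u else 0

variable {A : Set (Sym2 V)} {f : V → ℕ} {x a b v : V}

theorem nbSum_le {c : ℕ} (hf : ∀ u, f u ≤ c) : nbSum A f v ≤ Fintype.card V * c := by
  classical
  rw [nbSum, ← smul_eq_mul, ← Finset.card_univ]
  refine Finset.sum_le_card_nsmul _ _ _ fun u _ => ?_
  split_ifs
  · exact hf u
  · exact Nat.zero_le _

theorem nbSum_eq_zero (h : ∀ y, s(v, y) ∉ A) : nbSum A f v = 0 :=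
  Finset.sum_eq_zero fun u _ => if_neg (h u)

theorem le_nbSum (h : s(v, a) ∈ A) : f a ≤ nbSum A f v := by
  classical
  have := Finset.single_le_sum (f := fun u => if s(v, u) ∈ A then f u else 0)
    (fun u _ => Nat.zero_le _) (Finset.mem_univ a)
  simpa [h, nbSum] using this

theorem add_le_nbSum (hab : a ≠ b) (ha : s(v, a) ∈ A) (hb : s(v, b) ∈ A) :
    f a + f b ≤ nbSum A f v := by
  classical
  have := Finset.sum_le_sum_of_subset_of_nonneg (f := fun u => if s(v, u) ∈ A then f u else 0)
    (Finset.subset_univ {a, b}) (fun u _ _ => Nat.zero_le _)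
  rw [Finset.sum_pair hab, if_pos ha, if_pos hb] at this
  exact this

theorem HasTwoNeighbors.nbSum_eq (h : HasTwoNeighbors A x a b) : nbSum A f x = f a + f b := by
  classical
  have : ∀ u, (if s(x, u) ∈ A then f u else 0) =
      (if a = u then f u else 0) + (if b = u then f u else 0) := by
    intro u
    have h1 := h.mem_iff u
    have h2 := h.ne
    by_cases hu : s(x, u) ∈ A
    · rcases h1.1 hu with rfl | rfl
      · simp [hu, h2.symm]
      · simp [hu, h2]
    · have : ¬ (u = a ∨ u = b) := fun h => hu (h1.2 h)
      rw [not_or] at this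
      simp [hu, Ne.symm this.1, Ne.symm this.2]
  rw [nbSum, Finset.sum_congr rfl fun u _ => this u, Finset.sum_add_distrib]
  simp

theorem exists_hasTwoNeighbors (hA : ∀ y, s(y, y) ∉ A) (h : nbSum A 1 x = 2) :
    ∃ a b, HasTwoNeighbors A x a b := by
  classical
  have : (Finset.univ.filter fun u => s(x, u) ∈ A).card = 2 := by
    rw [← h, nbSum, Finset.card_filter]
    rfl
  obtain ⟨a, b, hab, hs⟩ := Finset.card_eq_two.1 this
  have hm : ∀ y, s(x, y) ∈ A ↔ y = a ∨ y = b := by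
    intro y
    have := congrArg (y ∈ ·) hs
    simpa using this
  refine ⟨a, b, hab, ?_, ?_, hm⟩
  · rintro rfl
    exact hA _ ((hm _).2 (.inl rfl))
  · rintro rfl
    exact hA _ ((hm _).2 (.inr rfl))

variable [DecidableEq V]

theorem nbSum_insert (hab : a ≠ b) (h : s(a, b) ∉ A) : nbSum (insert s(a, b) A) f v =
    nbSum A f v + ((if v = a then f b else 0) + (if v = b then f a else 0)) := by
  classical
  have key : ∀ u, (if s(v, u) ∈ insert s(a, b) A then f u else 0) =
      (if s(v, u) ∈ A then f u else 0) + ((if b = u then (if v = a then f b else 0) else 0) +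
        (if a = u then (if v = b then f a else 0) else 0)) := by
    intro u
    by_cases h1 : s(v, u) = s(a, b)
    · have h2 : s(v, u) ∉ A := h1 ▸ h
      rw [if_pos (Set.mem_insert_iff.2 (.inl h1)), if_neg h2]
      rcases Sym2.eq_iff.1 h1 with ⟨rfl, rfl⟩ | ⟨rfl, rfl⟩
      · simp [hab]
      · simp [hab.symm]
    · have h2 : s(v, u) ∈ insert s(a, b) A ↔ s(v, u) ∈ A := by
        rw [Set.mem_insert_iff]
        exact or_iff_right h1
      rw [Sym2.eq_iff] at h1
      rw [if_congr h2 rfl rfl]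
      by_cases hb : b = u <;> by_cases ha : a = u <;> grind
  have hsum : nbSum (insert s(a, b) A) f v = ∑ u, ((if s(v, u) ∈ A then f u else 0) +
      ((if b = u then (if v = a then f b else 0) else 0) +
        (if a = u then (if v = b then f a else 0) else 0))) :=
    Finset.sum_congr rfl fun u _ => by convert key u
  rw [hsum, Finset.sum_add_distrib, Finset.sum_add_distrib, Finset.sum_ite_eq, Finset.sum_ite_eq]
  simp [nbSum]

open Classical in
/-- The effect of a reduction step on the sums over neighbours. -/
theorem HasTwoNeighbors.nbSum_reduce (h : HasTwoNeighbors A x a b) (hv : v ≠ x) :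
    nbSum (reduce A x a b) f v + ((if v = a then f x else 0) + (if v = b then f x else 0)) =
      nbSum A f v + (if s(a, b) ∈ A then 0 else
        (if v = a then f b else 0) + (if v = b then f a else 0)) := by
  have h1 := h.ne
  have h2 := h.ne_left
  have h3 := h.ne_right
  obtain ⟨n1, n2, n3⟩ := h.sym2_ne
  set A₀ : Set (Sym2 V) := {e ∈ A | x ∉ e} with hA₀
  have hA : A = insert s(x, a) (insert s(x, b) A₀) := by
    ext e
    simp only [Set.mem_insert_iff, hA₀, Set.mem_ofPred_eq]
    constructor
    · intro he
      by_cases hx : x ∈ e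
      · rcases h.eq_or_eq he hx with h | h
        · exact .inl h
        · exact .inr (.inl h)
      · exact .inr (.inr ⟨he, hx⟩)
    · rintro (rfl | rfl | he)
      · exact h.mem_left
      · exact h.mem_right
      · exact he.1
  have e1 : nbSum A f v =
      nbSum A₀ f v + ((if v = a then f x else 0) + (if v = b then f x else 0)) := by
    rw [hA, nbSum_insert h2, nbSum_insert h3]
    · simp only [if_neg hv]
      omega
    · simp [hA₀]
    · simp [hA₀, n1]
  have e2 : s(a, b) ∈ A ↔ s(a, b) ∈ A₀ := by
    simp only [hA₀, Set.mem_ofPred_eq]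
    exact ⟨fun h' => ⟨h', h.not_mem⟩, fun h' => h'.1⟩
  by_cases hab : s(a, b) ∈ A
  · have : reduce A x a b = A₀ := Set.insert_eq_of_mem (e2.1 hab)
    rw [this, e1, if_pos hab]
    rfl
  · have : reduce A x a b = insert s(a, b) A₀ := rfl
    rw [this, nbSum_insert h1 (fun h => hab (e2.2 h)), e1, if_neg hab]
    omega

end Neighbours

section PartialReduction

variable {V : Type*}

theorem Reducible.exists_reductionSeq {R A : Set (Sym2 V)} {p q : V} {k : ℕ}
    (h : Reducible R p q k A) : ∃ K, K.length = k ∧ ReductionSeq R p q K A := by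
  induction h with
  | edge => exact ⟨[], rfl, .edge⟩
  | step hp hq h hR _ ih =>
    obtain ⟨K, rfl, hK⟩ := ih
    exact ⟨_, rfl, .step hp hq h hR hK⟩

theorem Reducible.ncard_le [Finite V] {R A : Set (Sym2 V)} {p q : V} {k : ℕ}
    (h : Reducible R p q k A) : A.ncard ≤ 2 * k + 1 := by
  induction h with
  | edge => simp
  | @step k A x a b hp hq h hR _ ih =>
    have h1 : A ⊆ insert s(x, a) (insert s(x, b) (reduce A x a b)) := by
      intro e he
      by_cases hx : x ∈ e
      · rcases h.eq_or_eq he hx with h | h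
        · exact .inl h
        · exact .inr (.inl h)
      · exact .inr (.inr (mem_reduce_iff'.2 (.inr ⟨he, hx⟩)))
    have h2 := Set.ncard_le_ncard h1 (Set.toFinite _)
    have h3 := Set.ncard_insert_le s(x, a) (insert s(x, b) (reduce A x a b))
    have h4 := Set.ncard_insert_le s(x, b) (reduce A x a b)
    omega

variable [Fintype V] [DecidableEq V]

open Classical in
/-- The state after some reduction steps: the steps `l` lead from the edge set `R` to `A`, a set
that `k` more steps reduce to the edge `pq`, and from the weights `S₀` to `S`; the vertices that the
next step can remove are those in the queue `Q`. The number `m` bounds the weights. -/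
structure PartialReduction (R : Set (Sym2 V)) (p q : V) (S₀ : Sym2 V → ℕ) (m k : ℕ)
    (A : Set (Sym2 V)) (S : Sym2 V → ℕ) (l : List (V × V × V)) (Q : List V) : Prop where
  red : Reducible R p q k A
  append : ∀ K, ReductionSeq R p q K A → ReductionSeq R p q (l ++ K) R
  weight : S = upPass S₀ l
  pos_iff : ∀ e, Covers A e → (0 < S e ↔ e ∈ A)
  le : ∀ e, S e ≤ m
  sum_le : ∑ e, (if e ∈ A then S e else 0) ≤ m
  nodup : Q.Nodup
  mem_iff : ∀ v, v ∈ Q ↔ v ≠ p ∧ v ≠ q ∧ nbSum A 1 v = 2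

namespace PartialReduction

variable {R A : Set (Sym2 V)} {p q x a b : V} {S₀ S : Sym2 V → ℕ} {m k : ℕ}
  {l : List (V × V × V)} {Q : List V}

theorem exists_hasTwoNeighbors (h : PartialReduction R p q S₀ m k A S l (x :: Q)) (hpq : p ≠ q) :
    ∃ a b, HasTwoNeighbors A x a b :=
  _root_.exists_hasTwoNeighbors (fun _ => h.red.not_isDiag hpq)
    ((h.mem_iff x).1 List.mem_cons_self).2.2

/-- As long as steps remain, the queue is not empty. -/
theorem ne_nil (h : PartialReduction R p q S₀ m (k + 1) A S l Q) : Q ≠ [] := by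
  obtain _ | ⟨hp, hq, h2, -, -⟩ := h.red
  refine List.ne_nil_of_mem ((h.mem_iff _).2 ⟨hp, hq, ?_⟩)
  rw [h2.nbSum_eq]
  rfl

theorem eq_nil (h : PartialReduction R p q S₀ m 0 A S l Q) : Q = [] := by
  have h0 := h.red
  cases h0
  refine List.eq_nil_iff_forall_not_mem.2 fun v hv => ?_
  obtain ⟨hp, hq, h2⟩ := (h.mem_iff v).1 hv
  rw [nbSum_eq_zero] at h2
  · omega
  · intro y hy
    rcases Sym2.eq_iff.1 (Set.mem_singleton_iff.1 hy) with ⟨h, -⟩ | ⟨h, -⟩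
    · exact hp h
    · exact hq h

theorem reductionSeq (h : PartialReduction R p q S₀ m 0 A S l Q) : ReductionSeq R p q l R := by
  have h0 := h.red
  have h1 := h.append
  cases h0
  simpa using h1 [] .edge

/-- The total weight of the current edges does not grow; this keeps all weights small. -/
theorem weight_add_le (h : PartialReduction R p q S₀ m k A S l Q) (hx : HasTwoNeighbors A x a b) :
    S s(a, b) + lighter S (x, a, b) ≤ m := by
  classical
  obtain ⟨n1, n2, n3⟩ := hx.sym2_ne
  have h1 : lighter S (x, a, b) ≤ S s(x, a) := min_le_left _ _
  by_cases hab : s(a, b) ∈ A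
  · have := Finset.sum_le_sum_of_subset_of_nonneg (f := fun e => if e ∈ A then S e else 0)
      (Finset.subset_univ {s(x, a), s(a, b)}) (fun u _ _ => Nat.zero_le _)
    rw [Finset.sum_pair n2, if_pos hx.mem_left, if_pos hab] at this
    have := h.sum_le
    omega
  · have h2 : S s(a, b) = 0 := by
      have := (h.pos_iff _ hx.covers).not.2 hab
      omega
    have := h.le s(x, a)
    omega

open Classical in
/-- The vertices to be put into the queue for `u` when `x` is removed: `u` itself if it
loses a neighbour without gaining one, and thereby can be removed. -/
noncomputable def newlyReady (A : Set (Sym2 V)) (p q x a b u : V) : List V :=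
  if s(a, b) ∈ A ∧ u ≠ p ∧ u ≠ q ∧ nbSum (reduce A x a b) 1 u = 2 then [u] else []

/-- The vertex at the head of the queue can be removed, and afterwards the queue is right again if
the neighbours of that vertex are put into it where they have become ready. -/
theorem step (h : PartialReduction R p q S₀ m k A S l (x :: Q))
    (hx : HasTwoNeighbors A x a b) :
    PartialReduction R p q S₀ m (k - 1) (reduce A x a b) (upStep S (x, a, b)) (l ++ [(x, a, b)])
      (Q ++ (newlyReady A p q x a b a ++ newlyReady A p q x a b b)) := by
  classical
  have hxQ := (h.mem_iff x).1 List.mem_cons_self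
  obtain ⟨hR, j, rfl, hred⟩ := h.red.confluent hxQ.1 hxQ.2.1 hx
  obtain ⟨n1, n2, n3⟩ := hx.sym2_ne
  have hnot := hx.not_mem
  have hle := h.weight_add_le hx
  have hnd := List.nodup_cons.1 h.nodup
  have hS : ∀ e, e ≠ s(a, b) → upStep S (x, a, b) e = S e :=
    fun e he => Function.update_of_ne he _ _
  have hS' : upStep S (x, a, b) s(a, b) = S s(a, b) + lighter S (x, a, b) :=
    Function.update_self _ _ _
  have hlp : 0 < lighter S (x, a, b) := by
    have e1 := (h.pos_iff _ (covers_of_mem hx.mem_left)).2 hx.mem_left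
    have e2 := (h.pos_iff _ (covers_of_mem hx.mem_right)).2 hx.mem_right
    exact lt_min e1 e2
  have hx0 : nbSum (reduce A x a b) 1 x = 0 := by
    refine nbSum_eq_zero fun y hy => ?_
    exact ((hx.exists_mem_reduce_iff x).1 ⟨y, hy⟩).2 rfl
  have hbig : ∀ u, u ≠ p → u ≠ q → (∃ y, s(u, y) ∈ reduce A x a b) →
      2 ≤ nbSum (reduce A x a b) 1 u := by
    rintro u hup huq ⟨y, hy⟩
    obtain ⟨z, hz, hz'⟩ := hred.exists_mem_ne hup huq hy
    exact add_le_nbSum (f := 1) hz hz' hy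
  have hba : s(b, a) ∈ reduce A x a b := mem_reduce_iff'.2 (.inl Sym2.eq_swap)
  have hga := fun h1 h2 => hbig a h1 h2 ⟨b, mem_reduce_iff'.2 (.inl rfl)⟩
  have hgb := fun h1 h2 => hbig b h1 h2 ⟨a, hba⟩
  have hab := hx.ne
  have hxa := hx.ne_left
  have hxb := hx.ne_right
  have sa := hx.nbSum_reduce (f := 1) hxa.symm
  have sb := hx.nbSum_reduce (f := 1) hxb.symm
  simp only [hab, hab.symm, if_true, if_false, Pi.one_apply, add_zero, zero_add] at sa sb
  have ma := h.mem_iff a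
  have mb := h.mem_iff b
  simp only [List.mem_cons, hxa.symm, hxb.symm, false_or] at ma mb
  refine ⟨hred, ?_, ?_, ?_, ?_, ?_, ?_, ?_⟩
  · intro K hK
    rw [List.append_assoc]
    exact h.append _ (.step hxQ.1 hxQ.2.1 hx hR hK)
  · rw [h.weight, upPass, upPass, List.foldl_append]
    rfl
  · intro e he
    by_cases heq : e = s(a, b)
    · subst heq
      rw [hS']
      exact iff_of_true (by omega) (mem_reduce_iff'.2 (.inl rfl))
    · rw [hS e heq, mem_reduce_iff']
      have := hx.covers_reduce_iff.1 he
      rw [h.pos_iff e this.1]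
      exact ⟨fun h => .inr ⟨h, this.2⟩, fun h => (h.resolve_left heq).1⟩
  · intro e
    by_cases heq : e = s(a, b)
    · rw [heq, hS']
      exact hle
    · rw [hS e heq]
      exact h.le e
  · have key : ∀ e, (if e ∈ reduce A x a b then upStep S (x, a, b) e else 0) +
        (if s(x, a) = e then S s(x, a) else 0) ≤
        (if e ∈ A then S e else 0) + (if s(a, b) = e then S s(x, a) else 0) := by
      intro e
      by_cases heq : e = s(a, b)
      · subst heq
        have h1 : lighter S (x, a, b) ≤ S s(x, a) := min_le_left _ _
        rw [hS', if_pos (mem_reduce_iff'.2 (.inl rfl)), if_neg n2, if_pos rfl]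
        have := h.pos_iff _ hx.covers
        split_ifs with h2
        · omega
        · have := this.not.2 h2
          omega
      · rw [hS e heq, if_neg (Ne.symm heq)]
        by_cases hxe : x ∈ e
        · rw [if_neg fun h => ((mem_reduce_iff'.1 h).resolve_left heq).2 hxe]
          by_cases h2 : s(x, a) = e
          · rw [if_pos h2, ← h2, if_pos hx.mem_left]
            omega
          · rw [if_neg h2]
            omega
        · have h2 : s(x, a) ≠ e := by
            rintro rfl
            exact hxe (Sym2.mem_mk_left _ _)
          rw [if_neg h2]
          by_cases h3 : e ∈ A
          · rw [if_pos h3, if_pos (mem_reduce_iff'.2 (.inr ⟨h3, hxe⟩))]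
          · rw [if_neg h3, if_neg fun h => h3 ((mem_reduce_iff'.1 h).resolve_left heq).1]
    have := Finset.sum_le_sum fun e (_ : e ∈ Finset.univ) => key e
    rw [Finset.sum_add_distrib, Finset.sum_add_distrib, Finset.sum_ite_eq, Finset.sum_ite_eq,
      if_pos (Finset.mem_univ _), if_pos (Finset.mem_univ _)] at this
    have := h.sum_le
    omega
  · have d1 : ∀ u, (newlyReady A p q x a b u).Nodup := by
      intro u
      unfold newlyReady
      split_ifs <;> simp
    refine hnd.2.append ((d1 a).append (d1 b) ?_) ?_
    · intro u h1 h2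
      have e1 : u = a := by unfold newlyReady at h1; split_ifs at h1 <;> simp_all
      have e2 : u = b := by unfold newlyReady at h2; split_ifs at h2 <;> simp_all
      exact hab (e1.symm.trans e2)
    · intro u h1 h2
      rw [List.mem_append] at h2
      unfold newlyReady at h2
      rcases h2 with h2 | h2
      · split_ifs at h2 with h3
        · rw [List.mem_singleton] at h2
          subst h2
          have := (ma.1 h1).2.2
          rw [if_pos h3.1] at sa
          omega
        · simp at h2
      · split_ifs at h2 with h3
        · rw [List.mem_singleton] at h2
          subst h2
          have := (mb.1 h1).2.2
          rw [if_pos h3.1] at sb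
          omega
        · simp at h2
  · intro v
    have m' : ∀ u, v ∈ newlyReady A p q x a b u ↔
        v = u ∧ s(a, b) ∈ A ∧ u ≠ p ∧ u ≠ q ∧ nbSum (reduce A x a b) 1 u = 2 := by
      intro u
      unfold newlyReady
      split_ifs with h1
      · rw [List.mem_singleton]
        exact ⟨fun h => ⟨h, h1⟩, fun h => h.1⟩
      · exact iff_of_false (by simp) fun h => h1 h.2
    rw [List.mem_append, List.mem_append, m', m']
    by_cases hvx : v = x
    · subst hvx
      refine iff_of_false ?_ fun h => by rw [hx0] at h; omega
      rintro (h | h | h)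
      · exact hnd.1 h
      · exact hxa h.1
      · exact hxb h.1
    by_cases hva : v = a
    · subst hva
      rw [ma]
      by_cases hm : s(v, b) ∈ A
      · rw [if_pos hm] at sa
        constructor
        · rintro (h | h | h)
          · have := hga h.1 h.2.1
            omega
          · exact h.2.2
          · exact absurd h.1 hab
        · exact fun h => .inr (.inl ⟨rfl, hm, h⟩)
      · rw [if_neg hm] at sa
        rw [show nbSum (reduce A x v b) 1 v = nbSum A 1 v by omega]
        simp [hm]
    by_cases hvb : v = b
    · subst hvb
      rw [mb]
      by_cases hm : s(a, v) ∈ A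
      · rw [if_pos hm] at sb
        constructor
        · rintro (h | h | h)
          · have := hgb h.1 h.2.1
            omega
          · exact absurd h.1.symm hab
          · exact h.2.2
        · exact fun h => .inr (.inr ⟨rfl, hm, h⟩)
      · rw [if_neg hm] at sb
        rw [show nbSum (reduce A x a v) 1 v = nbSum A 1 v by omega]
        simp [hm]
    have sv := hx.nbSum_reduce (f := 1) hvx
    have mv := h.mem_iff v
    simp only [hva, hvb, if_false, add_zero, ite_self] at sv
    simp only [List.mem_cons, hvx, false_or] at mv
    rw [sv, mv]
    simp [hva, hvb]

end PartialReduction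

end PartialReduction

/-! ### Encoding of edges and the single steps of the program -/

namespace RAM

section Specifications

@[simp] theorem State.reg_setReg (s : State) (x k y : ℕ) :
    (s.setReg x k).reg y = if y = x then k else s.reg y :=
  Function.update_apply _ _ _ _

@[simp] theorem State.arr_setReg (s : State) (x k : ℕ) : (s.setReg x k).arr = s.arr := rfl

@[simp] theorem State.reg_setArr (s : State) (a i k : ℕ) : (s.setArr a i k).reg = s.reg := rfl

@[simp] theorem State.arr_setArr (s : State) (a i k b : ℕ) :
    (s.setArr a i k).arr b = if b = a then Function.update (s.arr a) i k else s.arr b :=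
  Function.update_apply _ _ _ _

instance : Add Ex := ⟨.op .add⟩
instance : Sub Ex := ⟨.op .sub⟩
instance : Mul Ex := ⟨.op .mul⟩
instance : Div Ex := ⟨.op .div⟩

namespace Ex

variable {W : ℕ} {s : State} {e f : Ex}

@[simp] theorem val_lit (k : ℕ) : (lit k).val s = k := rfl
@[simp] theorem val_reg (x : ℕ) : (reg x).val s = s.reg x := rfl
@[simp] theorem val_get (a : ℕ) : (get a e).val s = s.arr a (e.val s) := rfl
@[simp] theorem val_add : (e + f).val s = e.val s + f.val s := rfl
@[simp] theorem val_sub : (e - f).val s = e.val s - f.val s := rfl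
@[simp] theorem val_mul : (e * f).val s = e.val s * f.val s := rfl
@[simp] theorem val_div : (e / f).val s = e.val s / f.val s := rfl
@[simp] theorem fits_lit (k : ℕ) : (lit k).Fits W s ↔ k < W := Iff.rfl
@[simp] theorem fits_reg (x : ℕ) : (reg x).Fits W s ↔ True := Iff.rfl
@[simp] theorem fits_get (a : ℕ) : (get a e).Fits W s ↔ e.Fits W s := Iff.rfl
@[simp] theorem fits_add : (e + f).Fits W s ↔ e.Fits W s ∧ f.Fits W s ∧ e.val s + f.val s < W :=
  Iff.rfl
@[simp] theorem fits_sub : (e - f).Fits W s ↔ e.Fits W s ∧ f.Fits W s ∧ e.val s - f.val s < W :=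
  Iff.rfl
@[simp] theorem fits_mul : (e * f).Fits W s ↔ e.Fits W s ∧ f.Fits W s ∧ e.val s * f.val s < W :=
  Iff.rfl
@[simp] theorem fits_div : (e / f).Fits W s ↔ e.Fits W s ∧ f.Fits W s ∧ e.val s / f.val s < W :=
  Iff.rfl

end Ex

/-- The words are wide enough for all numbers that the program handles. -/
structure Wide (n W : ℕ) : Prop where
  three_le : 3 ≤ n
  le : 200 * (n * n * n) ≤ W

namespace Wide

variable {n W x : ℕ}

theorem lt_of_le_cube (h : Wide n W) (hx : x ≤ 50 * (n * n * n)) : x < W := by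
  have h1 := h.three_le
  have h2 := h.le
  have h3 : 3 * 3 * 3 ≤ n * n * n := Nat.mul_le_mul (Nat.mul_le_mul h1 h1) h1
  omega

theorem lt_of_le_sq (h : Wide n W) (hx : x ≤ 50 * (n * n)) : x < W := by
  refine h.lt_of_le_cube (hx.trans ?_)
  have h1 := h.three_le
  have : n * n * 1 ≤ n * n * n := Nat.mul_le_mul_left _ (by omega)
  omega

theorem lt_of_le (h : Wide n W) (hx : x ≤ 50 * n) : x < W := by
  refine h.lt_of_le_sq (hx.trans ?_)
  have h1 := h.three_le
  have : n * 1 ≤ n * n := Nat.mul_le_mul_left _ (by omega)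
  omega

end Wide

/-- The index of the word that an array keeps for a pair of vertices. The sum and the product of two
numbers determine the numbers up to their order. -/
def key {n : ℕ} : Sym2 (Fin n) → ℕ :=
  Sym2.lift ⟨fun u v => (u + v) * (n * n) + u * v, fun u v => by
    simp only [add_comm (u : ℕ), mul_comm (u : ℕ)]⟩

theorem key_mk {n : ℕ} (u v : Fin n) : key s(u, v) = (u + v) * (n * n) + u * v := rfl

theorem key_le {n : ℕ} (u v : Fin n) : key s(u, v) ≤ 3 * (n * n * n) := by
  have h0 := u.2
  have h1 : ((u : ℕ) + v) * (n * n) ≤ (n + n) * (n * n) :=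
    Nat.mul_le_mul (Nat.add_le_add u.2.le v.2.le) le_rfl
  have h2 : (u : ℕ) * v ≤ n * n := Nat.mul_le_mul u.2.le v.2.le
  have h3 : n * n * 1 ≤ n * n * n := Nat.mul_le_mul_left _ (by omega)
  rw [key_mk]
  have : (n + n) * (n * n) = 2 * (n * n * n) := by ring
  omega

theorem key_injective {n : ℕ} : Function.Injective (key (n := n)) := by
  intro e f
  induction e with
  | _ u v =>
  induction f with
  | _ x y =>
  intro h
  rw [key_mk, key_mk] at h
  have h1 : (u : ℕ) * v < n * n := Nat.mul_lt_mul'' u.2 v.2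
  have h2 : (x : ℕ) * y < n * n := Nat.mul_lt_mul'' x.2 y.2
  have hs : (u : ℕ) + v = x + y := by
    have := congrArg (· / (n * n)) h
    rwa [Nat.add_comm, Nat.add_mul_div_right _ _ (by omega), Nat.div_eq_of_lt h1,
      Nat.add_comm (_ * _) (_ * _), Nat.add_mul_div_right _ _ (by omega), Nat.div_eq_of_lt h2,
      Nat.zero_add, Nat.zero_add] at this
  have hp : (u : ℕ) * v = x * y := by
    rw [hs] at h
    omega
  have : ((u : ℤ) - x) * (u - y) = 0 := by
    zify at hs hp
    linear_combination (u : ℤ) * hs - hp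
  rw [Sym2.eq_iff]
  rcases mul_eq_zero.1 this with h | h
  · exact .inl ⟨Fin.ext (by omega), Fin.ext (by omega)⟩
  · exact .inr ⟨Fin.ext (by omega), Fin.ext (by omega)⟩

/-- The array contents `f` represent the function `F` on pairs of vertices. -/
def Rep {n : ℕ} (f : ℕ → ℕ) (F : Sym2 (Fin n) → ℕ) : Prop :=
  ∀ e, f (key e) = F e

theorem Rep.update {n : ℕ} {f : ℕ → ℕ} {F : Sym2 (Fin n) → ℕ} (h : Rep f F) (e : Sym2 (Fin n))
    (k : ℕ) : Rep (Function.update f (key e) k) (Function.update F e k) := by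
  intro e'
  by_cases he : e' = e
  · rw [he, Function.update_self, Function.update_self]
  · rw [Function.update_of_ne he, Function.update_of_ne fun h => he (key_injective h), h]

/-- The array contents `f` begin with the list `l`. -/
def Holds {n : ℕ} (f : ℕ → ℕ) (l : List (Fin n)) : Prop :=
  ∀ (j : ℕ) (v : Fin n), l[j]? = some v → f j = v

theorem Holds.append {n : ℕ} {f : ℕ → ℕ} {l : List (Fin n)} (h : Holds f l) {i k : ℕ}
    {v : Fin n} (hi : i = l.length) (hk : k = v) : Holds (Function.update f i k) (l ++ [v]) := by
  intro j w hj
  rcases lt_trichotomy j l.length with hlt | heq | hgt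
  · rw [Function.update_of_ne (by omega)]
    rw [List.getElem?_append_left hlt] at hj
    exact h j w hj
  · subst heq
    simp only [List.getElem?_concat_length, Option.some.injEq] at hj
    rw [hi, Function.update_self, hk, hj]
  · rw [List.getElem?_eq_none (by simp; omega)] at hj
    cases hj

open Ex Cmd

/-- The expression for the index of the pair of the vertices in the registers `x` and `y`. Register
`0` holds the number of vertices. -/
def keyE (x y : ℕ) : Ex :=
  (reg x + reg y) * (reg 0 * reg 0) + reg x * reg y

variable {n W : ℕ} {s : State} {Q : State → Prop}

theorem val_keyE {x y : ℕ} (h0 : s.reg 0 = n) {u v : Fin n} (hu : s.reg x = u)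
    (hv : s.reg y = v) : (keyE x y).val s = key s(u, v) := by
  simp [keyE, h0, hu, hv, key_mk]

theorem fits_keyE (hW : Wide n W) {x y : ℕ} (h0 : s.reg 0 = n) {u v : Fin n} (hu : s.reg x = u)
    (hv : s.reg y = v) : (keyE x y).Fits W s := by
  have h := key_le u v
  rw [key_mk] at h
  have hn := hW.three_le
  have h1 : ((u : ℕ) + v) * (n * n) < W := hW.lt_of_le_cube (by omega)
  have h2 : (u : ℕ) * v < W := hW.lt_of_le_cube (by omega)
  have h3 : (u : ℕ) + v < W := hW.lt_of_le (by omega)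
  have h4 : n * n < W := hW.lt_of_le_sq (by omega)
  have h5 : ((u : ℕ) + v) * (n * n) + u * v < W := hW.lt_of_le_cube (by omega)
  simp only [keyE, fits_add, fits_mul, fits_reg, val_add, val_mul, val_reg, h0, hu, hv, true_and]
  exact ⟨⟨h3, h4, h1⟩, h2, h5⟩

/-- For the triple of vertices in the registers `4`, `5`, `6`: the indices of the three pairs, and
the least of the weights of the first vertex with the others. Array `7` holds the weights. -/
def loadKeys : Cmd :=
  .seq (set 7 (keyE 5 6)) <| .seq (set 8 (keyE 4 5)) <| .seq (set 9 (keyE 4 6)) <|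
    ite .le (get 7 (reg 8)) (get 7 (reg 9)) (set 10 (get 7 (reg 8))) (set 10 (get 7 (reg 9)))

theorem wp_loadKeys (hW : Wide n W) (h0 : s.reg 0 = n) {x a b : Fin n} (hx : s.reg 4 = x)
    (ha : s.reg 5 = a) (hb : s.reg 6 = b) {S : Sym2 (Fin n) → ℕ} (hS : Rep (s.arr 7) S)
    (hQ : ∀ s' : State, s'.arr = s.arr →
      (∀ r, r ≠ 7 → r ≠ 8 → r ≠ 9 → r ≠ 10 → s'.reg r = s.reg r) → s'.reg 7 = key s(a, b) →
      s'.reg 8 = key s(x, a) → s'.reg 9 = key s(x, b) → s'.reg 10 = lighter S (x, a, b) → Q s') :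
    loadKeys.wp W Q s := by
  refine ⟨fits_keyE hW h0 ha hb, ?_⟩
  rintro k₁ rfl
  rw [val_keyE h0 ha hb]
  refine ⟨fits_keyE hW (u := x) (v := a) (by simpa) (by simpa) (by simpa), ?_⟩
  rintro k₂ rfl
  rw [val_keyE (u := x) (v := a) (by simpa) (by simpa) (by simpa)]
  refine ⟨fits_keyE hW (u := x) (v := b) (by simpa) (by simpa) (by simpa), ?_⟩
  rintro k₃ rfl
  rw [val_keyE (u := x) (v := b) (by simpa) (by simpa) (by simpa)]
  refine ⟨trivial, trivial, fun h => ⟨trivial, ?_⟩, fun h => ⟨trivial, ?_⟩⟩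
  all_goals
    rintro v rfl
    simp only [Cmp.holds, val_get, val_reg, State.arr_setReg, State.reg_setReg,
      Nat.reduceEqDiff, if_true, if_false, hS _] at h
    refine hQ _ rfl (fun r h1 h2 h3 h4 => by simp [h1, h2, h3, h4]) (by simp) (by simp)
      (by simp) ?_
    simp [lighter, hS _, h]
  exact (not_le.1 h).le

/-- The two neighbours of the vertex at the index in register `2` of array `9`, from their sum and
the sum of their squares. Array `6` gives square roots. -/
def findNeighbors : Cmd :=
  .seq (set 4 (get 9 (reg 2))) <| .seq (set 13 (get 4 (reg 4))) <|
  .seq (set 14 (get 6 (lit 2 * get 5 (reg 4) - reg 13 * reg 13))) <|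
  .seq (set 5 ((reg 13 + reg 14) / lit 2)) (set 6 ((reg 13 - reg 14) / lit 2))

theorem wp_findNeighbors (hW : Wide n W) {x a b : Fin n} (hx : s.arr 9 (s.reg 2) = x)
    (hab : b < a) (h4 : s.arr 4 x = a + b) (h5 : s.arr 5 x = a * a + b * b)
    (h6 : ∀ j < n, s.arr 6 (j * j) = j)
    (hQ : ∀ s' : State, s'.arr = s.arr →
      (∀ r, r ≠ 4 → r ≠ 5 → r ≠ 6 → r ≠ 13 → r ≠ 14 → s'.reg r = s.reg r) → s'.reg 4 = x →
      s'.reg 5 = a → s'.reg 6 = b → Q s') :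
    findNeighbors.wp W Q s := by
  obtain ⟨d, hd⟩ : ∃ d, (a : ℕ) = b + d := ⟨a - b, by have : (b : ℕ) < a := hab; omega⟩
  have hn := hW.three_le
  have e1 : (a : ℕ) + b ≤ 2 * n := by omega
  have e2 : ((a : ℕ) + b) * (a + b) ≤ (2 * n) * (2 * n) := Nat.mul_le_mul e1 e1
  have e3 : (2 * n) * (2 * n) = 4 * (n * n) := by ring
  have e4 : (a : ℕ) * a ≤ n * n := Nat.mul_le_mul a.2.le a.2.le
  have e5 : (b : ℕ) * b ≤ n * n := Nat.mul_le_mul b.2.le b.2.le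
  have e6 : 2 * ((a : ℕ) * a + b * b) - (a + b) * (a + b) = d * d := by
    rw [hd]
    have : 2 * (((b : ℕ) + d) * (b + d) + b * b) = d * d + (b + d + b) * (b + d + b) := by ring
    omega
  have e7 : s.arr 6 (d * d) = d := h6 d (by omega)
  have e8 : d * d ≤ n * n := Nat.mul_le_mul (by omega) (by omega)
  have f0 : 2 < W := hW.lt_of_le (by omega)
  have f1 : (a : ℕ) + b + d < W := hW.lt_of_le (by omega)
  have f2 : 2 * ((a : ℕ) * a + b * b) < W := hW.lt_of_le_sq (by omega)
  have f3 : ((a : ℕ) + b) * (a + b) < W := hW.lt_of_le_sq (by omega)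
  have f4 : d * d < W := hW.lt_of_le_sq (by omega)
  have v1 : ((a : ℕ) + b + d) / 2 = a := by omega
  have v2 : ((a : ℕ) + b - d) / 2 = b := by omega
  have f5 : (a : ℕ) < W := by omega
  have f6 : (b : ℕ) < W := by omega
  have f7 : (a : ℕ) + b - d < W := by omega
  simp only [findNeighbors, Cmd.wp, forall_eq, fits_get, fits_reg, fits_lit, fits_add, fits_sub,
    fits_mul, fits_div, val_get, val_reg, val_lit, val_add, val_sub, val_mul, val_div,
    State.arr_setReg, State.reg_setReg, Nat.reduceEqDiff, if_true, if_false, hx, h4, h5, e6, e7,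
    v1, v2, true_and]
  refine ⟨⟨⟨f0, f2⟩, f3, f4⟩, ⟨f1, f0, f5⟩, ⟨f7, f0, f6⟩, ?_⟩
  refine hQ _ rfl (fun r h1 h2 h3 h4 h5 => by simp [h1, h2, h3, h4, h5]) ?_ ?_ ?_ <;> simp

/-- Put the vertex in register `u` into the queue: array `9`, with its end in register `3`. -/
def push (u : ℕ) : Cmd :=
  .seq (put 9 (reg 3) (reg u)) (set 3 (reg 3 + lit 1))

/-- Add the vertex in register `w` to the sums for the vertex in register `u`. -/
def addNeighbor (u w : ℕ) : Cmd :=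
  .seq (put 4 (reg u) (get 4 (reg u) + reg w))
    (put 5 (reg u) (get 5 (reg u) + reg w * reg w))

/-- The changes at the vertex in register `u` when the vertex in register `4` is removed and the one
in register `w` becomes a neighbour, if it is not yet one, that is, if register `11` is `0`. -/
def relink (u w : ℕ) : Cmd :=
  .seq (put 4 (reg u) (get 4 (reg u) - reg 4)) <|
  .seq (put 5 (reg u) (get 5 (reg u) - reg 4 * reg 4)) <|
  ite .eq (reg 11) (lit 0) (addNeighbor u w) <|
    .seq (put 3 (reg u) (get 3 (reg u) - lit 1)) <|
      ite .eq (get 3 (reg u)) (lit 2) (push u) (set 13 (lit 0))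

theorem wp_relink (hW : Wide n W) {ru rw x u w : ℕ} (hru : ru ≠ 3 ∧ ru ≠ 13)
    (h4 : s.reg 4 = x) (hu : s.reg ru = u) (hw : s.reg rw = w) (hx : x < n) (hwn : w < n)
    (b3 : s.arr 3 u ≤ 10 * n) (b4 : s.arr 4 u ≤ n * n) (b5 : s.arr 5 u ≤ n * n * n)
    (bt : s.reg 3 ≤ 10 * n)
    (hQ : ∀ s' : State, (∀ r, r ≠ 3 → r ≠ 13 → s'.reg r = s.reg r) →
      (∀ k, k ≠ 3 → k ≠ 4 → k ≠ 5 → k ≠ 9 → s'.arr k = s.arr k) →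
      s'.arr 3 = Function.update (s.arr 3) u (s.arr 3 u - if s.reg 11 = 0 then 0 else 1) →
      s'.arr 4 = Function.update (s.arr 4) u (s.arr 4 u - x + if s.reg 11 = 0 then w else 0) →
      s'.arr 5 = Function.update (s.arr 5) u
        (s.arr 5 u - x * x + if s.reg 11 = 0 then w * w else 0) →
      (s.reg 11 ≠ 0 ∧ s.arr 3 u - 1 = 2 → s'.reg 3 = s.reg 3 + 1 ∧
        s'.arr 9 = Function.update (s.arr 9) (s.reg 3) u) →
      (¬ (s.reg 11 ≠ 0 ∧ s.arr 3 u - 1 = 2) → s'.reg 3 = s.reg 3 ∧ s'.arr 9 = s.arr 9) → Q s') :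
    (relink ru rw).wp W Q s := by
  obtain ⟨hru3, hru13⟩ := hru
  have hn := hW.three_le
  have e1 : x * x ≤ n * n := Nat.mul_le_mul hx.le hx.le
  have e2 : w * w ≤ n * n := Nat.mul_le_mul hwn.le hwn.le
  have e3 : n * n * 3 ≤ n * n * n := Nat.mul_le_mul_left _ hn
  have e4 : n * 3 ≤ n * n := Nat.mul_le_mul_left _ hn
  have f1 : s.arr 4 u - x < W := hW.lt_of_le_cube (by omega)
  have f2 : x * x < W := hW.lt_of_le_cube (by omega)
  have f3 : s.arr 5 u - x * x < W := hW.lt_of_le_cube (by omega)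
  have f4 : w * w < W := hW.lt_of_le_cube (by omega)
  have f5 : s.arr 4 u - x + w < W := hW.lt_of_le_cube (by omega)
  have f6 : s.arr 5 u - x * x + w * w < W := hW.lt_of_le_cube (by omega)
  have f7 : s.arr 3 u - 1 < W := hW.lt_of_le (by omega)
  have f8 : s.reg 3 + 1 < W := hW.lt_of_le (by omega)
  have f9 : 2 < W := hW.lt_of_le (by omega)
  have f10 : 1 < W := by omega
  have f11 : 0 < W := by omega
  simp only [relink, addNeighbor, push, Cmd.wp, forall_eq_apply_imp_iff, forall_eq, fits_get,
    fits_reg, fits_lit, fits_add, fits_sub, fits_mul, val_get, val_reg, val_lit, val_add, val_sub,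
    val_mul, State.arr_setArr, State.reg_setArr,
    Nat.reduceEqDiff, if_true, if_false, h4, hu, hw, true_and, Function.update_self,
    Cmp.holds]
  refine ⟨f1, ⟨f2, f3⟩, f11, fun h11 => ⟨f5, ⟨f4, f6⟩, ?_⟩, fun h11 => ⟨⟨f10, f7⟩, f9,
    fun h3 => ⟨⟨f10, f8⟩, ?_⟩, fun h3 => ⟨f11, ?_⟩⟩⟩
  · refine hQ _ (fun r _ _ => rfl) (fun k h1 h2 h3 h4 => by simp [h2, h3]) ?_ ?_ ?_ ?_ ?_ <;>
      simp [h11]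
  · refine hQ _ (fun r h1 _ => by simp [h1]) (fun k h1 h2 h3 h4 => by simp [h1, h2, h3, h4])
      ?_ ?_ ?_ ?_ ?_ <;> simp [h11, h3]
  · refine hQ _ (fun r _ h1 => by simp [h1]) (fun k h1 h2 h3 h4 => by simp [h1, h2, h3])
      ?_ ?_ ?_ ?_ ?_ <;> simp [h11, h3]

end Specifications

end RAM

/-! ### Setting up the memory -/

namespace RAM

section Phases

open Ex Cmd

variable {n W : ℕ} {s : State}

theorem runs_loop_of_wp {r : Cmp} {e f : Ex} {c : Cmd} (he : e.low = true) (hf : f.low = true)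
    (hc : c.low = true) (hn : 1 ≤ n) (I : ℕ → State → Prop) (N : ℕ) (hN : N ≤ 2 * n)
    (hfits : ∀ i s, I i s → e.Fits W s ∧ f.Fits W s)
    (hstep : ∀ i < N, ∀ s, I i s → r.holds (e.val s) (f.val s) ∧ c.wp W (I (i + 1)) s)
    (hend : ∀ s, I N s → ¬ r.holds (e.val s) (f.val s)) (h0 : I 0 s) :
    Runs W (.loop r e f c) s ((Cmd.loop r e f c).time * n) (I N) := by
  refine (runs_loop he hf I N hfits (T := c.time) (fun i hi s hs => ⟨(hstep i hi s hs).1,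
    runs_of_wp hc (hstep i hi s hs).2⟩) hend h0).mono ?_ fun s h => h
  rw [Cmd.time, add_mul]
  refine add_le_add ?_ (Nat.le_mul_of_pos_right _ hn)
  rw [mul_right_comm]
  exact Nat.mul_le_mul_right _ hN

/-- A command without loops takes constant time. -/
theorem runs_of_wp_mul {c : Cmd} {Q : State → Prop} (hc : c.low = true) (hn : 1 ≤ n)
    (h : c.wp W Q s) : Runs W c s (c.time * n) Q :=
  (runs_of_wp hc h).mono (Nat.le_mul_of_pos_right _ hn) fun _ h => h

theorem Runs.seq_mul {c d : Cmd} {Q : State → Prop}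
    (h : Runs W c s (c.time * n) fun s => Runs W d s (d.time * n) Q) :
    Runs W (.seq c d) s ((Cmd.seq c d).time * n) Q :=
  h.seq.mono (by rw [Cmd.time, add_mul]) fun _ h => h

/-- The part of the memory that is not changed after it is set up: the numbers of vertices and of
edges, the list of edges, and the table of square roots. -/
structure Setup (L : List (Fin n × Fin n)) (s : State) : Prop where
  reg_zero : s.reg 0 = n
  reg_one : s.reg 1 = L.length
  fst : ∀ i (h : i < L.length), s.arr 0 i = L[i].1
  snd : ∀ i (h : i < L.length), s.arr 1 i = L[i].2
  sqrt : ∀ j < n, s.arr 6 (j * j) = j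

variable {L : List (Fin n × Fin n)}

theorem Setup.congr {s' : State} (h : Setup L s) (h0 : s'.reg 0 = s.reg 0)
    (h1 : s'.reg 1 = s.reg 1) (a0 : s'.arr 0 = s.arr 0) (a1 : s'.arr 1 = s.arr 1)
    (a6 : s'.arr 6 = s.arr 6) : Setup L s' :=
  ⟨h0.trans h.1, h1.trans h.2, by rw [a0]; exact h.3, by rw [a1]; exact h.4,
    by rw [a6]; exact h.5⟩

/-- Fill the table of square roots, array `6`. -/
def squareRoots : Cmd :=
  .seq (set 2 (lit 0)) <| loop .lt (reg 2) (reg 0) <|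
    .seq (put 6 (reg 2 * reg 2) (reg 2)) (set 2 (reg 2 + lit 1))

theorem runs_squareRoots (hW : Wide n W) :
    Runs W squareRoots (inputState L) (squareRoots.time * n) fun s => Setup L s ∧ s.reg 3 = 0 ∧
      ∀ k, k ≠ 0 → k ≠ 1 → k ≠ 6 → s.arr k = fun _ => 0 := by
  have hn := hW.three_le
  refine Runs.seq_mul (runs_of_wp_mul rfl (by omega) ⟨hW.lt_of_le (Nat.zero_le _), ?_⟩)
  rintro v rfl
  let I : ℕ → State → Prop := fun i s => s.reg 0 = n ∧ s.reg 1 = L.length ∧ s.reg 2 = i ∧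
    s.reg 3 = 0 ∧ s.arr 0 = (inputState L).arr 0 ∧ s.arr 1 = (inputState L).arr 1 ∧
    (∀ j < i, s.arr 6 (j * j) = j) ∧ ∀ k, k ≠ 0 → k ≠ 1 → k ≠ 6 → s.arr k = fun _ => 0
  refine (runs_loop_of_wp rfl rfl rfl (by omega) I n (by omega)
    (fun _ _ _ => by exact ⟨trivial, trivial⟩)
    ?_ ?_ ?_).mono le_rfl ?_
  · rintro i hi s ⟨h0, h1, h2, h3, a0, a1, a6, ak⟩
    refine ⟨by simpa [Cmp.holds, h0, h2], ?_⟩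
    have e1 : i * i ≤ n * n := Nat.mul_le_mul hi.le hi.le
    have f1 : i * i < W := hW.lt_of_le_sq (by omega)
    have f2 : i + 1 < W := hW.lt_of_le (by omega)
    have f3 : 1 < W := by omega
    simp only [Cmd.wp, forall_eq_apply_imp_iff, forall_eq, fits_mul, fits_add, fits_reg, fits_lit,
      val_mul, val_add, val_reg, val_lit, h2, true_and, State.reg_setArr]
    refine ⟨f1, ⟨f3, f2⟩, ?_⟩
    refine ⟨by simpa, by simpa, by simp, by simpa, by simpa, by simpa, ?_,
      fun k k0 k1 k6 => by simp [k6, ak k k0 k1]⟩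
    intro j hj
    by_cases hji : j = i
    · simp [hji]
    · have : j * j ≠ i * i := by
        rw [ne_eq, Nat.mul_self_inj]
        exact hji
      simp [this, a6 j (by omega)]
  · rintro s ⟨h0, -, h2, -⟩
    simp [Cmp.holds, h0, h2]
  · refine ⟨rfl, rfl, rfl, rfl, rfl, rfl, fun j hj => absurd hj (Nat.not_lt_zero _), ?_⟩
    intro k k0 k1 _
    funext i
    simp [inputState, k0, k1]
  · rintro s ⟨h0, h1, -, h3, a0, a1, a6, ak⟩
    refine ⟨⟨h0, h1, ?_, ?_, a6⟩, h3, ak⟩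
    · intro i hi
      simp [a0, inputState, hi]
    · intro i hi
      simp [a1, inputState, hi]

/-- The edge set `A` is stored: the degrees in array `3`, the sums of the neighbours in array `4`,
the sums of their squares in array `5`, and the weights, all equal to one, in array `7`. -/
structure Stored (A : Set (Sym2 (Fin n))) (s : State) : Prop where
  deg : ∀ v : Fin n, s.arr 3 v = nbSum A 1 v
  sum : ∀ v : Fin n, s.arr 4 v = nbSum A (fun u => (u : ℕ)) v
  sq : ∀ v : Fin n, s.arr 5 v = nbSum A (fun u => (u : ℕ) * u) v
  rep : Rep (s.arr 7) (A.indicator 1)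

/-- Store the edge at the index in register `2`. -/
def storeEdge : Cmd :=
  .seq (set 5 (get 0 (reg 2))) <| .seq (set 6 (get 1 (reg 2))) <|
  .seq (put 3 (reg 5) (get 3 (reg 5) + lit 1)) <| .seq (put 3 (reg 6) (get 3 (reg 6) + lit 1)) <|
  .seq (addNeighbor 5 6) <| .seq (addNeighbor 6 5) <|
  .seq (put 7 (keyE 5 6) (lit 1)) <| set 2 (reg 2 + lit 1)

theorem nbSum_bounds (A : Set (Sym2 (Fin n))) (v : Fin n) : nbSum A 1 v ≤ n ∧
    nbSum A (fun u => (u : ℕ)) v ≤ n * n ∧ nbSum A (fun u => (u : ℕ) * u) v ≤ n * n * n := by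
  have h1 := nbSum_le (A := A) (f := 1) (v := v) (c := 1) fun _ => le_rfl
  have h2 := nbSum_le (A := A) (f := fun u : Fin n => (u : ℕ)) (v := v) fun u => u.2.le
  have h3 := nbSum_le (A := A) (f := fun u : Fin n => (u : ℕ) * u) (v := v)
    fun u => Nat.mul_le_mul u.2.le u.2.le
  rw [Fintype.card_fin] at h1 h2 h3
  exact ⟨by omega, h2, by rwa [mul_assoc]⟩

theorem wp_storeEdge (hW : Wide n W) {Q : State → Prop} {A : Set (Sym2 (Fin n))} {a b : Fin n}
    (h0 : s.reg 0 = n) (ha : s.arr 0 (s.reg 2) = a) (hb : s.arr 1 (s.reg 2) = b)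
    (h2 : s.reg 2 ≤ 10 * n) (hab : a ≠ b) (hA : s(a, b) ∉ A) (h : Stored A s)
    (hQ : ∀ s' : State, (∀ k, k ≠ 3 → k ≠ 4 → k ≠ 5 → k ≠ 7 → s'.arr k = s.arr k) →
      (∀ r, r ≠ 2 → r ≠ 5 → r ≠ 6 → s'.reg r = s.reg r) → s'.reg 2 = s.reg 2 + 1 →
      Stored (insert s(a, b) A) s' → Q s') :
    storeEdge.wp W Q s := by
  have hn := hW.three_le
  have hba : (b : ℕ) ≠ a := fun h => hab (Fin.ext h.symm)
  obtain ⟨ba1, ba2, ba3⟩ := nbSum_bounds A a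
  obtain ⟨bb1, bb2, bb3⟩ := nbSum_bounds A b
  rw [← h.deg, ← h.sum, ← h.sq] at *
  have e3 : n * n * 3 ≤ n * n * n := Nat.mul_le_mul_left _ hn
  have e4 : n * 3 ≤ n * n := Nat.mul_le_mul_left _ hn
  have e5 : (a : ℕ) * a ≤ n * n := Nat.mul_le_mul a.2.le a.2.le
  have e6 : (b : ℕ) * b ≤ n * n := Nat.mul_le_mul b.2.le b.2.le
  have f1 : 1 < W := hW.lt_of_le (by omega)
  have f2 : s.arr 3 a + 1 < W := hW.lt_of_le (by omega)
  have f3 : s.arr 3 b + 1 < W := hW.lt_of_le (by omega)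
  have f4 : s.arr 4 a + b < W := hW.lt_of_le_sq (by omega)
  have f5 : s.arr 4 b + a < W := hW.lt_of_le_sq (by omega)
  have f6 : s.arr 5 a + b * b < W := hW.lt_of_le_cube (by omega)
  have f7 : s.arr 5 b + a * a < W := hW.lt_of_le_cube (by omega)
  have f8 : (a : ℕ) * a < W := hW.lt_of_le_sq (by omega)
  have f9 : (b : ℕ) * b < W := hW.lt_of_le_sq (by omega)
  have f10 : s.reg 2 + 1 < W := hW.lt_of_le (by omega)
  have upd : ∀ (F G : Fin n → ℕ) (g : ℕ → ℕ) (v : Fin n), (∀ v : Fin n, g v = nbSum A F v) →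
      Function.update (Function.update g a (g a + F b)) b (g b + F a) v =
        nbSum (insert s(a, b) A) F v := by
    intro F G g v hg
    rw [nbSum_insert hab hA, ← hg]
    by_cases hva : v = a
    · subst hva
      rw [Function.update_of_ne hba.symm, Function.update_self]
      simp [hab]
    · have hva' : (v : ℕ) ≠ a := fun h => hva (Fin.ext h)
      by_cases hvb : v = b
      · subst hvb
        rw [Function.update_self]
        simp [hva]
      · have hvb' : (v : ℕ) ≠ b := fun h => hvb (Fin.ext h)
        rw [Function.update_of_ne hvb', Function.update_of_ne hva']
        simp [hva, hvb]
  have hk : ∀ s' : State, s'.reg 0 = n → s'.reg 5 = a → s'.reg 6 = b →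
      (keyE 5 6).Fits W s' ∧ (keyE 5 6).val s' = key s(a, b) :=
    fun s' k0 k5 k6 => ⟨fits_keyE hW k0 k5 k6, val_keyE k0 k5 k6⟩
  simp only [storeEdge, addNeighbor, Cmd.wp, forall_eq_apply_imp_iff, forall_eq, fits_get,
    fits_reg, fits_lit, fits_add, fits_mul, val_get, val_reg, val_lit, val_add,
    val_mul, State.arr_setReg, State.reg_setReg, State.arr_setArr, State.reg_setArr,
    Nat.reduceEqDiff, if_true, if_false, ha, hb, true_and,
    Function.update_of_ne hba, f1, f2, f3, f4, f5, f6, f7, f8, f9, f10, and_true]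
  refine ⟨(hk _ (by simpa) (by simp) (by simp)).1, ?_⟩
  rw [(hk _ (by simpa) (by simp) (by simp)).2]
  refine hQ _ (fun k k3 k4 k5 k7 => by simp [k3, k4, k5, k7])
    (fun r r2 r5 r6 => by simp [r2, r5, r6]) (by simp) ⟨?_, ?_, ?_, ?_⟩
  · intro v
    simpa using upd 1 1 _ v h.deg
  · intro v
    simpa using upd (fun u => (u : ℕ)) 1 _ v h.sum
  · intro v
    simpa using upd (fun u => (u : ℕ) * u) 1 _ v h.sq
  · have := h.rep.update s(a, b) 1
    simp only [State.arr_setReg, State.arr_setArr, Nat.reduceEqDiff, if_true, if_false]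
    intro e
    rw [this]
    by_cases he : e = s(a, b)
    · rw [he, Function.update_self, Set.indicator_of_mem (Set.mem_insert _ _)]
      rfl
    · rw [Function.update_of_ne he]
      have : e ∈ insert s(a, b) A ↔ e ∈ A := by
        rw [Set.mem_insert_iff]
        exact or_iff_right he
      classical
      rw [Set.indicator_apply, Set.indicator_apply, if_congr this rfl rfl]

/-- Store all the edges of the list. -/
def storeEdges : Cmd :=
  .seq (set 2 (lit 0)) <| loop .lt (reg 2) (reg 1) storeEdge

theorem runs_storeEdges {A : Set (Sym2 (Fin n))} (hW : Wide n W) (hL : L.length ≤ 2 * n)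
    (hne : ∀ i (h : i < L.length), L[i].1 ≠ L[i].2) (hnd : (L.map fun p => s(p.1, p.2)).Nodup)
    (hA : ∀ e, e ∈ (L.map fun p => s(p.1, p.2)) ↔ e ∈ A) (hs : Setup L s)
    (hs0 : Stored (∅ : Set (Sym2 (Fin n))) s) : Runs W storeEdges s (storeEdges.time * n) fun s' =>
      Setup L s' ∧ Stored A s' ∧ s'.reg 3 = s.reg 3 ∧
      s'.arr 12 = s.arr 12 ∧ s'.arr 13 = s.arr 13 := by
  have hn := hW.three_le
  refine Runs.seq_mul (runs_of_wp_mul rfl (by omega) ⟨hW.lt_of_le (Nat.zero_le _), ?_⟩)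
  rintro v rfl
  let B : ℕ → Set (Sym2 (Fin n)) := fun i => {e | e ∈ (L.take i).map fun p => s(p.1, p.2)}
  let I : ℕ → State → Prop := fun i s' => Setup L s' ∧ s'.reg 2 = i ∧ Stored (B i) s' ∧
    s'.reg 3 = s.reg 3 ∧ s'.arr 12 = s.arr 12 ∧ s'.arr 13 = s.arr 13
  refine (runs_loop_of_wp rfl rfl rfl (by omega) I L.length hL
    (fun _ _ _ => by exact ⟨trivial, trivial⟩)
    ?_ ?_ ?_).mono le_rfl ?_
  · rintro i hi s ⟨h, h2, hB, h3, h12, h13⟩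
    refine ⟨by simpa [Cmp.holds, h.reg_one, h2], ?_⟩
    have hB' : B (i + 1) = insert s(L[i].1, L[i].2) (B i) := by
      ext e
      simp only [B, ← List.take_concat_get' L i hi, List.map_append, Set.mem_ofPred_eq,
        List.mem_append, Set.mem_insert_iff, List.map_cons, List.map_nil, List.mem_singleton]
      exact or_comm
    have hnew : s(L[i].1, L[i].2) ∉ B i := by
      have h1 : (L.take (i + 1)).map (fun p => s(p.1, p.2)) <+: L.map fun p => s(p.1, p.2) :=
        (List.take_prefix _ _).map _
      have h2 := h1.sublist.nodup hnd
      rw [← List.take_concat_get' L i hi, List.map_append, List.nodup_append] at h2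
      exact fun h => h2.2.2 _ h _ (List.mem_singleton.2 rfl) rfl
    refine wp_storeEdge hW h.reg_zero (by rw [h2]; exact h.fst i hi) (by rw [h2]; exact h.snd i hi)
      (by omega) (hne i hi) hnew hB fun s' k k1 k2 k3 => ?_
    refine ⟨h.congr (k1 _ ?_ ?_ ?_) (k1 _ ?_ ?_ ?_) (k _ ?_ ?_ ?_ ?_) (k _ ?_ ?_ ?_ ?_)
      (k _ ?_ ?_ ?_ ?_), by omega, hB' ▸ k3, (k1 _ ?_ ?_ ?_).trans h3,
      (k _ ?_ ?_ ?_ ?_).trans h12, (k _ ?_ ?_ ?_ ?_).trans h13⟩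
    all_goals decide
  · rintro s' ⟨h, h2, -⟩
    simp [Cmp.holds, h.reg_one, h2]
  · refine ⟨hs.congr rfl rfl rfl rfl rfl, rfl, ?_, rfl, rfl, rfl⟩
    have : B 0 = ∅ := by
      ext e
      simp [B]
    rw [this]
    exact ⟨hs0.1, hs0.2, hs0.3, hs0.4⟩
  · rintro s' ⟨h, -, hB, h3, h12, h13⟩
    have : B L.length = A := by
      ext e
      rw [← hA e]
      simp only [B, List.take_length]
      rfl
    exact ⟨h, this ▸ hB, h3, h12, h13⟩

/-- Raise the degrees of the ends of the first edge of the list by two, so that these two vertices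
never get into the queue. -/
def markRoots : Cmd :=
  .seq (put 3 (get 0 (lit 0)) (get 3 (get 0 (lit 0)) + lit 2))
    (put 3 (get 1 (lit 0)) (get 3 (get 1 (lit 0)) + lit 2))

/-- The amount by which the degree of `v` is raised when `p` and `q` are marked. -/
def mark (p q v : Fin n) : ℕ :=
  if v = p ∨ v = q then 2 else 0

theorem wp_markRoots (hW : Wide n W) {Q : State → Prop} {p q : Fin n} (hpq : p ≠ q)
    {d : Fin n → ℕ} (hd : ∀ v : Fin n, s.arr 3 v = d v) (hdn : ∀ v, d v ≤ n) (hp : s.arr 0 0 = p)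
    (hq : s.arr 1 0 = q)
    (hQ : ∀ s' : State, (∀ k, k ≠ 3 → s'.arr k = s.arr k) → s'.reg = s.reg →
      (∀ v : Fin n, s'.arr 3 v = d v + mark p q v) → Q s') :
    markRoots.wp W Q s := by
  have hn := hW.three_le
  have hqp' : (q : ℕ) ≠ p := fun h => hpq (Fin.ext h.symm)
  have f1 : 2 < W := hW.lt_of_le (by omega)
  have f2 : d p + 2 < W := hW.lt_of_le (by have := hdn p; omega)
  have f3 : d q + 2 < W := hW.lt_of_le (by have := hdn q; omega)
  have f4 : 0 < W := by omega
  simp only [markRoots, Cmd.wp, forall_eq_apply_imp_iff, forall_eq, fits_get, fits_lit, fits_add,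
    val_get, val_lit, val_add, State.arr_setArr, Nat.reduceEqDiff, if_true, if_false, hp, hq,
    true_and, Function.update_of_ne hqp', hd, f1, f2, f3, f4]
  refine hQ _ (fun k hk => by simp [hk]) rfl fun v => ?_
  simp only [State.arr_setArr, if_true, mark]
  by_cases hvq : v = q
  · simp [hvq]
  · have hvq' : (v : ℕ) ≠ q := fun h => hvq (Fin.ext h)
    by_cases hvp : v = p
    · simp [hvp, hqp'.symm]
    · have hvp' : (v : ℕ) ≠ p := fun h => hvp (Fin.ext h)
      simp [hvq, hvq', hvp, hvp', hd]

/-- Put all vertices of degree two into the queue. -/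
def fillQueue : Cmd :=
  .seq (set 2 (lit 0)) <| loop .lt (reg 2) (reg 0) <|
    .seq (ite .eq (get 3 (reg 2)) (lit 2) (push 2) (set 13 (lit 0))) (set 2 (reg 2 + lit 1))

theorem runs_fillQueue (hW : Wide n W) (hs0 : s.reg 0 = n) (hs3 : s.reg 3 = 0) :
    Runs W fillQueue s (fillQueue.time * n) fun s' => s'.reg 0 = s.reg 0 ∧ s'.reg 1 = s.reg 1 ∧
      (∀ k, k ≠ 9 → s'.arr k = s.arr k) ∧ ∃ Q : List (Fin n), Q.Nodup ∧
        (∀ v, v ∈ Q ↔ s.arr 3 v = 2) ∧ Holds (s'.arr 9) Q ∧ s'.reg 3 = Q.length := by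
  have hn := hW.three_le
  refine Runs.seq_mul (runs_of_wp_mul rfl (by omega) ⟨hW.lt_of_le (Nat.zero_le _), ?_⟩)
  rintro v rfl
  let I : ℕ → State → Prop := fun i s' => s'.reg 2 = i ∧ s'.reg 0 = s.reg 0 ∧
    s'.reg 1 = s.reg 1 ∧ (∀ k, k ≠ 9 → s'.arr k = s.arr k) ∧ ∃ Q : List (Fin n), Q.Nodup ∧
      (∀ v, v ∈ Q ↔ (v : ℕ) < i ∧ s.arr 3 v = 2) ∧ Holds (s'.arr 9) Q ∧ s'.reg 3 = Q.length
  refine (runs_loop_of_wp rfl rfl rfl (by omega) I n (by omega)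
    (fun _ _ _ => by exact ⟨trivial, trivial⟩)
    ?_ ?_ ?_).mono le_rfl ?_
  · rintro i hi s' ⟨h2, h0, h1, ak, Q, hnd, hQ, h9, h3⟩
    refine ⟨by simpa [Cmp.holds, h0, h2, hs0], ?_⟩
    have hlen : Q.length ≤ n := by
      have := hnd.length_le_card
      rwa [Fintype.card_fin] at this
    have f1 : Q.length + 1 < W := hW.lt_of_le (by omega)
    have f2 : i + 1 < W := hW.lt_of_le (by omega)
    have f3 : 2 < W := hW.lt_of_le (by omega)
    have f4 : 1 < W := by omega
    have f5 : 0 < W := by omega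
    have a3 := ak 3 (by decide)
    simp only [push, Cmd.wp, forall_eq_apply_imp_iff, forall_eq, fits_get, fits_lit, fits_add,
      fits_reg, val_get, val_lit, val_add, val_reg, State.reg_setReg,
      State.reg_setArr, Nat.reduceEqDiff, if_false, true_and, h2, h3, a3, f1, f2, f3, f4, f5,
      Cmp.holds]
    have hmem : ∀ v : Fin n, (v : ℕ) < i + 1 ↔ (v : ℕ) < i ∨ v = ⟨i, hi⟩ := by
      intro v
      rw [Fin.ext_iff]
      exact Nat.lt_succ_iff_lt_or_eq
    refine ⟨fun h => ?_, fun h => ?_⟩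
    · refine ⟨by simp, by simpa, by simpa, fun k hk => by simp [hk, ak], Q ++ [⟨i, hi⟩], ?_, ?_, ?_,
        by simp⟩
      · rw [List.nodup_append]
        refine ⟨hnd, List.nodup_singleton _, ?_⟩
        rintro u hu w hw rfl
        rw [List.mem_singleton] at hw
        have := ((hQ u).1 hu).1
        rw [hw] at this
        exact lt_irrefl _ this
      · intro v
        rw [List.mem_append, hQ, List.mem_singleton, hmem]
        constructor
        · rintro (h | rfl)
          · exact ⟨.inl h.1, h.2⟩
          · exact ⟨.inr rfl, h⟩
        · rintro ⟨h1 | h1, h2⟩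
          · exact .inl ⟨h1, h2⟩
          · exact .inr h1
      · simpa using h9.append (v := ⟨i, hi⟩) rfl rfl
    · refine ⟨by simp, by simpa, by simpa, fun k hk => by simp [hk, ak], Q, hnd, ?_, by simpa,
        by simpa⟩
      intro v
      rw [hQ, hmem]
      constructor
      · exact fun h => ⟨.inl h.1, h.2⟩
      · rintro ⟨h1 | rfl, h2⟩
        · exact ⟨h1, h2⟩
        · exact absurd h2 h
  · rintro s' ⟨h2, h0, -⟩
    simp [Cmp.holds, h2, h0, hs0]
  · refine ⟨by simp, by simp, by simp, fun k hk => rfl, [], List.nodup_nil, ?_, ?_, by simpa⟩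
    · intro v
      simp
    · intro j v h
      simp at h
  · rintro s' ⟨-, h0, h1, ak, Q, hnd, hQ, h9, h3⟩
    exact ⟨h0, h1, ak, Q, hnd, fun v => by rw [hQ]; exact and_iff_right v.2, h9, h3⟩

end Phases

end RAM

/-! ### The reduction on the machine -/

namespace RAM

section Elimination

open Ex Cmd

variable {n W : ℕ} {s : State} {Q : State → Prop}

/-- Take the next vertex from the queue, find its neighbours, note the triple in the arrays `9`,
`10`, `11`, and update the weight of the edge opposite to the vertex, whose former weight is kept in
register `11`. -/
def removeVertex : Cmd :=
  .seq findNeighbors <| .seq (put 10 (reg 2) (reg 5)) <| .seq (put 11 (reg 2) (reg 6)) <|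
  .seq loadKeys <| .seq (set 11 (get 7 (reg 7))) (put 7 (reg 7) (reg 11 + reg 10))

theorem wp_removeVertex (hW : Wide n W) (h0 : s.reg 0 = n) {x a b : Fin n}
    (hx : s.arr 9 (s.reg 2) = x) (hab : b < a) (h4 : s.arr 4 x = a + b)
    (h5 : s.arr 5 x = a * a + b * b) (h6 : ∀ j < n, s.arr 6 (j * j) = j)
    {S : Sym2 (Fin n) → ℕ} (hS : Rep (s.arr 7) S)
    (hle : S s(a, b) + lighter S (x, a, b) ≤ 2 * n)
    (hQ : ∀ s' : State, (∀ k, k ≠ 7 → k ≠ 10 → k ≠ 11 → s'.arr k = s.arr k) →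
      (∀ r < 4, s'.reg r = s.reg r) → s'.reg 4 = x → s'.reg 5 = a → s'.reg 6 = b →
      s'.reg 11 = S s(a, b) → Rep (s'.arr 7) (upStep S (x, a, b)) →
      s'.arr 10 = Function.update (s.arr 10) (s.reg 2) a →
      s'.arr 11 = Function.update (s.arr 11) (s.reg 2) b → Q s') :
    removeVertex.wp W Q s := by
  have f1 : S s(a, b) + lighter S (x, a, b) < W := hW.lt_of_le (by omega)
  refine wp_findNeighbors hW hx hab h4 h5 h6 fun s₁ a₁ r₁ x4 x5 x6 => ?_
  have r10 : s₁.reg 0 = n := by rw [r₁ 0 (by decide) (by decide) (by decide) (by decide)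
    (by decide), h0]
  have r12 : s₁.reg 2 = s.reg 2 := r₁ 2 (by decide) (by decide) (by decide) (by decide)
    (by decide)
  simp only [Cmd.wp, forall_eq_apply_imp_iff, forall_eq, fits_reg, val_reg, State.reg_setArr,
    true_and]
  refine wp_loadKeys hW (x := x) (a := a) (b := b) (S := S) (by simpa) (by simpa) (by simpa)
    (by simpa) (by simpa [a₁]) fun s₂ a₂ r₂ k7 k8 k9 k10 => ?_
  have hS7 : s₂.arr 7 (key s(a, b)) = S s(a, b) := by
    rw [a₂]
    simp [a₁, hS s(a, b)]
  simp only [fits_reg, fits_get, fits_add, val_get, val_reg, val_add, State.reg_setReg,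
    Nat.reduceEqDiff, if_true, if_false, k7, k10, hS7, true_and]
  refine ⟨f1, hQ _ ?_ ?_ ?_ ?_ ?_ ?_ ?_ ?_ ?_⟩
  · intro k h7 h10 h11
    simp [h7, h10, h11, a₂, a₁]
  · intro r hr
    simp only [State.reg_setArr, State.reg_setReg]
    rw [if_neg (by omega), r₂ r (by omega) (by omega) (by omega) (by omega), State.reg_setArr,
      State.reg_setArr, r₁ r (by omega) (by omega) (by omega) (by omega) (by omega)]
  · simp [r₂, x4]
  · simp [r₂, x5]
  · simp [r₂, x6]
  · simp
  · have := hS.update s(a, b) (S s(a, b) + lighter S (x, a, b))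
    simpa [a₂, a₁, upStep] using this
  · simp [a₂, a₁, r12, x5]
  · simp [a₂, a₁, r12, x6]

theorem Holds.append_ite {f f' : ℕ → ℕ} {l : List (Fin n)} {t t' u : ℕ} {v : Fin n} {C P : Prop}
    [Decidable P] (h : Holds f l) (ht : t = l.length) (hu : u = v) (hC : C ↔ P)
    (h1 : C → t' = t + 1 ∧ f' = Function.update f t u) (h2 : ¬ C → t' = t ∧ f' = f) :
    Holds f' (l ++ if P then [v] else []) ∧ t' = (l ++ if P then [v] else []).length := by
  by_cases hP : P
  · obtain ⟨rfl, rfl⟩ := h1 (hC.2 hP)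
    rw [if_pos hP]
    exact ⟨h.append ht hu, by simp [ht]⟩
  · obtain ⟨rfl, rfl⟩ := h2 (fun h => hP (hC.1 h))
    rw [if_neg hP, List.append_nil]
    exact ⟨h, ht⟩

/-- The state `s` holds the partial reduction with current edges `A`, weights `S`, past steps `l`
and queue `Q`. The sums over neighbours are kept for the vertices that are not removed yet. -/
structure Represents (L : List (Fin n × Fin n)) (p q : Fin n) (A : Set (Sym2 (Fin n)))
    (S : Sym2 (Fin n) → ℕ) (l : List (Fin n × Fin n × Fin n)) (Q : List (Fin n)) (s : State) :
    Prop where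
  setup : Setup L s
  index : s.reg 2 = l.length
  tail : s.reg 3 = (l.map (fun t => t.1) ++ Q).length
  deg : ∀ v : Fin n, (∃ y, s(v, y) ∈ A) → s.arr 3 v = nbSum A 1 v + mark p q v
  sum : ∀ v : Fin n, (∃ y, s(v, y) ∈ A) → s.arr 4 v = nbSum A (fun u => (u : ℕ)) v
  sq : ∀ v : Fin n, (∃ y, s(v, y) ∈ A) → s.arr 5 v = nbSum A (fun u => (u : ℕ) * u) v
  rep : Rep (s.arr 7) S
  queue : Holds (s.arr 9) (l.map (fun t => t.1) ++ Q)
  left : Holds (s.arr 10) (l.map fun t => t.2.1)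
  right : Holds (s.arr 11) (l.map fun t => t.2.2)
  zero_twelve : s.arr 12 = fun _ => 0
  zero_thirteen : s.arr 13 = fun _ => 0

/-- One reduction step. -/
def reduceStep : Cmd :=
  .seq removeVertex <| .seq (relink 5 6) <| .seq (relink 6 5) <| set 2 (reg 2 + lit 1)

theorem wp_reduceStep (hW : Wide n W) {R A : Set (Sym2 (Fin n))} {p q x : Fin n}
    (hpq : p ≠ q) {S₀ S : Sym2 (Fin n) → ℕ} {m k : ℕ} {L : List (Fin n × Fin n)}
    {l : List (Fin n × Fin n × Fin n)} {q' : List (Fin n)} (hm : m ≤ 2 * n)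
    (h : PartialReduction R p q S₀ m k A S l (x :: q')) (hl : l.length ≤ n)
    (hs : Represents L p q A S l (x :: q') s)
    (hQ : ∀ (s' : State) (t : Fin n × Fin n × Fin n) A' S' q'',
      PartialReduction R p q S₀ m (k - 1) A' S' (l ++ [t]) q'' →
      Represents L p q A' S' (l ++ [t]) q'' s' → Q s') :
    reduceStep.wp W Q s := by
  classical
  obtain ⟨a, b, hx, hab⟩ : ∃ a b, HasTwoNeighbors A x a b ∧ b < a := by
    obtain ⟨a, b, hx⟩ := h.exists_hasTwoNeighbors hpq
    rcases lt_or_gt_of_ne hx.ne with h | h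
    · exact ⟨b, a, hx.symm, h⟩
    · exact ⟨a, b, hx, h⟩
  have hn := hW.three_le
  have hne := hx.ne
  have hxa := hx.ne_left
  have hxb := hx.ne_right
  have hba' : (b : ℕ) ≠ a := fun h => hne (Fin.ext h.symm)
  have next := h.step hx
  have hxA : ∃ y, s(x, y) ∈ A := ⟨a, hx.mem_left⟩
  have maA : s(a, x) ∈ A := Sym2.eq_swap ▸ hx.mem_left
  have mbA : s(b, x) ∈ A := Sym2.eq_swap ▸ hx.mem_right
  have haA : ∃ y, s(a, y) ∈ A := ⟨x, maA⟩
  have hbA : ∃ y, s(b, y) ∈ A := ⟨x, mbA⟩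
  have hpos := h.pos_iff _ hx.covers
  have hxq : s.arr 9 (s.reg 2) = x := by
    refine hs.queue _ _ ?_
    rw [hs.index, List.getElem?_append_right (by simp)]
    simp
  have hx4 := (hs.sum x hxA).trans hx.nbSum_eq
  have hx5 := (hs.sq x hxA).trans hx.nbSum_eq
  have hqlen : q'.length < n := by
    have := h.nodup.length_le_card
    rwa [Fintype.card_fin] at this
  have htail := hs.tail
  rw [List.length_append, List.length_map, List.length_cons] at htail
  have mark_le : ∀ v, mark p q v ≤ 2 := by
    intro v
    unfold mark
    split_ifs <;> omega
  -- the new entries of the arrays with the sums over neighbours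
  have upd : ∀ (g : ℕ → ℕ) (f M : Fin n → ℕ),
      (∀ v : Fin n, (∃ y, s(v, y) ∈ A) → g v = nbSum A f v + M v) →
      ∀ v : Fin n, (∃ y, s(v, y) ∈ reduce A x a b) →
      Function.update (Function.update g a (g a - f x + if S s(a, b) = 0 then f b else 0)) b
        (g b - f x + if S s(a, b) = 0 then f a else 0) v = nbSum (reduce A x a b) f v + M v := by
    intro g f M hg v hv
    obtain ⟨hv, hvx⟩ := (hx.exists_mem_reduce_iff v).1 hv
    have e1 := hx.nbSum_reduce (f := f) hvx
    have e2 := hg v hv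
    have e3 := le_nbSum (f := f) maA
    have e4 := le_nbSum (f := f) mbA
    have hiff : s(a, b) ∈ A ↔ ¬ S s(a, b) = 0 := by
      rw [← hpos]
      omega
    by_cases hva : v = a
    · subst hva
      rw [Function.update_of_ne hba'.symm, Function.update_self]
      simp only [hne, if_true, if_false, hiff, ite_not, add_zero] at e1
      omega
    · have hva' : (v : ℕ) ≠ a := fun h => hva (Fin.ext h)
      by_cases hvb : v = b
      · subst hvb
        rw [Function.update_self]
        simp only [hne.symm, if_true, if_false, hiff, ite_not, zero_add] at e1
        omega
      · have hvb' : (v : ℕ) ≠ b := fun h => hvb (Fin.ext h)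
        rw [Function.update_of_ne hvb', Function.update_of_ne hva', e2]
        simp only [hva, hvb, if_false, ite_self, add_zero] at e1
        rw [e1]
  -- the test whether a vertex gets into the queue
  have ready : ∀ u, u ≠ x → (∃ y, s(u, y) ∈ reduce A x a b) → (u = a ∨ u = b) →
      (S s(a, b) ≠ 0 ∧ s.arr 3 u - 1 = 2 ↔
        s(a, b) ∈ A ∧ u ≠ p ∧ u ≠ q ∧ nbSum (reduce A x a b) 1 u = 2) := by
    rintro u hux ⟨y, hy⟩ hu
    rw [show S s(a, b) ≠ 0 ↔ s(a, b) ∈ A by rw [← hpos]; omega]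
    refine and_congr_right fun hm => ?_
    have e1 := hx.nbSum_reduce (f := 1) hux
    have e2 : nbSum (reduce A x a b) 1 u + 1 = nbSum A 1 u := by
      rw [if_pos hm] at e1
      rcases hu with rfl | rfl
      · simpa [hne] using e1
      · simpa [hne.symm] using e1
    have e3 := le_nbSum (f := 1) hy
    rw [Pi.one_apply] at e3
    rw [hs.deg u ((hx.exists_mem_reduce_iff u).1 ⟨y, hy⟩).1, ← e2]
    by_cases hr : u = p ∨ u = q
    · have : ¬ (u ≠ p ∧ u ≠ q ∧ nbSum (reduce A x a b) 1 u = 2) :=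
        fun h => hr.elim h.1 h.2.1
      simp only [mark, if_pos hr, this, iff_false]
      omega
    · simp only [mark, if_neg hr]
      rw [not_or] at hr
      constructor
      · exact fun h => ⟨hr.1, hr.2, by omega⟩
      · rintro ⟨-, -, h⟩
        omega
  have da := hs.deg a haA
  have db := hs.deg b hbA
  have ma := mark_le a
  have mb := mark_le b
  obtain ⟨ba1, ba2, ba3⟩ := nbSum_bounds A a
  obtain ⟨bb1, bb2, bb3⟩ := nbSum_bounds A b
  rw [← hs.sum a haA] at ba2
  rw [← hs.sq a haA] at ba3
  rw [← hs.sum b hbA] at bb2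
  rw [← hs.sq b hbA] at bb3
  refine wp_removeVertex hW hs.setup.reg_zero hxq hab hx4 hx5 hs.setup.sqrt hs.rep
    ((h.weight_add_le hx).trans hm) fun s₁ a₁ r₁ x4 x5 x6 x11 rep₁ w10 w11 => ?_
  have a3 := a₁ 3 (by decide) (by decide) (by decide)
  have a4 := a₁ 4 (by decide) (by decide) (by decide)
  have a5 := a₁ 5 (by decide) (by decide) (by decide)
  have a9 := a₁ 9 (by decide) (by decide) (by decide)
  have t3 := r₁ 3 (by decide)
  refine wp_relink hW (by decide) x4 x5 x6 x.2 b.2 (by rw [a3]; omega) (by rwa [a4])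
    (by rwa [a5]) (by omega) fun s₂ r₂ a₂ c3 c4 c5 cq cq' => ?_
  rw [x11, a3] at cq cq' c3
  rw [x11, a4] at c4
  rw [x11, a5] at c5
  rw [t3, a9] at cq cq'
  have y4 := (r₂ 4 (by decide) (by decide)).trans x4
  have y5 := (r₂ 5 (by decide) (by decide)).trans x5
  have y6 := (r₂ 6 (by decide) (by decide)).trans x6
  have y11 := (r₂ 11 (by decide) (by decide)).trans x11
  have b3 : s₂.arr 3 b = s.arr 3 b := by rw [c3, Function.update_of_ne hba']
  have b4 : s₂.arr 4 b = s.arr 4 b := by rw [c4, Function.update_of_ne hba']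
  have b5 : s₂.arr 5 b = s.arr 5 b := by rw [c5, Function.update_of_ne hba']
  have t3' : s₂.reg 3 ≤ s.reg 3 + 1 := by
    by_cases hc : S s(a, b) ≠ 0 ∧ s.arr 3 a - 1 = 2
    · rw [(cq hc).1]
    · rw [(cq' hc).1]
      omega
  refine wp_relink hW (by decide) y4 y6 y5 x.2 a.2 (by rw [b3]; omega) (by rwa [b4])
    (by rwa [b5]) (by omega) fun s₃ r₃ a₃ d3 d4 d5 dq dq' => ?_
  rw [y11, b3] at dq dq' d3
  rw [y11, b4] at d4
  rw [y11, b5] at d5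
  have hmab : s(a, b) ∈ reduce A x a b := mem_reduce_iff'.2 (.inl rfl)
  have hmba : s(b, a) ∈ reduce A x a b := Sym2.eq_swap ▸ hmab
  obtain ⟨q1, q2⟩ := Holds.append_ite hs.queue hs.tail rfl
    (ready a hxa.symm ⟨b, hmab⟩ (.inl rfl)) cq cq'
  obtain ⟨q3, q4⟩ := Holds.append_ite q1 q2 rfl (ready b hxb.symm ⟨a, hmba⟩ (.inr rfl)) dq dq'
  have hlist : (l.map (fun t => t.1) ++ x :: q' ++ PartialReduction.newlyReady A p q x a b a) ++
      PartialReduction.newlyReady A p q x a b b = (l ++ [(x, a, b)]).map (fun t => t.1) ++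
      (q' ++ (PartialReduction.newlyReady A p q x a b a ++
        PartialReduction.newlyReady A p q x a b b)) := by
    simp
  have i2 : s₃.reg 2 = l.length := by
    rw [r₃ 2 (by decide) (by decide), r₂ 2 (by decide) (by decide), r₁ 2 (by decide), hs.index]
  have f1 : l.length + 1 < W := hW.lt_of_le (by omega)
  have f2 : 1 < W := by omega
  have frame : ∀ k, k ≠ 3 → k ≠ 4 → k ≠ 5 → k ≠ 9 → s₃.arr k = s₁.arr k :=
    fun k k3 k4 k5 k9 => (a₃ k k3 k4 k5 k9).trans (a₂ k k3 k4 k5 k9)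
  have frame' : ∀ k, k < 3 ∨ k = 6 ∨ k = 12 ∨ k = 13 → s₃.arr k = s.arr k := by
    intro k hk
    rw [frame k (by omega) (by omega) (by omega) (by omega),
      a₁ k (by omega) (by omega) (by omega)]
  have hr : ∀ r < 2, s₃.reg r = s.reg r := by
    intro r hr
    rw [r₃ r (by omega) (by omega), r₂ r (by omega) (by omega), r₁ r (by omega)]
  refine ⟨⟨trivial, f2, by change s₃.reg 2 + 1 < W; rwa [i2]⟩, ?_⟩
  rintro v rfl
  refine hQ _ (x, a, b) _ _ _ next ⟨?_, ?_, ?_, ?_, ?_, ?_, ?_, ?_, ?_, ?_, ?_, ?_⟩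
  · refine hs.setup.congr ?_ ?_ (frame' 0 (by decide)) (frame' 1 (by decide))
      (frame' 6 (by decide))
    · simpa using hr 0 (by decide)
    · simpa using hr 1 (by decide)
  · simp [i2]
  · rw [← hlist]
    exact q4
  · intro v hv
    rw [State.arr_setReg, d3, c3]
    have e1 : ∀ u : Fin n, (∃ y, s(u, y) ∈ A) → s.arr 3 u - (if S s(a, b) = 0 then 0 else 1) =
        s.arr 3 u - (1 : Fin n → ℕ) x + if S s(a, b) = 0 then (1 : Fin n → ℕ) u else 0 := by
      rintro u ⟨y, hy⟩
      have := le_nbSum (f := 1) hy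
      have := hs.deg u ⟨y, hy⟩
      simp only [Pi.one_apply] at *
      split_ifs <;> omega
    rw [e1 a haA, e1 b hbA]
    exact upd _ 1 (mark p q) hs.deg v hv
  · intro v hv
    rw [State.arr_setReg, d4, c4]
    exact upd _ (fun u => (u : ℕ)) 0 hs.sum v hv
  · intro v hv
    rw [State.arr_setReg, d5, c5]
    exact upd _ (fun u => (u : ℕ) * u) 0 hs.sq v hv
  · rw [State.arr_setReg, frame 7 (by decide) (by decide) (by decide) (by decide)]
    exact rep₁
  · rw [← hlist]
    exact q3
  · rw [State.arr_setReg, frame 10 (by decide) (by decide) (by decide) (by decide), w10,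
      List.map_append]
    exact hs.left.append (by rw [hs.index, List.length_map]) rfl
  · rw [State.arr_setReg, frame 11 (by decide) (by decide) (by decide) (by decide), w11,
      List.map_append]
    exact hs.right.append (by rw [hs.index, List.length_map]) rfl
  · rw [State.arr_setReg, frame' 12 (by decide), hs.zero_twelve]
  · rw [State.arr_setReg, frame' 13 (by decide), hs.zero_thirteen]

/-- All reduction steps. -/
def reduceAll : Cmd :=
  loop .lt (reg 2) (reg 3) reduceStep

theorem runs_reduceAll (hW : Wide n W) {R : Set (Sym2 (Fin n))} {p q : Fin n}
    (hpq : p ≠ q) {S₀ : Sym2 (Fin n) → ℕ} {m N : ℕ} {L : List (Fin n × Fin n)}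
    {q' : List (Fin n)} (hm : m ≤ 2 * n) (hN : N ≤ n)
    (h : PartialReduction R p q S₀ m N R S₀ [] q') (hs : Represents L p q R S₀ [] q' s) :
    Runs W reduceAll s (reduceAll.time * n) fun s' => ∃ A l, ReductionSeq R p q l R ∧
      l.length = N ∧ Represents L p q A (upPass S₀ l) l [] s' ∧ ∀ e, upPass S₀ l e ≤ m := by
  have hn := hW.three_le
  let I : ℕ → State → Prop := fun i s => ∃ A S l q', PartialReduction R p q S₀ m (N - i) A S l q' ∧
    l.length = i ∧ Represents L p q A S l q' s
  refine (runs_loop_of_wp rfl rfl rfl (by omega) I N (by omega)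
    (fun _ _ _ => by exact ⟨trivial, trivial⟩) ?_ ?_ ⟨_, _, _, _, h, rfl, hs⟩).mono le_rfl ?_
  · rintro i hi s ⟨A, S, l, q', h, hl, hs⟩
    obtain ⟨k, hk⟩ : ∃ k, N - i = k + 1 := ⟨N - i - 1, by omega⟩
    rw [hk] at h
    obtain ⟨x, q', rfl⟩ := List.exists_cons_of_ne_nil h.ne_nil
    refine ⟨?_, ?_⟩
    · simp [Cmp.holds, hs.index, hs.tail]
    · refine wp_reduceStep hW hpq hm h (by omega) hs fun s' t A' S' q'' h' hs' => ?_
      refine ⟨A', S', _, q'', ?_, ?_, hs'⟩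
      · rwa [show N - (i + 1) = k + 1 - 1 by omega]
      · simp [hl]
  · rintro s ⟨A, S, l, q', h, hl, hs⟩
    rw [Nat.sub_self] at h
    rw [h.eq_nil] at hs
    simp [Cmp.holds, hs.index, hs.tail]
  · rintro s ⟨A, S, l, q', h, hl, hs⟩
    rw [Nat.sub_self] at h
    rw [h.eq_nil] at hs
    refine ⟨A, l, h.reductionSeq, hl, ?_, ?_⟩
    · rwa [← h.weight]
    · rw [← h.weight]
      exact h.le

end Elimination

end RAM

/-! ### The choice of the tree on the machine -/

namespace RAM

section Choice

open Ex Cmd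

variable {n W : ℕ} {s : State} {Q : State → Prop}

/-- Write the least of two values at an index of an array. -/
def putMin (a : ℕ) (e f g : Ex) : Cmd :=
  ite .le f g (put a e f) (put a e g)

theorem wp_putMin {a : ℕ} {e f g : Ex} (he : e.Fits W s) (hf : f.Fits W s) (hg : g.Fits W s)
    (hQ : Q (s.setArr a (e.val s) (min (f.val s) (g.val s)))) : (putMin a e f g).wp W Q s := by
  refine ⟨hf, hg, fun h => ⟨he, hf, ?_⟩, fun h => ⟨he, hg, ?_⟩⟩
  · rintro i v rfl rfl
    rwa [min_eq_left h] at hQ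
  · rintro i v rfl rfl
    rwa [min_eq_right (not_le.1 h).le] at hQ

/-- Leave out the lighter one of the two edges at the first vertex of the triple. -/
def chooseLeaf : Cmd :=
  ite .le (get 7 (reg 8)) (get 7 (reg 9))
    (.seq (put 13 (reg 8) (lit 0)) (put 13 (reg 9) (lit 1)))
    (.seq (put 13 (reg 8) (lit 1)) (put 13 (reg 9) (lit 0)))

/-- Update the tree, array `13`, at a triple; register `10` holds the least weight of the edges at
the first vertex, and register `11` the price of leaving through the opposite edge. -/
def chooseEdges : Cmd :=
  ite .eq (get 13 (reg 7)) (lit 1)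
    (ite .le (reg 11) (reg 10)
      (.seq (put 13 (reg 7) (lit 0)) <| .seq (put 13 (reg 8) (lit 1)) (put 13 (reg 9) (lit 1)))
      chooseLeaf)
    chooseLeaf

theorem wp_chooseEdges (hW : Wide n W) {x a b : Fin n} (h7 : s.reg 7 = key s(a, b))
    (h8 : s.reg 8 = key s(x, a)) (h9 : s.reg 9 = key s(x, b)) {F D C : Sym2 (Fin n) → ℕ}
    (h10 : s.reg 10 = lighter F (x, a, b)) (h11 : s.reg 11 = around F D (x, a, b))
    (hF : Rep (s.arr 7) F) (hC : Rep (s.arr 13) C)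
    (hQ : ∀ s' : State, s'.reg = s.reg → (∀ k, k ≠ 13 → s'.arr k = s.arr k) →
      Rep (s'.arr 13) (treeStep F D C (x, a, b)) → Q s') :
    chooseEdges.wp W Q s := by
  have f1 : 1 < W := hW.lt_of_le (by have := hW.three_le; omega)
  have f0 : 0 < W := by omega
  have leaf : ¬ (C s(a, b) = 1 ∧ around F D (x, a, b) ≤ lighter F (x, a, b)) →
      chooseLeaf.wp W Q s := by
    intro hc
    refine ⟨trivial, trivial, fun h => ?_, fun h => ?_⟩
    all_goals
      simp only [Cmp.holds, val_get, val_reg, h8, h9, hF _] at h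
      simp only [Cmd.wp, forall_eq_apply_imp_iff, forall_eq, fits_reg, fits_lit, val_reg, val_lit,
        State.reg_setArr, true_and, f0, f1, h8, h9]
      refine hQ _ rfl (fun k hk => by simp [hk]) ?_
      rw [treeStep, if_neg hc]
    · rw [if_pos h]
      simpa using (hC.update s(x, a) 0).update s(x, b) 1
    · rw [if_neg h]
      simpa using (hC.update s(x, a) 1).update s(x, b) 0
  refine ⟨trivial, f1, fun h => ⟨trivial, trivial, fun h' => ?_, fun h' => leaf fun hc => ?_⟩,
    fun h => leaf fun hc => ?_⟩
  · simp only [Cmp.holds, val_get, val_reg, val_lit, h7, h10, h11, hC _] at h h'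
    simp only [Cmd.wp, forall_eq_apply_imp_iff, forall_eq, fits_reg, fits_lit, val_reg, val_lit,
      State.reg_setArr, true_and, f0, f1, h7, h8, h9]
    refine hQ _ rfl (fun k hk => by simp [hk]) ?_
    rw [treeStep, if_pos ⟨h, h'⟩]
    simpa using ((hC.update s(a, b) 0).update s(x, a) 1).update s(x, b) 1
  · simp only [Cmp.holds, val_reg, h10, h11] at h'
    exact h' hc.2
  · simp only [Cmp.holds, val_get, val_reg, val_lit, h7, hC _] at h
    exact h hc.1

/-- The state `s` holds the results of the pass downwards after it has come to the index `j` of the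
list `l` of reduction steps. -/
structure Descended (L : List (Fin n × Fin n)) (p q : Fin n) (F : Sym2 (Fin n) → ℕ)
    (l : List (Fin n × Fin n × Fin n)) (j : ℕ) (s : State) : Prop where
  setup : Setup L s
  index : s.reg 2 = j
  rep : Rep (s.arr 7) F
  vertex : Holds (s.arr 9) (l.map fun t => t.1)
  left : Holds (s.arr 10) (l.map fun t => t.2.1)
  right : Holds (s.arr 11) (l.map fun t => t.2.2)
  repD : Rep (s.arr 12) (downD F (l.drop j))
  repC : Rep (s.arr 13) (downC F p q (l.drop j))

/-- One step of the pass downwards. -/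
def descendStep : Cmd :=
  .seq (set 2 (reg 2 - lit 1)) <| .seq (set 4 (get 9 (reg 2))) <|
  .seq (set 5 (get 10 (reg 2))) <| .seq (set 6 (get 11 (reg 2))) <| .seq loadKeys <|
  .seq (set 11 (get 7 (reg 7) - reg 10 + get 12 (reg 7))) <|
  .seq (putMin 12 (reg 8) (get 7 (reg 9)) (reg 11)) <|
  .seq (putMin 12 (reg 9) (get 7 (reg 8)) (reg 11)) chooseEdges

theorem downD_le {F : Sym2 (Fin n) → ℕ} {m : ℕ} (hF : ∀ e, F e ≤ m)
    (l : List (Fin n × Fin n × Fin n)) (e : Sym2 (Fin n)) : downD F l e ≤ m := by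
  induction l with
  | nil => exact Nat.zero_le _
  | cons t l ih =>
    simp only [downD, Function.update_apply]
    split_ifs
    · exact (min_le_left _ _).trans (hF _)
    · exact (min_le_left _ _).trans (hF _)
    · exact ih

theorem wp_descendStep (hW : Wide n W) {L : List (Fin n × Fin n)} {p q : Fin n}
    {F : Sym2 (Fin n) → ℕ} (hF : ∀ e, F e ≤ 2 * n) {l : List (Fin n × Fin n × Fin n)} {j : ℕ}
    (hj : j < l.length) (hl : l.length ≤ n) (hs : Descended L p q F l (j + 1) s)
    (hQ : ∀ s', Descended L p q F l j s' → Q s') : descendStep.wp W Q s := by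
  have hn := hW.three_le
  have hdrop : l.drop j = l[j] :: l.drop (j + 1) := List.drop_eq_getElem_cons hj
  set K := l.drop (j + 1) with hK
  rcases ht : l[j] with ⟨x, a, b⟩
  rw [ht] at hdrop
  have g9 : s.arr 9 j = x := hs.vertex j x (by simp [hj, ht])
  have g10 : s.arr 10 j = a := hs.left j a (by simp [hj, ht])
  have g11 : s.arr 11 j = b := hs.right j b (by simp [hj, ht])
  have f1 : 1 < W := hW.lt_of_le (by omega)
  have f2 : j < W := hW.lt_of_le (by omega)
  simp only [descendStep, Cmd.wp, forall_eq, fits_reg, fits_sub, fits_lit, fits_get, val_reg,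
    val_sub, val_lit, val_get, State.reg_setReg, State.arr_setReg, Nat.reduceEqDiff, if_true,
    if_false, hs.index, Nat.add_sub_cancel, g9, g10, g11, true_and, f1, f2]
  refine wp_loadKeys hW (x := x) (a := a) (b := b) (S := F) (by simpa using hs.setup.reg_zero)
    (by simp) (by simp) (by simp) (by simpa using hs.rep) fun s₁ a₁ r₁ k7 k8 k9 k10 => ?_
  have hF7 : Rep (s₁.arr 7) F := by
    intro e
    rw [a₁]
    exact hs.rep e
  have hD : Rep (s₁.arr 12) (downD F K) := by
    intro e
    rw [a₁]
    exact hs.repD e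
  have b1 := hF s(a, b)
  have b2 := downD_le hF K s(a, b)
  have f3 : F s(a, b) - lighter F (x, a, b) < W := hW.lt_of_le (by omega)
  have f4 : F s(a, b) - lighter F (x, a, b) + downD F K s(a, b) < W := hW.lt_of_le (by omega)
  simp only [fits_reg, fits_sub, fits_add, fits_get, val_reg, val_sub, val_add, val_get,
    k7, k10, hF7 _, hD _, true_and, f3, f4]
  refine wp_putMin trivial trivial trivial ?_
  refine wp_putMin trivial trivial trivial ?_
  refine wp_chooseEdges hW (x := x) (a := a) (b := b) (F := F) (D := downD F K)
    (C := downC F p q K) (by simp [k7]) (by simp [k8]) (by simp [k9]) (by simp [k10])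
    (by simp [around]) ?_ ?_ ?_
  · simpa using hF7
  · intro e
    simpa [a₁] using hs.repC e
  intro s' hr hk hC
  refine hQ s' ⟨?_, ?_, ?_, ?_, ?_, ?_, ?_, ?_⟩
  · refine hs.setup.congr ?_ ?_ ?_ ?_ ?_
    · simp [hr, r₁]
    · simp [hr, r₁]
    · simp [hk, a₁]
    · simp [hk, a₁]
    · simp [hk, a₁]
  · simp [hr, r₁]
  · simpa [hk] using hF7
  · simpa [hk, a₁] using hs.vertex
  · simpa [hk, a₁] using hs.left
  · simpa [hk, a₁] using hs.right
  · have := (hD.update s(x, a) (min (F s(x, b)) (around F (downD F K) (x, a, b)))).update s(x, b)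
      (min (F s(x, a)) (around F (downD F K) (x, a, b)))
    rw [hdrop]
    simpa [hk, downD, around, k8, k9, hF7 _] using this
  · rw [hdrop]
    exact hC

/-- The pass downwards: begin with the first edge of the list as the tree, and go through the
reduction steps backwards. -/
def descend : Cmd :=
  .seq (.seq (set 5 (get 0 (lit 0))) <| .seq (set 6 (get 1 (lit 0))) (put 13 (keyE 5 6) (lit 1))) <|
    loop .lt (lit 0) (reg 2) descendStep

theorem runs_descend (hW : Wide n W) {L : List (Fin n × Fin n)} {p q : Fin n}
    (hp : s.arr 0 0 = p) (hq : s.arr 1 0 = q) {A : Set (Sym2 (Fin n))} {F : Sym2 (Fin n) → ℕ}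
    (hF : ∀ e, F e ≤ 2 * n) {l : List (Fin n × Fin n × Fin n)} (hl : l.length ≤ n)
    (hs : Represents L p q A F l [] s) :
    Runs W descend s (descend.time * n) (Descended L p q F l 0) := by
  have hn := hW.three_le
  have f1 : 1 < W := hW.lt_of_le (by omega)
  have f0 : 0 < W := by omega
  refine Runs.seq_mul (runs_of_wp_mul rfl (by omega) ?_)
  simp only [Cmd.wp, forall_eq_apply_imp_iff, forall_eq, fits_lit, fits_get, val_get, val_lit,
    State.arr_setReg, hp, hq, true_and, f0, f1]
  refine ⟨fits_keyE hW (u := p) (v := q) (by simpa using hs.setup.reg_zero) (by simp) (by simp), ?_⟩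
  rw [val_keyE (n := n) (u := p) (v := q) (by simpa using hs.setup.reg_zero) (by simp) (by simp)]
  refine (runs_loop_of_wp rfl rfl rfl (by omega)
    (fun i s => Descended L p q F l (l.length - i) s) l.length (by omega)
    (fun _ _ _ => by exact ⟨f0, trivial⟩) ?_ ?_ ?_).mono le_rfl ?_
  · rintro i hi s hs
    obtain ⟨j, hj⟩ : ∃ j, l.length - i = j + 1 := ⟨l.length - i - 1, by omega⟩
    rw [hj] at hs
    refine ⟨by simp [Cmp.holds, hs.index], ?_⟩
    refine wp_descendStep hW hF (by omega) hl hs fun s' hs' => ?_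
    rwa [show l.length - (i + 1) = j by omega]
  · rintro s hs
    simp [Cmp.holds, hs.index]
  · refine ⟨hs.setup.congr rfl rfl rfl rfl rfl, by simp [hs.index], hs.rep, ?_, hs.left, hs.right,
      ?_, ?_⟩
    · simpa using hs.queue
    · intro e
      simp [hs.zero_twelve, downD]
    · have h0 : Rep (s.arr 13) (0 : Sym2 (Fin n) → ℕ) := fun e => by rw [hs.zero_thirteen]; rfl
      simpa [downC, Pi.single] using h0.update s(p, q) 1
  · intro s hs
    rwa [Nat.sub_self] at hs

/-- Mark the edges of the tree in the list. -/
def output : Cmd :=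
  .seq (set 2 (lit 0)) <| loop .lt (reg 2) (reg 1) <|
    .seq (set 5 (get 0 (reg 2))) <| .seq (set 6 (get 1 (reg 2))) <|
    .seq (put 2 (reg 2) (get 13 (keyE 5 6))) (set 2 (reg 2 + lit 1))

theorem runs_output (hW : Wide n W) {L : List (Fin n × Fin n)} {C : Sym2 (Fin n) → ℕ}
    (hL : L.length ≤ 2 * n) (hs : Setup L s) (hC : Rep (s.arr 13) C) :
    Runs W output s (output.time * n) fun s' =>
      ∀ i (h : i < L.length), s'.arr 2 i = C s(L[i].1, L[i].2) := by
  have hn := hW.three_le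
  refine Runs.seq_mul (runs_of_wp_mul rfl (by omega) ⟨hW.lt_of_le (Nat.zero_le _), ?_⟩)
  rintro v rfl
  let I : ℕ → State → Prop := fun i s => Setup L s ∧ s.reg 2 = i ∧ Rep (s.arr 13) C ∧
    ∀ j (h : j < L.length), j < i → s.arr 2 j = C s(L[j].1, L[j].2)
  refine (runs_loop_of_wp rfl rfl rfl (by omega) I L.length hL
    (fun _ _ _ => by exact ⟨trivial, trivial⟩) ?_ ?_ ?_).mono le_rfl ?_
  · rintro i hi s ⟨h, h2, hC, h3⟩
    refine ⟨by simpa [Cmp.holds, h.reg_one, h2], ?_⟩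
    have g0 := h.fst i hi
    have g1 := h.snd i hi
    have f1 : 1 < W := hW.lt_of_le (by omega)
    have f2 : i + 1 < W := hW.lt_of_le (by omega)
    simp only [Cmd.wp, forall_eq_apply_imp_iff, forall_eq, fits_lit, fits_get, fits_reg, fits_add,
      val_get, val_lit, val_reg, val_add, State.reg_setReg, State.arr_setReg, State.reg_setArr,
      Nat.reduceEqDiff, if_false, h2, g0, g1, true_and, f1, f2]
    refine ⟨fits_keyE hW (u := L[i].1) (v := L[i].2) (by simpa using h.reg_zero) (by simp)
      (by simp), ?_⟩
    rw [val_keyE (n := n) (u := L[i].1) (v := L[i].2) (by simpa using h.reg_zero) (by simp)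
      (by simp), hC]
    refine ⟨h.congr rfl rfl rfl rfl rfl, by simp, hC, ?_⟩
    intro j hj hji
    by_cases hij : j = i
    · subst hij
      simp
    · simpa [hij] using h3 j hj (by omega)
  · rintro s ⟨h, h2, -⟩
    simp [Cmp.holds, h.reg_one, h2]
  · exact ⟨hs.congr rfl rfl rfl rfl rfl, rfl, hC, fun j _ h => absurd h (Nat.not_lt_zero _)⟩
  · rintro s ⟨-, -, -, h⟩ i hi
    exact h i hi hi

end Choice

end RAM

/-! ### Correctness and running time -/

section Main

theorem SimpleGraph.Subgraph.IsPolygonal2Tree.verts_nonempty {V : Type*} {G : SimpleGraph V}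
    {H : G.Subgraph} (hH : H.IsPolygonal2Tree) : H.verts.Nonempty := by
  induction hH with
  | cycle p hp => exact ⟨_, p.start_mem_verts_toSubgraph⟩
  | addPath _ _ _ _ _ _ _ ih => exact ih.mono Set.subset_union_left

theorem SimpleGraph.Subgraph.IsPolygonal2Tree.three_le_card {V : Type*} [Fintype V]
    {G : SimpleGraph V} {H : G.Subgraph} (hH : H.IsPolygonal2Tree) : 3 ≤ Fintype.card V := by
  induction hH with
  | cycle p hp =>
    have h1 := hp.support_nodup.length_le_card
    rw [List.length_tail, SimpleGraph.Walk.length_support, Nat.add_sub_cancel] at h1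
    exact hp.three_le_length.trans h1
  | addPath _ _ _ _ _ _ _ ih => exact ih

namespace RAM

variable {n : ℕ} {G : SimpleGraph (Fin n)} {L : List (Fin n × Fin n)}

theorem ncard_edgeSet (hL : IsEdgeList G L) : G.edgeSet.ncard = L.length := by
  classical
  have h1 := List.toFinset_card_of_nodup hL.1
  rw [List.length_map] at h1
  rw [← h1, ← Set.ncard_coe_finset]
  congr 1
  ext e
  rw [← hL.2 e, List.coe_toFinset]
  rfl

/-- At the beginning no step is done, all weights are one, and the queue holds the vertices of
degree two other than the ends of the first edge. -/
theorem partialReduction_nil (hL : IsEdgeList G L) {p q : Fin n} {k : ℕ}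
    (hred : Reducible G.edgeSet p q k G.edgeSet) (hpos : 0 < L.length) {Q : List (Fin n)}
    (hnd : Q.Nodup) (hQ : ∀ v, v ∈ Q ↔ v ≠ p ∧ v ≠ q ∧ nbSum G.edgeSet 1 v = 2) :
    PartialReduction G.edgeSet p q (G.edgeSet.indicator 1) L.length k G.edgeSet
      (G.edgeSet.indicator 1) [] Q := by
  classical
  refine ⟨hred, fun K hK => hK, rfl, ?_, ?_, ?_, hnd, hQ⟩
  · intro e _
    by_cases he : e ∈ G.edgeSet <;> simp [he]
  · intro e
    by_cases he : e ∈ G.edgeSet <;> simp [he]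
    omega
  · rw [← ncard_edgeSet hL, Set.ncard_eq_toFinset_card', Finset.card_eq_sum_ones]
    refine (Finset.sum_subset_zero_on_sdiff (Finset.subset_univ _) (fun e he => ?_)
      fun e he => ?_).ge
    · rw [Finset.mem_sdiff, Set.mem_toFinset] at he
      exact if_neg he.2
    · rw [Set.mem_toFinset] at he
      simp [he]

/-- The program for a minimum average stretch spanning tree.

Registers: `0` and `1` hold the numbers of vertices and of edges, `2` the loop index, `3` the end of
the queue, `4`, `5`, `6` a removed vertex `x` and its neighbours `a`, `b`, and `7`, `8`, `9` the
indices of the pairs `ab`, `xa`, `xb`.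

Arrays: `0`, `1` hold the input and `2` the output; `3`, `4`, `5` the degrees, the sums of the
neighbours, and the sums of their squares; `6` the square roots; `7` the weights; `9` the queue, and
with `10`, `11` the reduction steps; `12`, `13` the functions `downD` and `downC`. -/
def spanningTree : Cmd :=
  .seq squareRoots <| .seq storeEdges <| .seq markRoots <| .seq fillQueue <|
  .seq (.set 2 (.lit 0)) <| .seq reduceAll <| .seq descend output

theorem outputGraph_eq (hL : IsEdgeList G L) {C : Sym2 (Fin n) → ℕ} (hC : indicatorGraph C ≤ G)
    {s : State} (hs : ∀ i (h : i < L.length), s.arr 2 i = C s(L[i].1, L[i].2)) :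
    outputGraph L s = indicatorGraph C := by
  ext u v
  constructor
  · rw [outputGraph, SimpleGraph.fromEdgeSet_adj]
    rintro ⟨⟨i, hi, h1, h2⟩, hne⟩
    rw [indicatorGraph_adj, h2, ← hs i hi]
    exact ⟨h1, hne⟩
  · intro h
    obtain ⟨i, hi, h1⟩ := List.mem_iff_getElem.1 ((hL.2 s(u, v)).2 (hC h))
    rw [List.length_map] at hi
    rw [List.getElem_map] at h1
    refine (SimpleGraph.fromEdgeSet_adj _).2 ⟨⟨i, hi, ?_, h1.symm⟩, h.ne⟩
    rw [hs i hi, h1]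
    exact (indicatorGraph_adj.1 h).1

theorem runs_spanningTree {W : ℕ} (hW : Wide n W) (hG : G.IsPolygonal2Tree)
    (hL : IsEdgeList G L) :
    Runs W spanningTree (inputState L) (spanningTree.time * n) fun s =>
      G.IsMinAvgStretchSpanningTree (outputGraph L s) := by
  have hn := hW.three_le
  have hadj : ∀ v, ∃ w, G.Adj v w := by
    intro v
    obtain ⟨w, hw⟩ := SimpleGraph.Subgraph.IsPolygonal2Tree.exists_adj hG
      (Set.mem_univ v)
    exact ⟨w, hw⟩
  have hedge : ∀ i (h : i < L.length), G.Adj L[i].1 L[i].2 := by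
    intro i hi
    rw [← SimpleGraph.mem_edgeSet, ← hL.2]
    exact List.mem_map_of_mem (f := fun p => s(p.1, p.2)) (List.getElem_mem hi)
  have hpos : 0 < L.length := by
    obtain ⟨v, -⟩ := hG.verts_nonempty
    obtain ⟨w, hw⟩ := hadj v
    have := (hL.2 s(v, w)).2 hw
    rw [List.length_pos_iff]
    rintro rfl
    simp at this
  obtain ⟨p, hp⟩ : ∃ p, p = L[0].1 := ⟨_, rfl⟩
  obtain ⟨q, hq⟩ : ∃ q, q = L[0].2 := ⟨_, rfl⟩
  have hadj' : G.Adj p q := by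
    rw [hp, hq]
    exact hedge 0 hpos
  have hpq := hadj'.ne
  obtain ⟨k, hk⟩ := SimpleGraph.Subgraph.IsPolygonal2Tree.reducible hG (c := p) (d := q) hadj'
  rw [SimpleGraph.Subgraph.edgeSet_top] at hk
  have hkn : k + 2 ≤ n := by
    obtain ⟨K, rfl, hK⟩ := hk.exists_reductionSeq
    have := hK.length_add_two_le hpq
    rwa [Fintype.card_fin] at this
  have hm : L.length ≤ 2 * n := by
    have := hk.ncard_le
    rw [ncard_edgeSet hL] at this
    omega
  refine Runs.seq_mul ((runs_squareRoots hW).mono le_rfl ?_)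
  rintro s₁ ⟨h₁, t₁, z₁⟩
  have st₁ : Stored (∅ : Set (Sym2 (Fin n))) s₁ := by
    refine ⟨fun v => ?_, fun v => ?_, fun v => ?_, fun e => ?_⟩
    · rw [z₁ 3 (by decide) (by decide) (by decide), nbSum_eq_zero fun _ => Set.notMem_empty _]
    · rw [z₁ 4 (by decide) (by decide) (by decide), nbSum_eq_zero fun _ => Set.notMem_empty _]
    · rw [z₁ 5 (by decide) (by decide) (by decide), nbSum_eq_zero fun _ => Set.notMem_empty _]
    · rw [z₁ 7 (by decide) (by decide) (by decide)]
      simp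
  refine Runs.seq_mul ((runs_storeEdges hW hm (fun i hi => (hedge i hi).ne) hL.1 hL.2 h₁ st₁).mono
    le_rfl ?_)
  rintro s₂ ⟨h₂, st₂, t₂, d₂, c₂⟩
  have p₂ : s₂.arr 0 0 = p := by rw [hp]; exact h₂.fst 0 hpos
  have q₂ : s₂.arr 1 0 = q := by rw [hq]; exact h₂.snd 0 hpos
  refine Runs.seq_mul (runs_of_wp_mul rfl (by omega)
    (wp_markRoots hW hpq st₂.deg (fun v => (nbSum_bounds _ v).1) p₂ q₂ ?_))
  intro s₃ a₃ r₃ deg₃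
  have h₃ : Setup L s₃ := h₂.congr (by rw [r₃]) (by rw [r₃]) (a₃ 0 (by decide)) (a₃ 1 (by decide))
    (a₃ 6 (by decide))
  refine Runs.seq_mul ((runs_fillQueue hW h₃.reg_zero (by rw [r₃, t₂, t₁])).mono le_rfl ?_)
  rintro s₄ ⟨n₄, m₄, a₄, Q, hnd, hQ, q₄, t₄⟩
  have h₄ : Setup L s₄ := h₃.congr n₄ m₄ (a₄ 0 (by decide)) (a₄ 1 (by decide)) (a₄ 6 (by decide))
  have frame : ∀ k, k ≠ 3 → k ≠ 9 → s₄.arr k = s₂.arr k :=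
    fun k k3 k9 => (a₄ k k9).trans (a₃ k k3)
  have hQ' : ∀ v, v ∈ Q ↔ v ≠ p ∧ v ≠ q ∧ nbSum G.edgeSet 1 v = 2 := by
    intro v
    rw [hQ, deg₃]
    obtain ⟨w, hw⟩ := hadj v
    have h1 := le_nbSum (f := 1) ((SimpleGraph.mem_edgeSet G).2 hw)
    rw [Pi.one_apply] at h1
    by_cases hr : v = p ∨ v = q
    · rw [mark, if_pos hr]
      exact iff_of_false (by omega) fun h => hr.elim h.1 h.2.1
    · rw [mark, if_neg hr]
      rw [not_or] at hr
      exact ⟨fun h => ⟨hr.1, hr.2, h⟩, fun h => h.2.2⟩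
  refine Runs.seq_mul (runs_of_wp_mul rfl (by omega) ⟨hW.lt_of_le (Nat.zero_le _), ?_⟩)
  rintro v rfl
  have rep₅ : Represents L p q G.edgeSet (G.edgeSet.indicator 1) [] Q (s₄.setReg 2 0) := by
    refine ⟨h₄.congr rfl rfl rfl rfl rfl, rfl, by simpa using t₄, fun v _ => ?_, fun v _ => ?_,
      fun v _ => ?_, ?_, by simpa using q₄, fun j v h => by simp at h, fun j v h => by simp at h,
      ?_, ?_⟩
    · rw [State.arr_setReg, a₄ 3 (by decide), deg₃]
    · rw [State.arr_setReg, frame 4 (by decide) (by decide), st₂.sum]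
    · rw [State.arr_setReg, frame 5 (by decide) (by decide), st₂.sq]
    · rw [State.arr_setReg, frame 7 (by decide) (by decide)]
      exact st₂.rep
    · rw [State.arr_setReg, frame 12 (by decide) (by decide), d₂,
        z₁ 12 (by decide) (by decide) (by decide)]
    · rw [State.arr_setReg, frame 13 (by decide) (by decide), c₂,
        z₁ 13 (by decide) (by decide) (by decide)]
  refine Runs.seq_mul ((runs_reduceAll hW hpq hm (by omega)
    (partialReduction_nil hL hk hpos hnd hQ') rep₅).mono le_rfl ?_)
  rintro s₆ ⟨A, l, hl, hlen, rep₆, hF⟩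
  have p₆ : s₆.arr 0 0 = p := by rw [hp]; exact rep₆.setup.fst 0 hpos
  have q₆ : s₆.arr 1 0 = q := by rw [hq]; exact rep₆.setup.snd 0 hpos
  refine Runs.seq_mul ((runs_descend hW p₆ q₆ (fun e => (hF e).trans hm) (by omega) rep₆).mono
    le_rfl ?_)
  intro s₇ h₇
  have hopt := hl.isMinAvgStretchSpanningTree hpq hadj (S := G.edgeSet.indicator 1) rfl
    (fun e he => Set.indicator_of_notMem he _) (fun e he => Set.indicator_of_mem he _)
  refine (runs_output hW hm h₇.setup h₇.repC).mono le_rfl fun s₈ h₈ => ?_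
  rw [List.drop_zero] at h₈
  rwa [outputGraph_eq hL hopt.1.1 h₈]

end RAM

theorem wide_pow {n : ℕ} (hn : 3 ≤ n) : RAM.Wide n (n ^ 8) := by
  refine ⟨hn, ?_⟩
  have h1 : 3 ^ 5 ≤ n ^ 5 := Nat.pow_le_pow_left hn 5
  have h2 : n ^ 8 = n ^ 5 * (n * n * n) := by ring
  rw [h2]
  exact Nat.mul_le_mul_right _ (le_trans (by norm_num) h1)

theorem one_le_log {n : ℕ} (hn : 3 ≤ n) : 1 ≤ Real.log n := by
  have h1 : (3 : ℝ) ≤ n := by exact_mod_cast hn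
  rw [Real.le_log_iff_exp_le (by linarith)]
  have := Real.exp_one_lt_d9
  linarith

end Main

theorem theorem1 :
    ∃ (P : RAM.Prog) (c : ℕ) (C : ℝ),
      ∀ (n : ℕ) (G : SimpleGraph (Fin n)), G.IsPolygonal2Tree →
        ∀ L : List (Fin n × Fin n), IsEdgeList G L →
          ∃ (t : ℕ) (s : RAM.State),
            RAM.Exec (n ^ c) P (inputState L) t s ∧
            (t : ℝ) ≤ C * (n * Real.log n) ∧
            G.IsMinAvgStretchSpanningTree (outputGraph L s) := by
  refine ⟨RAM.spanningTree.code, 8, RAM.spanningTree.time, fun n G hG L hL => ?_⟩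
  have hn : 3 ≤ n := by
    have := SimpleGraph.Subgraph.IsPolygonal2Tree.three_le_card hG
    rwa [Fintype.card_fin] at this
  obtain ⟨t, s, s', hrun, ht, hs, hopt⟩ := RAM.runs_spanningTree (wide_pow hn) hG hL
    (inputState L) ⟨rfl, fun _ _ => rfl⟩
  refine ⟨t, s, hrun, ?_, ?_⟩
  · have h1 : (t : ℝ) ≤ RAM.spanningTree.time * n := by exact_mod_cast ht
    refine h1.trans (mul_le_mul_of_nonneg_left ?_ (Nat.cast_nonneg _))
    exact le_mul_of_one_le_right (Nat.cast_nonneg _) (one_le_log hn)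
  · have : outputGraph L s = outputGraph L s' := by rw [outputGraph, outputGraph, hs.1]
    rwa [this]
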